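/- Let $q\in\mathbb C$ with $0<|q|<1$. Write $(x;q)_\infty=\prod_{k\ge 0}(1-xq^k)$ and $(x_1,\dots,x_m;q)_\infty=\prod_i (x_i;q)_\infty$; for $n\in\mathbb Z$ let $(x;q)_n=(x;q)_\infty/(xq^n;q)_\infty$, that is, $(x;q)_n=\prod_{0\le k<n}(1-xq^k)$ for $n\ge 0$ and $(x;q)_n=\prod_{1\le k\le -n}(1-xq^{-k})^{-1}$ for $n<0$. Write $$\Omega(x_1,\dots,x_n;a_1,\dots,a_m)=\prod_{i,j}(x_i/a_j;q)_\infty ,\qquad \theta(x)=\frac1{(q;q)_\infty}\sum_{n\in\mathbb Z}(-1)^nq^{n(n-1)/2}x^n ,\qquad \theta(x_1,\dots,x_m)=\prod_i\theta(x_i),$$ and let $${}_8\psi_8[a;x_1,\dots,x_6;q,t]=\sum_{n\in\mathbb Z}\frac{1-aq^{2n}}{1-a}\prod_{i=1}^{6}\frac{(x_i;q)_n}{(aq/x_i;q)_n}\,t^n,\qquad {}_8W_7[a;x_1,\dots,x_5;q,t]=\sum_{n\ge0}\frac{1-aq^{2n}}{1-a}\frac{(a;q)_n}{(q;q)_n}\prod_{i=1}^{5}\frac{(x_i;q)_n}{(aq/x_i;q)_n}\,t^n$$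 be the very-well-poised series. **Theorem (generalized Weierstrass theta identity).** Let $a,b,c,d,e$ be nonzero complex numbers and $z=bcde/(aq)$, with $|aq/z|<1$. Assume that no denominator vanishes, that is, $a\ne1$ and $(y;q)_\infty\neq0$ for each $y$ among $q/x,\ aq/x,\ x/z$ $(x=b,c,d,e)$, $1/z$, $zq$, $zq/a$, $aq/z^2$. Then the two series below converge absolutely and $$\begin{aligned} {}_8\psi_8[a;b,c,d,e,a/z,z;q,aq/z] &=\Bigl(1-\frac1z\Bigr)\frac{(q,q,aq,q/a;q)_\infty}{(zq/a,q/z,aq/z;q)_\infty}\, \frac{\Omega(aq;bc,bd,be,cd,ce,de,z^2)}{\Omega(aq;b,c,d,e)\,\Omega(1/z;1/b,1/c,1/d,1/e)}\\ &\qquad\times{}_8W_7[1/z;b/z,c/z,d/z,e/z,z/a;q,q]\\ &\quad+\frac1z\,\frac{(q,q,aq,q/a,b,c,d,e;q)_\infty}{(q/z,zq/a,zq,aq/z;q)_\infty}\, \frac{\Omega(aq/z;b,c,d,e)}{\Omega(aq;b,c,d,e)\,\Omega(1/z;1/b,1/c,1/d,1/e)} . \end{aligned}$$ If moreover $z=a$,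 then both series are equal to $1$. The special case $z=a$ corresponds to Weierstrass' theta identity: for all nonzero $a,b,c,d,e$ with $a^2q=bcde$, $$\theta(b,c,d,e)-\theta(a,bc/a,bd/a,be/a)=a\,\theta(b/a,c/a,d/a,e/a),$$ equivalently, for all nonzero $x,a,b,c$, $$\theta(xa,x/a,bc,b/c)-\theta(xc,x/c,ab,b/a)=\frac ba\,\theta(xb,x/b,ac,a/c).$$ -/

import Mathlib

namespace WeierstrassTheta

noncomputable section

/-- `(x; q)_∞ = ∏_{n ≥ 0} (1 - x q^n)`. -/
def qInf (q x : ℂ) : ℂ := ∏' n : ℕ, (1 - x * q ^ n)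

/-- `(x₁, …, x_m; q)_∞`. -/
def qInfs (q : ℂ) (xs : List ℂ) : ℂ := (xs.map (qInf q)).prod

/-- The `q`-shifted factorial `(x; q)_n` for an integer `n`:
`∏_{0 ≤ k < n} (1 - x q^k)` for `n ≥ 0`, and `1 / ∏_{1 ≤ k ≤ -n} (1 - x q^{-k})` for `n < 0`. -/
def qPoch (q x : ℂ) : ℤ → ℂ
  | Int.ofNat n => ∏ k ∈ Finset.range n, (1 - x * q ^ k)
  | Int.negSucc n => (∏ k ∈ Finset.range (n + 1), (1 - x / q ^ (k + 1)))⁻¹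

/-- `Ω(x₁, …, x_n; a₁, …, a_m) = ∏_i ∏_j (x_i / a_j; q)_∞`. -/
def Omega (q : ℂ) (xs as : List ℂ) : ℂ :=
  (xs.map fun x => (as.map fun a => qInf q (x / a)).prod).prod

/-- The Jacobi theta function
`θ(x) = (q; q)_∞⁻¹ ∑_{n ∈ ℤ} (-1)^n q^{n(n-1)/2} x^n` (for `x ≠ 0`). -/
def theta (q x : ℂ) : ℂ :=
  (qInf q q)⁻¹ * ∑' n : ℤ, (-1) ^ n * q ^ (n * (n - 1) / 2) * x ^ n

/-- `θ(x₁, …, x_m) = θ(x₁) ⋯ θ(x_m)`. -/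
def thetas (q : ℂ) (xs : List ℂ) : ℂ := (xs.map (theta q)).prod

/-- The `n`-th term of the bilateral series `_rψ_r` with upper parameters `as`, lower parameters
`bs`, base `q` and argument `z`. -/
def psiTerm (q : ℂ) (as bs : List ℂ) (z : ℂ) (n : ℤ) : ℂ :=
  (as.map fun x => qPoch q x n).prod / (bs.map fun x => qPoch q x n).prod * z ^ n

/-- The `n`-th term of the unilateral series `_{r+1}φ_r` with upper parameters `as`, lower
parameters `bs`, base `q` and argument `z`. -/
def phiTerm (q : ℂ) (as bs : List ℂ) (z : ℂ) (n : ℕ) : ℂ :=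
  (as.map fun x => qPoch q x n).prod / (bs.map fun x => qPoch q x n).prod * (z ^ n / qPoch q q n)

/-- The `n`-th term of the very-well-poised series with special parameter `a` and remaining upper
parameters `xs`; the two upper parameters `±q√a` over `±√a` contribute
`(1 - a q^{2n}) / (1 - a)`, see `vwpTerm_eq_psiTerm`. -/
def vwpTerm (q a : ℂ) (xs : List ℂ) (z : ℂ) (n : ℤ) : ℂ :=
  (1 - a * q ^ (2 * n)) / (1 - a)
    * (xs.map fun x => qPoch q x n / qPoch q (a * q / x) n).prod * z ^ n

/-- The very-well-poised bilateral series `_rψ_r[a; a₃, …, a_r; q, z]`, with `xs = [a₃, …, a_r]`. -/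
def vwpPsi (q a : ℂ) (xs : List ℂ) (z : ℂ) : ℂ := ∑' n : ℤ, vwpTerm q a xs z n

/-- The very-well-poised unilateral series `_{r+1}W_r[a; a₄, …, a_{r+1}; q, z]`, with
`xs = [a₄, …, a_{r+1}]`; its first upper parameter is `a` itself, paired with `q = a q / a`. -/
def vwpW (q a : ℂ) (xs : List ℂ) (z : ℂ) : ℂ := ∑' n : ℕ, vwpTerm q a (a :: xs) z n

/-- Wherever the quotient makes sense, `(x; q)_n = (x; q)_∞ / (x q^n; q)_∞`. -/
theorem qPoch_eq_div {q x : ℂ} (hq0 : q ≠ 0) (hq1 : ‖q‖ < 1) (n : ℤ)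
    (h : qInf q (x * q ^ n) ≠ 0) : qPoch q x n = qInf q x / qInf q (x * q ^ n) := by
  have hm : ∀ y : ℂ, Multipliable fun k : ℕ => 1 - y * q ^ k := by
    intro y
    have : Summable fun k : ℕ => ‖-(y * q ^ k)‖ := by
      simp only [norm_neg, norm_mul, norm_pow]
      exact (summable_geometric_of_lt_one (norm_nonneg _) hq1).mul_left _
    simpa [sub_eq_add_neg] using multipliable_one_add_of_summable this
  have step : ∀ y : ℂ, qInf q y = (1 - y) * qInf q (y * q) := by
    intro y
    unfold qInf
    have h1 : Multipliable fun k : ℕ => 1 - y * q ^ (k + 1) := by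
      simpa [pow_succ', mul_assoc] using hm (y * q)
    rw [tprod_eq_zero_mul' (f := fun k : ℕ => 1 - y * q ^ k) h1]
    simp [pow_succ', mul_assoc]
  have key : ∀ (m : ℕ) (y : ℂ),
      qInf q y = (∏ k ∈ Finset.range m, (1 - y * q ^ k)) * qInf q (y * q ^ m) := by
    intro m
    induction m with
    | zero => intro y; simp
    | succ m ih =>
      intro y
      rw [Finset.prod_range_succ, ih y, step (y * q ^ m), pow_succ]
      ring_nf
  cases n with
  | ofNat m =>
    simp only [Int.ofNat_eq_natCast, zpow_natCast] at h
    simp only [qPoch, Int.ofNat_eq_natCast, zpow_natCast]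
    rw [key m x, mul_div_assoc, div_self h, mul_one]
  | negSucc m =>
    have hz : x * q ^ (Int.negSucc m) * q ^ (m + 1) = x := by
      rw [zpow_negSucc]; field_simp
    have hk := key (m + 1) (x * q ^ (Int.negSucc m))
    rw [hz, ← Finset.prod_range_reflect] at hk
    have hp : (∏ j ∈ Finset.range (m + 1),
        (1 - x * q ^ (Int.negSucc m) * q ^ (m + 1 - 1 - j)))
        = ∏ k ∈ Finset.range (m + 1), (1 - x / q ^ (k + 1)) := by
      refine Finset.prod_congr rfl fun j hj => ?_
      have hj' : j ≤ m := by simpa [Nat.lt_succ_iff] using hj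
      obtain ⟨i, rfl⟩ := Nat.exists_eq_add_of_le hj'
      rw [zpow_negSucc, show j + i + 1 - 1 - j = i by omega]
      field_simp
      ring
    rw [hp] at hk
    rw [hk] at h ⊢
    simp only [qPoch]
    have h2 := right_ne_zero_of_mul h
    have h1 := left_ne_zero_of_mul h
    field_simp

theorem qPoch_q_mul {q s : ℂ} (hq0 : q ≠ 0) (hs : ∀ n : ℤ, s * q ^ n ≠ 1) (n : ℤ) :
    qPoch q (q * s) n / qPoch q s n = (1 - s * q ^ n) / (1 - s) := by
  have hne : ∀ m : ℤ, 1 - s * q ^ m ≠ 0 := fun m => sub_ne_zero.2 (hs m).symm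
  have h0 : 1 - s ≠ 0 := by simpa using hne 0
  have hn : ∀ k : ℕ, 1 - s * q ^ k ≠ 0 := fun k => by simpa using hne k
  have hd : ∀ k : ℕ, 1 - s / q ^ k ≠ 0 := fun k => by
    simpa [div_eq_mul_inv] using hne (-(k : ℤ))
  cases n with
  | ofNat m =>
    simp only [qPoch, Int.ofNat_eq_natCast, zpow_natCast]
    have hP : (∏ k ∈ Finset.range m, (1 - s * q ^ k)) ≠ 0 :=
      Finset.prod_ne_zero_iff.2 fun k _ => hn k
    rw [div_eq_div_iff hP h0]
    have e : (∏ k ∈ Finset.range m, (1 - q * s * q ^ k))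
        = ∏ k ∈ Finset.range m, (1 - s * q ^ (k + 1)) :=
      Finset.prod_congr rfl fun k _ => by ring
    have h1 := Finset.prod_range_succ (fun k => 1 - s * q ^ k) m
    have h2 := Finset.prod_range_succ' (fun k => 1 - s * q ^ k) m
    simp only [pow_zero, mul_one] at h2
    rw [e, ← h2, h1]
    ring
  | negSucc m =>
    simp only [qPoch, zpow_negSucc]
    have hP : (∏ k ∈ Finset.range (m + 1), (1 - s / q ^ (k + 1))) ≠ 0 :=
      Finset.prod_ne_zero_iff.2 fun k _ => hd (k + 1)
    have e : (∏ k ∈ Finset.range (m + 1), (1 - q * s / q ^ (k + 1)))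
        = ∏ k ∈ Finset.range (m + 1), (1 - s / q ^ k) :=
      Finset.prod_congr rfl fun k _ => by rw [pow_succ]; field_simp
    have hQ : (∏ k ∈ Finset.range (m + 1), (1 - s / q ^ k)) ≠ 0 :=
      Finset.prod_ne_zero_iff.2 fun k _ => hd k
    have h1 := Finset.prod_range_succ (fun k => 1 - s / q ^ k) (m + 1)
    have h2 := Finset.prod_range_succ' (fun k => 1 - s / q ^ k) (m + 1)
    simp only [pow_zero, div_one] at h2
    rw [e, inv_div_inv, div_eq_div_iff hQ h0, ← h2, h1, div_eq_mul_inv]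
    ring

/-- The very-well-poised term is the general bilateral term with upper parameters
`q√a, -q√a, a₃, …, a_r` and lower parameters `aq / (upper parameter)`. -/
theorem vwpTerm_eq_psiTerm {q s : ℂ} (hq0 : q ≠ 0) (hs0 : s ≠ 0)
    (hs : ∀ n : ℤ, s * q ^ n ≠ 1) (hs' : ∀ n : ℤ, -s * q ^ n ≠ 1)
    (xs : List ℂ) (z : ℂ) (n : ℤ) :
    vwpTerm q (s ^ 2) xs z n = psiTerm q (q * s :: -(q * s) :: xs)
      ((q * s :: -(q * s) :: xs).map fun x => s ^ 2 * q / x) z n := by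
  have e1 : s ^ 2 * q / (q * s) = s := by field_simp
  have e2 : s ^ 2 * q / (-(q * s)) = -s := by field_simp
  have hl : ∀ l : List ℂ,
      (l.map fun x => qPoch q x n / qPoch q (s ^ 2 * q / x) n).prod
        = (l.map fun x => qPoch q x n).prod
          / ((l.map fun x => s ^ 2 * q / x).map fun x => qPoch q x n).prod := by
    intro l
    induction l with
    | nil => simp
    | cons x l ih => simp only [List.map_cons, List.prod_cons, ih]; rw [div_mul_div_comm]
  have hA := qPoch_q_mul hq0 hs n
  have hB := qPoch_q_mul hq0 hs' n
  have h1 : 1 - s ≠ 0 := sub_ne_zero.2 (by simpa using (hs 0).symm)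
  have h2 : 1 - -s ≠ 0 := sub_ne_zero.2 (by simpa using (hs' 0).symm)
  have h3 : 1 - s ^ 2 = (1 - s) * (1 - -s) := by ring
  have hf : (1 - s ^ 2 * q ^ (2 * n)) / (1 - s ^ 2)
      = (qPoch q (q * s) n / qPoch q s n) * (qPoch q (-(q * s)) n / qPoch q (-s) n) := by
    rw [← mul_neg, hA, hB, div_mul_div_comm, h3, mul_comm 2 n, zpow_mul]
    congr 1
    norm_cast
    ring
  unfold vwpTerm psiTerm
  rw [hl, hf]
  simp only [List.map_cons, List.prod_cons, e1, e2]
  simp only [div_eq_mul_inv, mul_inv]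
  ring

/-- The term of `_{r+1}W_r` is the general unilateral term with upper parameters
`a, q√a, -q√a, a₄, …, a_{r+1}` and lower parameters `√a, -√a, aq/a₄, …, aq/a_{r+1}`. -/
theorem vwpTerm_eq_phiTerm {q s : ℂ} (hq0 : q ≠ 0) (hs0 : s ≠ 0)
    (hs : ∀ n : ℤ, s * q ^ n ≠ 1) (hs' : ∀ n : ℤ, -s * q ^ n ≠ 1)
    (xs : List ℂ) (z : ℂ) (n : ℕ) :
    vwpTerm q (s ^ 2) (s ^ 2 :: xs) z n = phiTerm q (s ^ 2 :: q * s :: -(q * s) :: xs)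
      ((q * s :: -(q * s) :: xs).map fun x => s ^ 2 * q / x) z n := by
  rw [vwpTerm_eq_psiTerm hq0 hs0 hs hs']
  have e : s ^ 2 * q / s ^ 2 = q := by field_simp
  unfold psiTerm phiTerm
  simp only [List.map_cons, List.prod_cons, e]
  simp only [div_eq_mul_inv, mul_inv, zpow_natCast]
  ring

end

end WeierstrassTheta

open WeierstrassTheta

open WeierstrassTheta

namespace WeierstrassTheta

open Filter Topology

/-! The identity is a three-term relation that comes from one first-order recurrence together with
its limit. Put p₁, …, p₄ = 1/b, 1/c, 1/d, 1/e. Multiplying out all denominators that depend on these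
parameters turns the ₈ψ₈, the ₈W₇ and the product term into `regPsi`, `regW` and `regProd`. The
claim becomes `regDiff` = 0 on the surface a q z p₁p₂p₃p₄ = 1. The shift (p₃, p₄) ↦ (p₃/q, q p₄)
preserves this surface.

Under this shift the product term satisfies a homogeneous first-order relation, by quasi-periodicity
of θ. The ₈ψ₈ satisfies the same relation up to a ₆ψ₆ (`psi8_shift_pair`). The ₈W₇ satisfies it up
to a product, which is the value at infinity of a telescoping certificate (`w7_shift_pair`).
Bailey's ₆ψ₆ sum (`psi6_eq`) makes the two inhomogeneous terms cancel, so `regDiff` satisfies the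
homogeneous relation (`regDiff_shift`).

Iterating N times and letting N → ∞ expresses `regDiff` through the limits of the three
contributions. The ₈ψ₈ and the ₈W₇ both degenerate to ₆ψ₆ series, hence to products, and the three
products cancel by Weierstrass' theta identity (`limit_combination`). This gives `regDiff` = 0 for
generic parameters, and continuity removes the genericity (`regDiff_eq_zero`). Dividing back by the
denominators gives the theorem when z ≠ a. When z = a the factor θ(a/z) vanishes, but both series
terminate at their first term, and the formula is Weierstrass' identity itself (`products_self`).

Two inputs are proved along the way. The ₆ψ₆ sum follows from a telescoping shift p₄ ↦ q p₄, which
sends parameters to 0 one at a time; the remaining constant is found from a specialization with a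
single nonzero term. The series with all parameters 0 is the theta series with its terms grouped in
pairs, so Jacobi's triple product is a corollary. Weierstrass' identity holds because θ(xa)θ(x/a)
is, up to a factor, a 2×2 determinant in two functions of one variable (`theta_mul_theta`), so that
it becomes the Plücker relation.

Throughout, σ is a square root of q, so that q^{n(n-1)/2} can be written σ^{n(n-1)}. -/

/-- The finite `q`-shifted factorial `(x; q)_n`, `n ≥ 0`. -/
noncomputable def qFin (q x : ℂ) (n : ℕ) : ℂ := ∏ k ∈ Finset.range n, (1 - x * q ^ k)

/-- The product `(x, q/x; q)_∞`. -/
noncomputable def qTheta (q x : ℂ) : ℂ := qInf q x * qInf q (q / x)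

/-! ### Finite and infinite q-products: nonvanishing, bounds, continuity. -/

section basic

variable {q : ℂ}

theorem qFin_zero (x : ℂ) : qFin q x 0 = 1 := by simp [qFin]

theorem qFin_succ (x : ℂ) (n : ℕ) : qFin q x (n + 1) = qFin q x n * (1 - x * q ^ n) := by
  simp [qFin, Finset.prod_range_succ]

theorem qFin_succ' (x : ℂ) (n : ℕ) : qFin q x (n + 1) = (1 - x) * qFin q (x * q) n := by
  simp only [qFin, Finset.prod_range_succ', pow_zero, mul_one]
  rw [mul_comm]
  congr 1
  exact Finset.prod_congr rfl fun k _ => by ring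

theorem summable_norm_mul_pow (hq1 : ‖q‖ < 1) (x : ℂ) : Summable fun k : ℕ => ‖-(x * q ^ k)‖ := by
  simp only [norm_neg, norm_mul, norm_pow]
  exact (summable_geometric_of_lt_one (norm_nonneg _) hq1).mul_left _

theorem tsum_norm_mul_pow (hq1 : ‖q‖ < 1) (x : ℂ) :
    ∑' k : ℕ, ‖-(x * q ^ k)‖ = ‖x‖ / (1 - ‖q‖) := by
  simp only [norm_neg, norm_mul, norm_pow]
  rw [tsum_mul_left, tsum_geometric_of_lt_one (norm_nonneg _) hq1, div_eq_mul_inv]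

theorem multipliable_qInf (hq1 : ‖q‖ < 1) (x : ℂ) :
    Multipliable fun k : ℕ => 1 - x * q ^ k := by
  simpa [sub_eq_add_neg] using multipliable_one_add_of_summable (summable_norm_mul_pow hq1 x)

theorem qInf_zero : qInf q 0 = 1 := by simp [qInf]

theorem qInf_step (hq1 : ‖q‖ < 1) (x : ℂ) : qInf q x = (1 - x) * qInf q (x * q) := by
  unfold qInf
  have h1 : Multipliable fun k : ℕ => 1 - x * q ^ (k + 1) := by
    simpa [pow_succ', mul_assoc] using multipliable_qInf hq1 (x * q)
  rw [tprod_eq_zero_mul' (f := fun k : ℕ => 1 - x * q ^ k) h1]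
  simp [pow_succ', mul_assoc]

theorem qInf_eq_qFin_mul (hq1 : ‖q‖ < 1) (x : ℂ) (n : ℕ) :
    qInf q x = qFin q x n * qInf q (x * q ^ n) := by
  induction n with
  | zero => simp [qFin]
  | succ n ih => rw [qFin_succ, ih, qInf_step hq1 (x * q ^ n), pow_succ]; ring_nf

/-- A convergent product vanishes only through one of its factors. This translates between the
pointwise non-degeneracy conditions and divisibility by the infinite product. -/
theorem qInf_ne_zero_iff (hq1 : ‖q‖ < 1) (x : ℂ) : qInf q x ≠ 0 ↔ ∀ n : ℕ, x * q ^ n ≠ 1 := by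
  constructor
  · intro h n hn
    apply h
    rw [qInf_eq_qFin_mul hq1 x (n + 1), qFin_succ, hn]
    simp
  · intro h
    have := tprod_one_add_ne_zero_of_summable (f := fun k : ℕ => -(x * q ^ k))
      (fun k => by rw [← sub_eq_add_neg]; exact sub_ne_zero.2 (h k).symm)
      (summable_norm_mul_pow hq1 x)
    simpa [qInf, sub_eq_add_neg] using this

theorem mul_pow_ne_one (hq1 : ‖q‖ < 1) {x : ℂ} (hx : ‖x‖ < 1) (n : ℕ) : x * q ^ n ≠ 1 := by
  intro h
  have h2 : ‖x * q ^ n‖ = 1 := by rw [h]; simp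
  rw [norm_mul, norm_pow] at h2
  have h3 : ‖q‖ ^ n ≤ 1 := pow_le_one₀ (norm_nonneg _) hq1.le
  nlinarith [norm_nonneg x, norm_nonneg q, pow_nonneg (norm_nonneg q) n]

theorem qInf_ne_zero_of_norm_lt (hq1 : ‖q‖ < 1) {x : ℂ} (hx : ‖x‖ < 1) : qInf q x ≠ 0 :=
  (qInf_ne_zero_iff hq1 x).2 fun n => mul_pow_ne_one hq1 hx n

theorem qInf_self_ne_zero (hq1 : ‖q‖ < 1) : qInf q q ≠ 0 := qInf_ne_zero_of_norm_lt hq1 hq1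

theorem norm_qFin_sub_one_le (hq1 : ‖q‖ < 1) (x : ℂ) (n : ℕ) :
    ‖qFin q x n - 1‖ ≤ Real.exp (‖x‖ / (1 - ‖q‖)) - 1 := by
  have h := (Finset.range n).norm_prod_one_add_sub_one_le fun k => -(x * q ^ k)
  simp only [← sub_eq_add_neg] at h
  refine h.trans ?_
  gcongr
  rw [← tsum_norm_mul_pow hq1 x]
  exact (summable_norm_mul_pow hq1 x).sum_le_tsum _ fun _ _ => norm_nonneg _

theorem tendsto_qFin (hq1 : ‖q‖ < 1) (x : ℂ) :
    Tendsto (fun n => qFin q x n) atTop (𝓝 (qInf q x)) :=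
  (multipliable_qInf hq1 x).hasProd.tendsto_prod_nat

theorem norm_qInf_sub_one_le (hq1 : ‖q‖ < 1) (x : ℂ) :
    ‖qInf q x - 1‖ ≤ Real.exp (‖x‖ / (1 - ‖q‖)) - 1 :=
  le_of_tendsto ((tendsto_qFin hq1 x).sub_const 1).norm
    (Eventually.of_forall fun n => norm_qFin_sub_one_le hq1 x n)

theorem norm_le_of_norm_sub_one_le {w : ℂ} {C : ℝ} (h : ‖w - 1‖ ≤ C - 1) : ‖w‖ ≤ C := by
  have := norm_add_le (w - 1) 1
  simp only [sub_add_cancel, norm_one] at this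
  linarith

theorem exp_div_mono (hq1 : ‖q‖ < 1) {x r : ℝ} (h : x ≤ r) :
    Real.exp (x / (1 - ‖q‖)) ≤ Real.exp (r / (1 - ‖q‖)) := by
  have : 0 < 1 - ‖q‖ := by linarith
  gcongr

theorem norm_qFin_le (hq1 : ‖q‖ < 1) {x : ℂ} {r : ℝ} (hx : ‖x‖ ≤ r) (n : ℕ) :
    ‖qFin q x n‖ ≤ Real.exp (r / (1 - ‖q‖)) :=
  (norm_le_of_norm_sub_one_le (norm_qFin_sub_one_le hq1 x n)).trans (exp_div_mono hq1 hx)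

theorem norm_qInf_le (hq1 : ‖q‖ < 1) {x : ℂ} {r : ℝ} (hx : ‖x‖ ≤ r) :
    ‖qInf q x‖ ≤ Real.exp (r / (1 - ‖q‖)) :=
  (norm_le_of_norm_sub_one_le (norm_qInf_sub_one_le hq1 x)).trans (exp_div_mono hq1 hx)

theorem norm_mul_pow_le (hq1 : ‖q‖ < 1) {x : ℂ} {r : ℝ} (hx : ‖x‖ ≤ r) (n : ℕ) :
    ‖x * q ^ n‖ ≤ r := by
  rw [norm_mul, norm_pow]
  exact (mul_le_of_le_one_right (norm_nonneg _) (pow_le_one₀ (norm_nonneg _) hq1.le)).trans hx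

theorem continuous_qFin (n : ℕ) : Continuous fun x => qFin q x n := by
  unfold qFin
  fun_prop

/-- A locally uniform limit of polynomials: on ‖y‖ ≤ r the tail (y q^n; q)_∞ differs from 1 by at
most exp(r‖q‖^n / (1 - ‖q‖)) - 1. -/
theorem continuous_qInf (hq1 : ‖q‖ < 1) : Continuous (qInf q) := by
  have key : TendstoLocallyUniformly (fun n x => qFin q x n) (qInf q) atTop := by
    rw [Metric.tendstoLocallyUniformly_iff]
    intro ε hε x
    set r := ‖x‖ + 1 with hr
    refine ⟨Metric.ball x 1, Metric.ball_mem_nhds x one_pos, ?_⟩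
    have hlim : Tendsto (fun n : ℕ => Real.exp (r / (1 - ‖q‖)) *
        (Real.exp (r * ‖q‖ ^ n / (1 - ‖q‖)) - 1)) atTop (𝓝 0) := by
      have h1 : Tendsto (fun n : ℕ => r * ‖q‖ ^ n / (1 - ‖q‖)) atTop (𝓝 (r * 0 / (1 - ‖q‖))) :=
        ((tendsto_pow_atTop_nhds_zero_of_lt_one (norm_nonneg q) hq1).const_mul r).div_const _
      have h2 := ((Real.continuous_exp.tendsto _).comp h1).sub_const 1
      have h3 := h2.const_mul (Real.exp (r / (1 - ‖q‖)))
      simpa using h3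
    filter_upwards [hlim.eventually (gt_mem_nhds hε)] with n hn y hy
    have hyr : ‖y‖ ≤ r := by
      have : ‖y - x‖ < 1 := by simpa [dist_eq_norm] using hy
      have := norm_add_le (y - x) x
      simp only [sub_add_cancel] at this
      linarith
    rw [dist_eq_norm, qInf_eq_qFin_mul hq1 y n,
      show qFin q y n * qInf q (y * q ^ n) - qFin q y n
        = qFin q y n * (qInf q (y * q ^ n) - 1) by ring, norm_mul]
    refine lt_of_le_of_lt ?_ hn
    refine mul_le_mul (norm_qFin_le hq1 hyr n) ?_ (norm_nonneg _) (Real.exp_pos _).le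
    refine (norm_qInf_sub_one_le hq1 _).trans ?_
    have h1 : ‖y * q ^ n‖ ≤ r * ‖q‖ ^ n := by rw [norm_mul, norm_pow]; gcongr
    linarith [exp_div_mono hq1 h1]
  exact key.continuous (Frequently.of_forall fun n => continuous_qFin n)

theorem tendsto_mul_pow_zero (hq1 : ‖q‖ < 1) (x : ℂ) :
    Tendsto (fun n : ℕ => x * q ^ n) atTop (𝓝 0) := by
  simpa using (tendsto_pow_atTop_nhds_zero_of_norm_lt_one hq1).const_mul x

theorem tendsto_qInf_mul_pow (hq1 : ‖q‖ < 1) (x : ℂ) :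
    Tendsto (fun n : ℕ => qInf q (x * q ^ n)) atTop (𝓝 1) := by
  have := ((continuous_qInf hq1).tendsto 0).comp (tendsto_mul_pow_zero hq1 x)
  rwa [qInf_zero] at this

theorem tendsto_qFin_mul_pow (hq1 : ‖q‖ < 1) (x : ℂ) (k : ℕ) :
    Tendsto (fun n : ℕ => qFin q (x * q ^ n) k) atTop (𝓝 1) := by
  have := ((continuous_qFin (q := q) k).tendsto 0).comp (tendsto_mul_pow_zero hq1 x)
  rwa [show qFin q 0 k = 1 by simp [qFin]] at this

end basic

/-! ### Growth under backward shifts, and quasi-periodicity of (x, q/x; q)_∞. -/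

section growth

variable {q σ : ℂ}

/-- Backward shift by `q ^ N`; here `σ² = q`. -/
theorem qInf_div_pow (hq0 : q ≠ 0) (hq1 : ‖q‖ < 1) (hσ : σ ^ 2 = q) {x : ℂ} (hx : x ≠ 0) (N : ℕ) :
    qInf q (x / q ^ N) * σ ^ (N * (N + 1)) = (-x) ^ N * qFin q (q / x) N * qInf q x := by
  induction N with
  | zero => simp [qFin]
  | succ N ih =>
    have h1 : x / q ^ (N + 1) * q = x / q ^ N := by rw [pow_succ]; field_simp
    rw [qInf_step hq1, h1, qFin_succ,
      show σ ^ ((N + 1) * (N + 1 + 1)) = σ ^ (N * (N + 1)) * q ^ (N + 1) by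
        rw [← hσ]; ring]
    have h2 : (1 - x / q ^ (N + 1)) * q ^ (N + 1) = -x * (1 - q / x * q ^ N) := by
      rw [pow_succ]; field_simp; ring
    calc _ = (qInf q (x / q ^ N) * σ ^ (N * (N + 1))) * ((1 - x / q ^ (N + 1)) * q ^ (N + 1)) := by
          ring
      _ = _ := by rw [ih, h2]; ring

/-- A convenient constant bounding `(x; q)_∞` and its backward shifts for `‖x‖ ≤ r`. -/
noncomputable def growthConst (q : ℂ) (r : ℝ) : ℝ :=
  Real.exp (r / (1 - ‖q‖)) * Real.exp (‖q‖ / r / (1 - ‖q‖))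

theorem growthConst_pos (q : ℂ) (r : ℝ) : 0 < growthConst q r := by
  unfold growthConst; positivity

theorem norm_qInf_le_growthConst (hq1 : ‖q‖ < 1) {x : ℂ} {r : ℝ} (hr : 0 < r) (hx : ‖x‖ ≤ r)
    (n : ℕ) : ‖qInf q (x * q ^ n)‖ ≤ growthConst q r := by
  refine (norm_qInf_le hq1 (norm_mul_pow_le hq1 hx n)).trans ?_
  have h : 0 ≤ ‖q‖ / r / (1 - ‖q‖) :=
    div_nonneg (div_nonneg (norm_nonneg _) hr.le) (by linarith)
  exact le_mul_of_one_le_right (Real.exp_pos _).le (Real.one_le_exp h)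

/-- The exact formula `qInf_div_pow` involves q/x and is not uniform as x → 0. Here the N new
factors are bounded one at a time, each costing r(1 + (‖q‖/r)‖q‖^k), and the product of the brackets
is at most the exponential of a geometric series. -/
theorem norm_qInf_div_pow_le (hq0 : q ≠ 0) (hq1 : ‖q‖ < 1) (hσ : σ ^ 2 = q) {x : ℂ} {r : ℝ}
    (hr : 0 < r) (hx : ‖x‖ ≤ r) (N : ℕ) :
    ‖qInf q (x / q ^ N)‖ * ‖σ‖ ^ (N * (N + 1)) ≤ growthConst q r * r ^ N := by
  have hq : 0 < ‖q‖ := norm_pos_iff.2 hq0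
  have hs : ‖σ‖ ^ 2 = ‖q‖ := by rw [← norm_pow, hσ]
  have key : ∀ N : ℕ, ‖qInf q (x / q ^ N)‖ * ‖σ‖ ^ (N * (N + 1)) ≤
      Real.exp (r / (1 - ‖q‖)) * (∏ k ∈ Finset.range N, (1 + ‖q‖ / r * ‖q‖ ^ k)) * r ^ N := by
    intro N
    induction N with
    | zero => simpa using norm_qInf_le hq1 hx
    | succ N ih =>
      have h1 : x / q ^ (N + 1) * q = x / q ^ N := by rw [pow_succ]; field_simp
      rw [qInf_step hq1, h1, Finset.prod_range_succ, norm_mul,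
        show ‖σ‖ ^ ((N + 1) * (N + 1 + 1)) = ‖σ‖ ^ (N * (N + 1)) * ‖q‖ ^ (N + 1) by
          rw [← hs]; ring]
      have h2 : ‖1 - x / q ^ (N + 1)‖ * ‖q‖ ^ (N + 1) ≤ r * (1 + ‖q‖ / r * ‖q‖ ^ N) := by
        rw [← norm_pow, ← norm_mul, sub_mul, div_mul_cancel₀ _ (pow_ne_zero _ hq0), one_mul]
        refine (norm_sub_le _ _).trans ?_
        rw [norm_pow]
        have : r * (1 + ‖q‖ / r * ‖q‖ ^ N) = r + ‖q‖ ^ (N + 1) := by rw [pow_succ]; field_simp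
        rw [this]; linarith
      calc _ = (‖qInf q (x / q ^ N)‖ * ‖σ‖ ^ (N * (N + 1))) *
            (‖1 - x / q ^ (N + 1)‖ * ‖q‖ ^ (N + 1)) := by ring
        _ ≤ _ := mul_le_mul ih h2 (by positivity) (by positivity)
        _ = _ := by ring
  refine (key N).trans ?_
  unfold growthConst
  gcongr
  have h3 := Real.prod_one_add_le_exp_sum (Finset.range N) (f := fun k => ‖q‖ / r * ‖q‖ ^ k)
    (fun k => by positivity)
  refine h3.trans (Real.exp_le_exp.2 ?_)
  have hsum : Summable fun k : ℕ => ‖q‖ / r * ‖q‖ ^ k :=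
    (summable_geometric_of_lt_one hq.le hq1).mul_left _
  refine (hsum.sum_le_tsum _ fun _ _ => by positivity).trans ?_
  rw [tsum_mul_left, tsum_geometric_of_lt_one hq.le hq1, div_eq_mul_inv (‖q‖ / r)]

/-- This is where theta functions enter the limits: a backward-shifted infinite product, suitably
normalized, tends to a full theta product. -/
theorem tendsto_qInf_div_pow (hq0 : q ≠ 0) (hq1 : ‖q‖ < 1) (hσ : σ ^ 2 = q) {x : ℂ} (hx : x ≠ 0) :
    Tendsto (fun N : ℕ => qInf q (x / q ^ N) * σ ^ (N * (N + 1)) / (-x) ^ N) atTop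
      (𝓝 (qTheta q x)) := by
  have h := ((tendsto_qFin hq1 (q / x)).mul_const (qInf q x))
  rw [mul_comm] at h
  refine h.congr fun N => ?_
  rw [qInf_div_pow hq0 hq1 hσ hx, mul_assoc, mul_div_cancel_left₀ _ (pow_ne_zero _ (neg_ne_zero.2 hx))]

theorem qTheta_mul (hq0 : q ≠ 0) (hq1 : ‖q‖ < 1) {x : ℂ} (hx : x ≠ 0) :
    x * qTheta q (x * q) = - qTheta q x := by
  unfold qTheta
  have h1 := qInf_step hq1 x
  have h2 := qInf_step hq1 (1 / x)
  rw [h1, show q / (x * q) = 1 / x by field_simp, h2, show 1 / x * q = q / x by ring]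
  field_simp
  ring

theorem qTheta_div (hq0 : q ≠ 0) {x : ℂ} (hx : x ≠ 0) : qTheta q (q / x) = qTheta q x := by
  unfold qTheta
  rw [show q / (q / x) = x by field_simp, mul_comm]

theorem qTheta_inv (hq0 : q ≠ 0) (hq1 : ‖q‖ < 1) {x : ℂ} (hx : x ≠ 0) :
    x * qTheta q (1 / x) = - qTheta q x := by
  have h := qTheta_mul hq0 hq1 (x := 1 / x) (by simpa using hx)
  rw [show 1 / x * q = q / x by ring, qTheta_div hq0 hx] at h
  have : qTheta q (1 / x) = - (1 / x * qTheta q x) := by rw [h]; ring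
  rw [this]; field_simp

/-- The quasi-period factors q^{-n(n-1)/2} and q^{-n(n+1)/2} of the two opposite shifts multiply to
q^{-n²}, and the signs cancel, so no square root of q is needed. -/
theorem qTheta_pair_zpow (hq0 : q ≠ 0) (hq1 : ‖q‖ < 1) {x y : ℂ} (hx : x ≠ 0) (hy : y ≠ 0)
    (n : ℤ) : qTheta q (x * q ^ n) * qTheta q (y * q ^ (-n))
      = (y / x) ^ n * q ^ (-n ^ 2) * (qTheta q x * qTheta q y) := by
  have step : ∀ n : ℤ, qTheta q (x * q ^ (n + 1)) * qTheta q (y * q ^ (-(n + 1)))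
      = (y / x) * q ^ (-(2 * n + 1)) * (qTheta q (x * q ^ n) * qTheta q (y * q ^ (-n))) := by
    intro n
    have hqn : q ^ n ≠ 0 := zpow_ne_zero _ hq0
    have h1 := qTheta_mul hq0 hq1 (x := x * q ^ n) (mul_ne_zero hx hqn)
    have h2 := qTheta_mul hq0 hq1 (x := y * q ^ (-(n + 1)))
      (mul_ne_zero hy (zpow_ne_zero _ hq0))
    rw [show x * q ^ n * q = x * q ^ (n + 1) by rw [zpow_add_one₀ hq0]; ring] at h1
    rw [show y * q ^ (-(n + 1)) * q = y * q ^ (-n) by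
      rw [mul_assoc, ← zpow_add_one₀ hq0]; congr 2; ring] at h2
    have h3 : qTheta q (x * q ^ n) = -(x * q ^ n * qTheta q (x * q ^ (n + 1))) := by
      rw [h1, neg_neg]
    have h4 : qTheta q (y * q ^ (-(n + 1))) = -(y * q ^ (-(n + 1)) * qTheta q (y * q ^ (-n))) := by
      rw [h2, neg_neg]
    rw [h3, h4]
    have e1 : q ^ (-(n + 1)) = (q ^ n)⁻¹ * q⁻¹ := by
      rw [neg_add, zpow_add₀ hq0, zpow_neg, zpow_neg_one]
    have e2 : q ^ (-(2 * n + 1)) = (q ^ n)⁻¹ * (q ^ n)⁻¹ * q⁻¹ := by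
      rw [neg_add, zpow_add₀ hq0, zpow_neg, zpow_neg_one, two_mul, zpow_add₀ hq0, mul_inv]
    rw [e1, e2]
    field_simp
  have hyx : y / x ≠ 0 := div_ne_zero hy hx
  have e : ∀ n : ℤ, (y / x) ^ (n + 1) * q ^ (-(n + 1) ^ 2)
      = y / x * q ^ (-(2 * n + 1)) * ((y / x) ^ n * q ^ (-n ^ 2)) := by
    intro n
    rw [show (-(n + 1) ^ 2 : ℤ) = -(2 * n + 1) + (-n ^ 2) by ring, zpow_add₀ hq0,
      zpow_add_one₀ hyx]
    ring
  induction n using Int.induction_on with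
  | zero => simp
  | succ n ih => rw [step, ih, e]; ring
  | pred n ih =>
    have h1 := step (-(n : ℤ) - 1)
    have h2 := e (-(n : ℤ) - 1)
    rw [sub_add_cancel] at h1 h2
    rw [h1, h2, mul_assoc _ (_ * _) (_ * _)] at ih
    have hne : y / x * q ^ (-(2 * (-(n : ℤ) - 1) + 1)) ≠ 0 :=
      mul_ne_zero hyx (zpow_ne_zero _ hq0)
    exact mul_left_cancel₀ hne ih

end growth

/-! ### The common factor of the regularized bilateral terms and its decay. -/

/-- The product `(a p q^{n+1}, p q^{1-n}; q)_∞`; with `p = 1/x` it is proportional to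
`(x; q)_n / (aq/x; q)_n`. -/
noncomputable def pairFn (q a p : ℂ) (n : ℤ) : ℂ :=
  qInf q (a * p * q ^ (n + 1)) * qInf q (p * q ^ (1 - n))

/-- The common part of the regularized `₆ψ₆` and `₈ψ₈` terms. -/
noncomputable def core (q a p₁ p₂ p₃ p₄ : ℂ) (n : ℤ) : ℂ :=
  a ^ (2 * n) * q ^ (2 * n ^ 2) *
    (pairFn q a p₁ n * pairFn q a p₂ n * pairFn q a p₃ n * pairFn q a p₄ n)

section core

variable {q σ a : ℂ}

theorem pairFn_neg (ha : a ≠ 0) (p : ℂ) (n : ℤ) :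
    pairFn q a p (-n) = pairFn q a⁻¹ (a * p) n := by
  unfold pairFn
  rw [inv_mul_cancel_left₀ ha, mul_comm, show 1 - -n = n + 1 by ring, show -n + 1 = 1 - n by ring]

/-- The very-well-poised symmetry n ↦ -n, a ↦ 1/a, p ↦ ap. It reduces every estimate over ℤ to one
over ℕ. -/
theorem core_neg (ha : a ≠ 0) (p₁ p₂ p₃ p₄ : ℂ) (n : ℤ) :
    core q a p₁ p₂ p₃ p₄ (-n) = core q a⁻¹ (a * p₁) (a * p₂) (a * p₃) (a * p₄) n := by
  unfold core
  simp only [pairFn_neg ha]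
  rw [inv_zpow', neg_sq, mul_neg]

theorem pairFn_add_one (hq0 : q ≠ 0) (hq1 : ‖q‖ < 1) (p : ℂ) (n : ℤ) :
    pairFn q a p (n + 1) * (1 - a * p * q ^ (n + 1)) = (1 - p * q ^ (-n)) * pairFn q a p n := by
  unfold pairFn
  have h1 := qInf_step hq1 (a * p * q ^ (n + 1))
  have h2 := qInf_step hq1 (p * q ^ (-n))
  rw [mul_assoc (a * p), ← zpow_add_one₀ hq0] at h1
  rw [mul_assoc p, ← zpow_add_one₀ hq0, neg_add_eq_sub] at h2
  rw [h1, show (1 : ℤ) - (n + 1) = -n by ring, h2]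
  ring

theorem pairFn_shift (hq1 : ‖q‖ < 1) (p : ℂ) (n : ℤ) :
    pairFn q a p n
      = pairFn q a (q * p) n * ((1 - a * p * q ^ (n + 1)) * (1 - p * q ^ (1 - n))) := by
  unfold pairFn
  rw [qInf_step hq1 (a * p * q ^ (n + 1)), qInf_step hq1 (p * q ^ (1 - n))]
  rw [show a * p * q ^ (n + 1) * q = a * (q * p) * q ^ (n + 1) by ring,
    show p * q ^ (1 - n) * q = q * p * q ^ (1 - n) by ring]
  ring

theorem pairFn_zero_left (n : ℤ) : pairFn q a 0 n = 1 := by simp [pairFn, qInf_zero]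

/-- The term ratio of the series, kept free of denominators so that it also holds where factors
vanish. -/
theorem core_add_one (hq0 : q ≠ 0) (hq1 : ‖q‖ < 1) (ha : a ≠ 0) (p₁ p₂ p₃ p₄ : ℂ) (n : ℤ) :
    core q a p₁ p₂ p₃ p₄ (n + 1) * ((1 - a * p₁ * q ^ (n + 1)) * (1 - a * p₂ * q ^ (n + 1)) *
      (1 - a * p₃ * q ^ (n + 1)) * (1 - a * p₄ * q ^ (n + 1)))
    = a ^ 2 * q ^ (4 * n + 2) * ((1 - p₁ * q ^ (-n)) * (1 - p₂ * q ^ (-n)) *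
      (1 - p₃ * q ^ (-n)) * (1 - p₄ * q ^ (-n))) * core q a p₁ p₂ p₃ p₄ n := by
  unfold core
  have e1 : a ^ (2 * (n + 1)) = a ^ 2 * a ^ (2 * n) := by
    rw [mul_add, zpow_add₀ ha, mul_comm, mul_one]; rfl
  have e2 : q ^ (2 * (n + 1) ^ 2) = q ^ (4 * n + 2) * q ^ (2 * n ^ 2) := by
    rw [← zpow_add₀ hq0]; congr 1; ring
  rw [e1, e2]
  have h1 := pairFn_add_one (a := a) hq0 hq1 p₁ n
  have h2 := pairFn_add_one (a := a) hq0 hq1 p₂ n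
  have h3 := pairFn_add_one (a := a) hq0 hq1 p₃ n
  have h4 := pairFn_add_one (a := a) hq0 hq1 p₄ n
  have : pairFn q a p₁ (n + 1) * (1 - a * p₁ * q ^ (n + 1)) *
      (pairFn q a p₂ (n + 1) * (1 - a * p₂ * q ^ (n + 1))) *
      (pairFn q a p₃ (n + 1) * (1 - a * p₃ * q ^ (n + 1))) *
      (pairFn q a p₄ (n + 1) * (1 - a * p₄ * q ^ (n + 1))) =
      (1 - p₁ * q ^ (-n)) * pairFn q a p₁ n * ((1 - p₂ * q ^ (-n)) * pairFn q a p₂ n) *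
      ((1 - p₃ * q ^ (-n)) * pairFn q a p₃ n) * ((1 - p₄ * q ^ (-n)) * pairFn q a p₄ n) := by
    rw [h1, h2, h3, h4]
  linear_combination (a ^ 2 * a ^ (2 * n) * (q ^ (4 * n + 2) * q ^ (2 * n ^ 2))) * this

theorem norm_pairFn_le (hq0 : q ≠ 0) (hq1 : ‖q‖ < 1) (hσ : σ ^ 2 = q) (ha : a ≠ 0)
    {p : ℂ} {r : ℝ} (hr : 0 < r) (hp : ‖p‖ ≤ r) (n : ℕ) :
    ‖pairFn q a p n‖ * ‖σ‖ ^ (n * (n + 1)) ≤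
      growthConst q (‖a‖ * r * ‖q‖) * growthConst q (r * ‖q‖) * (r * ‖q‖) ^ n := by
  have hq : 0 < ‖q‖ := norm_pos_iff.2 hq0
  have han : 0 < ‖a‖ := norm_pos_iff.2 ha
  have h1 : ‖qInf q (a * p * q ^ ((n : ℤ) + 1))‖ ≤ growthConst q (‖a‖ * r * ‖q‖) := by
    have := norm_qInf_le_growthConst hq1 (x := a * p * q) (r := ‖a‖ * r * ‖q‖) (by positivity)
      (by rw [norm_mul, norm_mul]; gcongr) n
    rw [zpow_add_one₀ hq0, zpow_natCast]
    convert this using 3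
    ring
  have h2 : ‖qInf q (p * q ^ (1 - (n : ℤ)))‖ * ‖σ‖ ^ (n * (n + 1)) ≤
      growthConst q (r * ‖q‖) * (r * ‖q‖) ^ n := by
    have := norm_qInf_div_pow_le hq0 hq1 hσ (x := p * q) (r := r * ‖q‖) (by positivity)
      (by rw [norm_mul]; gcongr) n
    rwa [show p * q / q ^ n = p * q ^ (1 - (n : ℤ)) by
      rw [zpow_sub₀ hq0, zpow_one, zpow_natCast, mul_div_assoc]] at this
  unfold pairFn
  rw [norm_mul, mul_assoc, mul_assoc (growthConst q (‖a‖ * r * ‖q‖))]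
  exact mul_le_mul h1 h2 (by positivity) (growthConst_pos _ _).le

/-- Each `pairFn` grows at most like ‖σ‖^{-n(n+1)} times a geometric factor. The four together cost
‖q‖^{-2n²-2n}, whose quadratic part is cancelled by q^{2n²}, leaving a geometric sequence. The
constant depends only on the radii, as dominated convergence requires. -/
theorem norm_core_natCast_le (hq0 : q ≠ 0) (hq1 : ‖q‖ < 1) (hσ : σ ^ 2 = q) (ha : a ≠ 0)
    {r₁ r₂ r₃ r₄ : ℝ} (hr₁ : 0 < r₁) (hr₂ : 0 < r₂) (hr₃ : 0 < r₃) (hr₄ : 0 < r₄) :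
    ∃ C : ℝ, ∀ p₁ p₂ p₃ p₄ : ℂ, ‖p₁‖ ≤ r₁ → ‖p₂‖ ≤ r₂ → ‖p₃‖ ≤ r₃ → ‖p₄‖ ≤ r₄ → ∀ n : ℕ,
      ‖core q a p₁ p₂ p₃ p₄ n‖ ≤ C * (‖a‖ ^ 2 * ‖q‖ ^ 2 * (r₁ * r₂ * r₃ * r₄)) ^ n := by
  have hs : ‖σ‖ ^ 2 = ‖q‖ := by rw [← norm_pow, hσ]
  have hq : 0 < ‖q‖ := norm_pos_iff.2 hq0
  have hs0 : 0 < ‖σ‖ := by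
    refine norm_pos_iff.2 fun h => hq0 ?_
    rw [← hσ, h]; simp
  let K : ℝ → ℝ := fun r => growthConst q (‖a‖ * r * ‖q‖) * growthConst q (r * ‖q‖)
  have hK : ∀ r, 0 ≤ K r := fun r => mul_nonneg (growthConst_pos _ _).le (growthConst_pos _ _).le
  refine ⟨K r₁ * K r₂ * K r₃ * K r₄, fun p₁ p₂ p₃ p₄ h₁ h₂ h₃ h₄ n => ?_⟩
  have b₁ := norm_pairFn_le hq0 hq1 hσ ha hr₁ h₁ n
  have b₂ := norm_pairFn_le hq0 hq1 hσ ha hr₂ h₂ n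
  have b₃ := norm_pairFn_le hq0 hq1 hσ ha hr₃ h₃ n
  have b₄ := norm_pairFn_le hq0 hq1 hσ ha hr₄ h₄ n
  have hpos : 0 < ‖σ‖ ^ (4 * (n * (n + 1))) := by positivity
  refine le_of_mul_le_mul_right ?_ hpos
  have e1 : ‖core q a p₁ p₂ p₃ p₄ n‖ = ‖a‖ ^ (2 * n) * ‖σ‖ ^ (4 * n ^ 2) *
      (‖pairFn q a p₁ n‖ * ‖pairFn q a p₂ n‖ * ‖pairFn q a p₃ n‖ * ‖pairFn q a p₄ n‖) := by
    unfold core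
    rw [← hσ]
    simp only [norm_mul, norm_zpow, norm_pow]
    congr 2
    · norm_cast
      rw [← pow_mul]; congr 1; ring
  calc _ = ‖a‖ ^ (2 * n) * ‖σ‖ ^ (4 * n ^ 2) *
      ((‖pairFn q a p₁ n‖ * ‖σ‖ ^ (n * (n + 1))) * (‖pairFn q a p₂ n‖ * ‖σ‖ ^ (n * (n + 1))) *
        (‖pairFn q a p₃ n‖ * ‖σ‖ ^ (n * (n + 1))) * (‖pairFn q a p₄ n‖ * ‖σ‖ ^ (n * (n + 1)))) := by
        rw [e1]; ring
    _ ≤ ‖a‖ ^ (2 * n) * ‖σ‖ ^ (4 * n ^ 2) *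
      ((K r₁ * (r₁ * ‖q‖) ^ n) * (K r₂ * (r₂ * ‖q‖) ^ n) * (K r₃ * (r₃ * ‖q‖) ^ n) *
        (K r₄ * (r₄ * ‖q‖) ^ n)) := by
        have := hK r₁; have := hK r₂; have := hK r₃; have := hK r₄
        gcongr
    _ = _ := by rw [← hs]; ring

theorem norm_core_le (hq0 : q ≠ 0) (hq1 : ‖q‖ < 1) (hσ : σ ^ 2 = q) (ha : a ≠ 0)
    {r₁ r₂ r₃ r₄ : ℝ} (hr₁ : 0 < r₁) (hr₂ : 0 < r₂) (hr₃ : 0 < r₃) (hr₄ : 0 < r₄) :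
    ∃ C : ℝ, 0 ≤ C ∧
      ∀ p₁ p₂ p₃ p₄ : ℂ, ‖p₁‖ ≤ r₁ → ‖p₂‖ ≤ r₂ → ‖p₃‖ ≤ r₃ → ‖p₄‖ ≤ r₄ → ∀ n : ℤ,
      ‖core q a p₁ p₂ p₃ p₄ n‖ ≤ C * (‖a‖ ^ 2 * ‖q‖ ^ 2 * (r₁ * r₂ * r₃ * r₄)) ^ n.natAbs := by
  have han : 0 < ‖a‖ := norm_pos_iff.2 ha
  obtain ⟨C, hC⟩ := norm_core_natCast_le hq0 hq1 hσ ha hr₁ hr₂ hr₃ hr₄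
  obtain ⟨C', hC'⟩ := norm_core_natCast_le hq0 hq1 hσ (inv_ne_zero ha) (mul_pos han hr₁)
    (mul_pos han hr₂) (mul_pos han hr₃) (mul_pos han hr₄)
  -- The ratio is invariant under a ↦ a⁻¹, r ↦ ‖a‖r, so both halves of ℤ obey the same bound.
  have e : ‖a⁻¹‖ ^ 2 * ‖q‖ ^ 2 * (‖a‖ * r₁ * (‖a‖ * r₂) * (‖a‖ * r₃) * (‖a‖ * r₄))
      = ‖a‖ ^ 2 * ‖q‖ ^ 2 * (r₁ * r₂ * r₃ * r₄) := by
    rw [norm_inv]; field_simp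
  refine ⟨max (max C C') 0, le_max_right _ _, fun p₁ p₂ p₃ p₄ h₁ h₂ h₃ h₄ n => ?_⟩
  have hpow : ∀ m : ℕ, 0 ≤ (‖a‖ ^ 2 * ‖q‖ ^ 2 * (r₁ * r₂ * r₃ * r₄)) ^ m := fun m => by positivity
  obtain ⟨m, rfl | rfl⟩ := n.eq_nat_or_neg
  · refine (hC p₁ p₂ p₃ p₄ h₁ h₂ h₃ h₄ m).trans ?_
    rw [Int.natAbs_natCast]
    exact mul_le_mul_of_nonneg_right ((le_max_left _ _).trans (le_max_left _ _)) (hpow m)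
  · rw [core_neg ha, Int.natAbs_neg, Int.natAbs_natCast]
    refine (hC' (a * p₁) (a * p₂) (a * p₃) (a * p₄) ?_ ?_ ?_ ?_ m).trans ?_
    · rw [norm_mul]; gcongr
    · rw [norm_mul]; gcongr
    · rw [norm_mul]; gcongr
    · rw [norm_mul]; gcongr
    · rw [e]
      exact mul_le_mul_of_nonneg_right ((le_max_right _ _).trans (le_max_left _ _)) (hpow m)

theorem summable_pow_natAbs {ρ : ℝ} (h0 : 0 ≤ ρ) (h1 : ρ < 1) :
    Summable fun n : ℤ => ρ ^ n.natAbs := by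
  have := summable_geometric_of_lt_one h0 h1
  apply Summable.of_nat_of_neg <;> simpa using this

theorem tsum_sub_shift {g : ℤ → ℂ} (hg : Summable g) : ∑' n, (g (n + 1) - g n) = 0 := by
  have h1 : Summable fun n => g (n + 1) := (Equiv.addRight (1 : ℤ)).summable_iff.2 hg
  have h2 : ∑' n, g (n + 1) = ∑' n, g n := (Equiv.addRight (1 : ℤ)).tsum_eq g
  rw [h1.tsum_sub hg, h2, sub_self]

/-- Enlarging all norms slightly keeps the ratio below 1. The radii become positive even when a
parameter is 0, and the strict inequalities leave room for a neighbourhood of the parameters. -/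
theorem exists_radii_lt {c : ℝ} {x₁ x₂ x₃ x₄ : ℝ} (h₁ : 0 ≤ x₁) (h₂ : 0 ≤ x₂) (h₃ : 0 ≤ x₃)
    (h₄ : 0 ≤ x₄) (h : c * (x₁ * x₂ * x₃ * x₄) < 1) :
    ∃ r₁ r₂ r₃ r₄ : ℝ, 0 < r₁ ∧ 0 < r₂ ∧ 0 < r₃ ∧ 0 < r₄ ∧ x₁ < r₁ ∧ x₂ < r₂ ∧ x₃ < r₃ ∧ x₄ < r₄ ∧
      c * (r₁ * r₂ * r₃ * r₄) < 1 := by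
  have hc : Continuous fun ε : ℝ => c * ((x₁ + ε) * (x₂ + ε) * (x₃ + ε) * (x₄ + ε)) := by fun_prop
  have h0 : ∀ᶠ ε in 𝓝 (0 : ℝ), c * ((x₁ + ε) * (x₂ + ε) * (x₃ + ε) * (x₄ + ε)) < 1 :=
    (hc.tendsto' 0 _ (by simp only [add_zero])).eventually (gt_mem_nhds h)
  obtain ⟨ε, h1, h2⟩ := ((h0.filter_mono nhdsWithin_le_nhds).and
    (self_mem_nhdsWithin (s := Set.Ioi (0 : ℝ)))).exists
  have h2 : 0 < ε := h2
  exact ⟨x₁ + ε, x₂ + ε, x₃ + ε, x₄ + ε, by linarith, by linarith, by linarith, by linarith,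
    by linarith, by linarith, by linarith, by linarith, h1⟩

theorem exists_radii {c : ℝ} {x₁ x₂ x₃ x₄ : ℝ} (h₁ : 0 ≤ x₁) (h₂ : 0 ≤ x₂) (h₃ : 0 ≤ x₃)
    (h₄ : 0 ≤ x₄) (h : c * (x₁ * x₂ * x₃ * x₄) < 1) :
    ∃ r₁ r₂ r₃ r₄ : ℝ, 0 < r₁ ∧ 0 < r₂ ∧ 0 < r₃ ∧ 0 < r₄ ∧ x₁ ≤ r₁ ∧ x₂ ≤ r₂ ∧ x₃ ≤ r₃ ∧ x₄ ≤ r₄ ∧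
      c * (r₁ * r₂ * r₃ * r₄) < 1 := by
  obtain ⟨r₁, r₂, r₃, r₄, g₁, g₂, g₃, g₄, l₁, l₂, l₃, l₄, hr⟩ := exists_radii_lt h₁ h₂ h₃ h₄ h
  exact ⟨r₁, r₂, r₃, r₄, g₁, g₂, g₃, g₄, l₁.le, l₂.le, l₃.le, l₄.le, hr⟩

end core

/-! ### Bailey's ₆ψ₆ sum by telescoping. -/

/-- The regularized term of the very-well-poised `₆ψ₆` series, with `pᵢ` the reciprocals of its
parameters. -/
noncomputable def psi6Term (q a p₁ p₂ p₃ p₄ : ℂ) (n : ℤ) : ℂ :=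
  core q a p₁ p₂ p₃ p₄ n * (q ^ (-n) - a * q ^ n)

/-- The regularized very-well-poised `₆ψ₆` series. -/
noncomputable def psi6 (q a p₁ p₂ p₃ p₄ : ℂ) : ℂ := ∑' n : ℤ, psi6Term q a p₁ p₂ p₃ p₄ n

section psi6

variable {q σ a : ℂ}

theorem norm_psi6_weight_le (hq0 : q ≠ 0) (hq1 : ‖q‖ < 1) (n : ℤ) :
    ‖q ^ (-n) - a * q ^ n‖ ≤ (1 + ‖a‖) * (‖q‖⁻¹) ^ n.natAbs := by
  have hq : 0 < ‖q‖ := norm_pos_iff.2 hq0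
  have hinv : 1 ≤ ‖q‖⁻¹ := (one_le_inv₀ hq).2 hq1.le
  have h : ∀ m : ℤ, ‖q ^ m‖ ≤ (‖q‖⁻¹) ^ m.natAbs := by
    intro m
    rw [norm_zpow]
    obtain ⟨k, rfl | rfl⟩ := m.eq_nat_or_neg
    · rw [zpow_natCast, Int.natAbs_natCast]
      exact (pow_le_one₀ hq.le hq1.le).trans (one_le_pow₀ hinv)
    · rw [zpow_neg, zpow_natCast, Int.natAbs_neg, Int.natAbs_natCast, inv_pow]
  refine (norm_sub_le _ _).trans ?_
  have h1 := h (-n)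
  rw [Int.natAbs_neg] at h1
  have h2 := h n
  rw [norm_mul, add_mul, one_mul]
  gcongr

theorem norm_psi6Term_le (hq0 : q ≠ 0) (hq1 : ‖q‖ < 1) (hσ : σ ^ 2 = q) (ha : a ≠ 0)
    {r₁ r₂ r₃ r₄ : ℝ} (hr₁ : 0 < r₁) (hr₂ : 0 < r₂) (hr₃ : 0 < r₃) (hr₄ : 0 < r₄) :
    ∃ C : ℝ, 0 ≤ C ∧
      ∀ p₁ p₂ p₃ p₄ : ℂ, ‖p₁‖ ≤ r₁ → ‖p₂‖ ≤ r₂ → ‖p₃‖ ≤ r₃ → ‖p₄‖ ≤ r₄ → ∀ n : ℤ,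
      ‖psi6Term q a p₁ p₂ p₃ p₄ n‖ ≤ C * (‖a‖ ^ 2 * ‖q‖ * (r₁ * r₂ * r₃ * r₄)) ^ n.natAbs := by
  have hq : 0 < ‖q‖ := norm_pos_iff.2 hq0
  obtain ⟨C, hC0, hC⟩ := norm_core_le hq0 hq1 hσ ha hr₁ hr₂ hr₃ hr₄
  refine ⟨C * (1 + ‖a‖), by positivity, fun p₁ p₂ p₃ p₄ h₁ h₂ h₃ h₄ n => ?_⟩
  unfold psi6Term
  rw [norm_mul]
  refine (mul_le_mul (hC p₁ p₂ p₃ p₄ h₁ h₂ h₃ h₄ n) (norm_psi6_weight_le hq0 hq1 n)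
    (norm_nonneg _) (by positivity)).trans (le_of_eq ?_)
  rw [mul_mul_mul_comm, ← mul_pow]
  congr 2
  field_simp

theorem summable_psi6Term (hq0 : q ≠ 0) (hq1 : ‖q‖ < 1) (hσ : σ ^ 2 = q) (ha : a ≠ 0)
    {p₁ p₂ p₃ p₄ : ℂ} (h : ‖a ^ 2 * q * (p₁ * p₂ * p₃ * p₄)‖ < 1) :
    Summable (psi6Term q a p₁ p₂ p₃ p₄) := by
  simp only [norm_mul, norm_pow] at h
  obtain ⟨r₁, r₂, r₃, r₄, g₁, g₂, g₃, g₄, h₁, h₂, h₃, h₄, hr⟩ := exists_radii (norm_nonneg p₁)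
    (norm_nonneg p₂) (norm_nonneg p₃) (norm_nonneg p₄) h
  obtain ⟨C, hC0, hC⟩ := norm_psi6Term_le hq0 hq1 hσ ha g₁ g₂ g₃ g₄
  exact Summable.of_norm_bounded ((summable_pow_natAbs (by positivity) hr).mul_left C)
    (hC p₁ p₂ p₃ p₄ h₁ h₂ h₃ h₄)

/-- By `core_add_one` and `pairFn_shift`, every term is the core at (p₁, p₂, p₃, q p₄) times a
rational function of q^n. After removing the core, the claim is a rational identity in y = q^n. -/
theorem psi6Term_telescope (hq0 : q ≠ 0) (hq1 : ‖q‖ < 1) (ha : a ≠ 0) (p₁ p₂ p₃ p₄ : ℂ) (n : ℤ) :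
    (1 - a ^ 2 * q * (p₁ * p₂ * p₃ * p₄)) * psi6Term q a p₁ p₂ p₃ p₄ n
      - (1 - a * q * p₁ * p₄) * (1 - a * q * p₂ * p₄) * (1 - a * q * p₃ * p₄) *
        psi6Term q a p₁ p₂ p₃ (q * p₄) n
    = (fun n : ℤ => q * p₄ * q ^ (-2 * n) * (core q a p₁ p₂ p₃ (q * p₄) n *
        ((1 - a * p₁ * q ^ n) * (1 - a * p₂ * q ^ n) * (1 - a * p₃ * q ^ n) *
          (1 - a * (q * p₄) * q ^ n)))) (n + 1)
      - (fun n : ℤ => q * p₄ * q ^ (-2 * n) * (core q a p₁ p₂ p₃ (q * p₄) n *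
        ((1 - a * p₁ * q ^ n) * (1 - a * p₂ * q ^ n) * (1 - a * p₃ * q ^ n) *
          (1 - a * (q * p₄) * q ^ n)))) n := by
  simp only
  rw [core_add_one hq0 hq1 ha]
  have hcore : core q a p₁ p₂ p₃ p₄ n = core q a p₁ p₂ p₃ (q * p₄) n *
      ((1 - a * p₄ * q ^ (n + 1)) * (1 - p₄ * q ^ (1 - n))) := by
    unfold core
    rw [pairFn_shift hq1 p₄ n]
    ring
  unfold psi6Term
  rw [hcore]
  generalize core q a p₁ p₂ p₃ (q * p₄) n = c
  have hy : q ^ n ≠ 0 := zpow_ne_zero _ hq0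
  have e1 : q ^ (n + 1) = q ^ n * q := zpow_add_one₀ hq0 n
  have e2 : q ^ (1 - n) = q / q ^ n := by rw [zpow_sub₀ hq0, zpow_one]
  have e3 : q ^ (-n) = (q ^ n)⁻¹ := zpow_neg _ _
  have e4 : q ^ (-2 * n) = ((q ^ n) ^ 2)⁻¹ := by
    rw [neg_mul, zpow_neg, mul_comm, zpow_mul]; rfl
  have e5 : q ^ (-2 * (n + 1)) = ((q ^ n) ^ 2 * q ^ 2)⁻¹ := by
    rw [neg_mul, zpow_neg, mul_comm, zpow_mul, e1]
    congr 1; norm_cast; ring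
  have e6 : q ^ (4 * n + 2) = (q ^ n) ^ 4 * q ^ 2 := by
    rw [zpow_add₀ hq0, mul_comm 4 n, zpow_mul]; rfl
  rw [e1, e2, e3, e4, e5, e6]
  generalize q ^ n = y at hy
  field_simp
  ring

theorem psi6_shift (hq0 : q ≠ 0) (hq1 : ‖q‖ < 1) (hσ : σ ^ 2 = q) (ha : a ≠ 0)
    {p₁ p₂ p₃ p₄ : ℂ} (h : ‖a ^ 2 * q * (p₁ * p₂ * p₃ * p₄)‖ < 1) :
    (1 - a ^ 2 * q * (p₁ * p₂ * p₃ * p₄)) * psi6 q a p₁ p₂ p₃ p₄ =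
      (1 - a * q * p₁ * p₄) * (1 - a * q * p₂ * p₄) * (1 - a * q * p₃ * p₄) *
        psi6 q a p₁ p₂ p₃ (q * p₄) := by
  have hq : 0 < ‖q‖ := norm_pos_iff.2 hq0
  have s1 := summable_psi6Term hq0 hq1 hσ ha h
  have h' : ‖a ^ 2 * q * (p₁ * p₂ * p₃ * (q * p₄))‖ < 1 := by
    rw [show a ^ 2 * q * (p₁ * p₂ * p₃ * (q * p₄)) = q * (a ^ 2 * q * (p₁ * p₂ * p₃ * p₄)) by ring,
      norm_mul]
    nlinarith [norm_nonneg (a ^ 2 * q * (p₁ * p₂ * p₃ * p₄))]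
  have s2 := summable_psi6Term hq0 hq1 hσ ha h'
  have hg : Summable fun n : ℤ => q * p₄ * q ^ (-2 * n) * (core q a p₁ p₂ p₃ (q * p₄) n *
        ((1 - a * p₁ * q ^ n) * (1 - a * p₂ * q ^ n) * (1 - a * p₃ * q ^ n) *
          (1 - a * (q * p₄) * q ^ n))) := by
    simp only [norm_mul, norm_pow] at h
    obtain ⟨r₁, r₂, r₃, r₄, g₁, g₂, g₃, g₄, h₁, h₂, h₃, h₄, hr⟩ := exists_radii (norm_nonneg p₁)
      (norm_nonneg p₂) (norm_nonneg p₃) (norm_nonneg p₄) h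
    obtain ⟨C, hC0, hC⟩ := norm_core_le hq0 hq1 hσ ha g₁ g₂ g₃ (mul_pos hq g₄)
    let M : ℝ := (1 + ‖a‖ * r₁) * (1 + ‖a‖ * r₂) * (1 + ‖a‖ * r₃) * (1 + ‖a‖ * (‖q‖ * r₄))
    refine Summable.of_norm_bounded ((summable_pow_natAbs (by positivity) hr).mul_left
      (‖q * p₄‖ * C * M)) fun n => ?_
    have hc := hC p₁ p₂ p₃ (q * p₄) h₁ h₂ h₃ (by rw [norm_mul]; gcongr) n
    -- For n ≥ 0 the growth comes from q^{-2n}. For n = -k the four linear factors contribute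
    -- ‖q‖^{-4k}, tempered by ‖q‖^{2k}. Either way the cost is ‖q‖^{-2|n|}, which the core at q p₄
    -- absorbs exactly down to the ratio ‖a‖²‖q‖r₁r₂r₃r₄.
    have hfac : ‖q ^ (-2 * n)‖ * ‖(1 - a * p₁ * q ^ n) * (1 - a * p₂ * q ^ n) *
        (1 - a * p₃ * q ^ n) * (1 - a * (q * p₄) * q ^ n)‖ ≤ M * (‖q‖⁻¹ ^ 2) ^ n.natAbs := by
      have hb : ∀ {x : ℂ} {r : ℝ}, ‖x‖ ≤ r → ∀ w : ℂ, ∀ t : ℝ, ‖w‖ ≤ t → 1 ≤ t →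
          ‖1 - a * x * w‖ ≤ (1 + ‖a‖ * r) * t := by
        intro x r hx w t hw ht
        refine (norm_sub_le _ _).trans ?_
        rw [norm_mul, norm_mul, norm_one, add_mul, one_mul]
        gcongr
        exact mul_nonneg (norm_nonneg _) ((norm_nonneg _).trans hx)
      have h4' : ‖q * p₄‖ ≤ ‖q‖ * r₄ := by rw [norm_mul]; gcongr
      obtain ⟨k, rfl | rfl⟩ := n.eq_nat_or_neg
      · have hw : ‖q ^ (k : ℤ)‖ ≤ 1 := by
          rw [zpow_natCast, norm_pow]; exact pow_le_one₀ hq.le hq1.le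
        have e : ‖q ^ (-2 * (k : ℤ))‖ = (‖q‖⁻¹ ^ 2) ^ k := by
          rw [norm_zpow, neg_mul, zpow_neg, ← pow_mul, inv_pow]; norm_cast
        rw [e, Int.natAbs_natCast, mul_comm]
        gcongr
        simp only [norm_mul]
        have b1 := hb h₁ _ 1 hw le_rfl
        have b2 := hb h₂ _ 1 hw le_rfl
        have b3 := hb h₃ _ 1 hw le_rfl
        have b4 := hb h4' _ 1 hw le_rfl
        simp only [mul_one] at b1 b2 b3 b4
        simp only [M]
        gcongr
      · have ht : 1 ≤ (‖q‖⁻¹) ^ k := one_le_pow₀ ((one_le_inv₀ hq).2 hq1.le)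
        have hw : ‖q ^ (-(k : ℤ))‖ ≤ (‖q‖⁻¹) ^ k := by
          rw [norm_zpow, zpow_neg, zpow_natCast, inv_pow]
        have e : ‖q ^ (-2 * -(k : ℤ))‖ = ‖q‖ ^ (2 * k) := by
          rw [norm_zpow, neg_mul_neg]; norm_cast
        rw [e, Int.natAbs_neg, Int.natAbs_natCast]
        simp only [norm_mul]
        have b1 := hb h₁ _ _ hw ht
        have b2 := hb h₂ _ _ hw ht
        have b3 := hb h₃ _ _ hw ht
        have b4 := hb h4' _ _ hw ht
        calc _ ≤ ‖q‖ ^ (2 * k) * ((1 + ‖a‖ * r₁) * (‖q‖⁻¹) ^ k * ((1 + ‖a‖ * r₂) * (‖q‖⁻¹) ^ k) *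
              ((1 + ‖a‖ * r₃) * (‖q‖⁻¹) ^ k) * ((1 + ‖a‖ * (‖q‖ * r₄)) * (‖q‖⁻¹) ^ k)) := by
              gcongr
          _ = _ := by
              simp only [M]
              have hk : ‖q‖ ^ k ≠ 0 := by positivity
              rw [mul_comm 2 k, pow_mul]
              simp only [inv_pow]
              rw [← pow_mul ‖q‖ 2 k, mul_comm 2 k, pow_mul]
              field_simp
    calc _ = ‖q * p₄‖ * ‖core q a p₁ p₂ p₃ (q * p₄) n‖ * (‖q ^ (-2 * n)‖ *
          ‖(1 - a * p₁ * q ^ n) * (1 - a * p₂ * q ^ n) *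
        (1 - a * p₃ * q ^ n) * (1 - a * (q * p₄) * q ^ n)‖) := by
          simp only [norm_mul]; ring
      _ ≤ ‖q * p₄‖ * (C * (‖a‖ ^ 2 * ‖q‖ ^ 2 * (r₁ * r₂ * r₃ * (‖q‖ * r₄))) ^ n.natAbs) *
          (M * (‖q‖⁻¹ ^ 2) ^ n.natAbs) := by gcongr
      _ = ‖q * p₄‖ * C * M * ((‖a‖ ^ 2 * ‖q‖ ^ 2 * (r₁ * r₂ * r₃ * (‖q‖ * r₄))) *
          (‖q‖⁻¹ ^ 2)) ^ n.natAbs := by rw [mul_pow _ (‖q‖⁻¹ ^ 2)]; ring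
      _ = _ := by
          congr 2
          field_simp
  have key := tsum_sub_shift hg
  rw [← tsum_congr (psi6Term_telescope hq0 hq1 ha p₁ p₂ p₃ p₄),
    (s1.mul_left _).tsum_sub (s2.mul_left _), tsum_mul_left, tsum_mul_left] at key
  exact sub_eq_zero.1 key

end psi6

section psi6

variable {q σ a : ℂ}

theorem psi6_rotate (p₁ p₂ p₃ p₄ : ℂ) : psi6 q a p₁ p₂ p₃ p₄ = psi6 q a p₄ p₁ p₂ p₃ := by
  unfold psi6 psi6Term core
  exact tsum_congr fun n => by ring

theorem continuous_pairFn (hq1 : ‖q‖ < 1) (n : ℤ) : Continuous fun p => pairFn q a p n := by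
  have := continuous_qInf hq1
  unfold pairFn
  fun_prop

theorem tendsto_pairFn_mul_pow (hq1 : ‖q‖ < 1) (p : ℂ) (n : ℤ) :
    Tendsto (fun N : ℕ => pairFn q a (p * q ^ N) n) atTop (𝓝 1) := by
  have := ((continuous_pairFn (a := a) hq1 n).tendsto 0).comp (tendsto_mul_pow_zero hq1 p)
  rwa [pairFn_zero_left] at this

theorem psi6_shift_iterate (hq0 : q ≠ 0) (hq1 : ‖q‖ < 1) (hσ : σ ^ 2 = q) (ha : a ≠ 0)
    {p₁ p₂ p₃ p₄ : ℂ} (h : ‖a ^ 2 * q * (p₁ * p₂ * p₃ * p₄)‖ < 1) (N : ℕ) :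
    qFin q (a ^ 2 * q * (p₁ * p₂ * p₃ * p₄)) N * psi6 q a p₁ p₂ p₃ p₄ =
      qFin q (a * q * p₁ * p₄) N * qFin q (a * q * p₂ * p₄) N * qFin q (a * q * p₃ * p₄) N *
        psi6 q a p₁ p₂ p₃ (p₄ * q ^ N) := by
  induction N with
  | zero => simp [qFin]
  | succ N ih =>
    have e : a ^ 2 * q * (p₁ * p₂ * p₃ * (p₄ * q ^ N))
        = a ^ 2 * q * (p₁ * p₂ * p₃ * p₄) * q ^ N := by ring
    have h' : ‖a ^ 2 * q * (p₁ * p₂ * p₃ * (p₄ * q ^ N))‖ < 1 := by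
      rw [e]
      exact (norm_mul_pow_le hq1 le_rfl N).trans_lt h
    have hs := psi6_shift hq0 hq1 hσ ha h'
    rw [e] at hs
    simp only [qFin_succ]
    rw [show p₄ * q ^ (N + 1) = q * (p₄ * q ^ N) by ring]
    calc _ = (1 - a ^ 2 * q * (p₁ * p₂ * p₃ * p₄) * q ^ N) *
          (qFin q (a ^ 2 * q * (p₁ * p₂ * p₃ * p₄)) N * psi6 q a p₁ p₂ p₃ p₄) := by ring
      _ = qFin q (a * q * p₁ * p₄) N * qFin q (a * q * p₂ * p₄) N * qFin q (a * q * p₃ * p₄) N *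
          ((1 - a ^ 2 * q * (p₁ * p₂ * p₃ * p₄) * q ^ N) *
            psi6 q a p₁ p₂ p₃ (p₄ * q ^ N)) := by rw [ih]; ring
      _ = _ := by rw [hs]; ring

theorem tendsto_psi6_mul_pow (hq0 : q ≠ 0) (hq1 : ‖q‖ < 1) (hσ : σ ^ 2 = q) (ha : a ≠ 0)
    {p₁ p₂ p₃ p₄ : ℂ} (h : ‖a ^ 2 * q * (p₁ * p₂ * p₃ * p₄)‖ < 1) :
    Tendsto (fun N : ℕ => psi6 q a p₁ p₂ p₃ (p₄ * q ^ N)) atTop (𝓝 (psi6 q a p₁ p₂ p₃ 0)) := by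
  simp only [norm_mul, norm_pow] at h
  obtain ⟨r₁, r₂, r₃, r₄, g₁, g₂, g₃, g₄, h₁, h₂, h₃, h₄, hr⟩ := exists_radii (norm_nonneg p₁)
    (norm_nonneg p₂) (norm_nonneg p₃) (norm_nonneg p₄) h
  obtain ⟨C, hC0, hC⟩ := norm_psi6Term_le hq0 hq1 hσ ha g₁ g₂ g₃ g₄
  refine tendsto_tsum_of_dominated_convergence
    ((summable_pow_natAbs (by positivity) hr).mul_left C) (fun n => ?_)
    (Eventually.of_forall fun N n =>
      hC p₁ p₂ p₃ (p₄ * q ^ N) h₁ h₂ h₃ (norm_mul_pow_le hq1 h₄ N) n)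
  have := tendsto_pairFn_mul_pow (a := a) hq1 p₄ n
  unfold psi6Term core
  rw [pairFn_zero_left]
  exact ((this.const_mul _).const_mul _).mul_const _

/-- The limit N → ∞ of the iterated shift: it removes one parameter at the price of explicit
products. -/
theorem psi6_eq_mul_zero (hq0 : q ≠ 0) (hq1 : ‖q‖ < 1) (hσ : σ ^ 2 = q) (ha : a ≠ 0)
    {p₁ p₂ p₃ p₄ : ℂ} (h : ‖a ^ 2 * q * (p₁ * p₂ * p₃ * p₄)‖ < 1) :
    qInf q (a ^ 2 * q * (p₁ * p₂ * p₃ * p₄)) * psi6 q a p₁ p₂ p₃ p₄ =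
      qInf q (a * q * p₁ * p₄) * qInf q (a * q * p₂ * p₄) * qInf q (a * q * p₃ * p₄) *
        psi6 q a p₁ p₂ p₃ 0 := by
  refine tendsto_nhds_unique ((tendsto_qFin hq1 _).mul_const _) ?_
  simp only [psi6_shift_iterate hq0 hq1 hσ ha h]
  exact (((tendsto_qFin hq1 _).mul (tendsto_qFin hq1 _)).mul (tendsto_qFin hq1 _)).mul
    (tendsto_psi6_mul_pow hq0 hq1 hσ ha h)

theorem qInf_zpow_of_nonpos (hq0 : q ≠ 0) (hq1 : ‖q‖ < 1) {m : ℤ} (hm : m ≤ 0) :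
    qInf q (q ^ m) = 0 := by
  by_contra h
  obtain ⟨k, hk⟩ := Int.eq_ofNat_of_zero_le (neg_nonneg.2 hm)
  refine (qInf_ne_zero_iff hq1 _).1 h k ?_
  rw [← zpow_natCast, ← hk, ← zpow_add₀ hq0]
  simp

/-- The parameter 1/a kills all terms with n < 0 and the parameter 1 kills all with n > 0. -/
theorem psi6_single (hq0 : q ≠ 0) (hq1 : ‖q‖ < 1) (ha : a ≠ 0) :
    psi6 q a a⁻¹ 1 0 0 = (1 - a) * qInf q q ^ 2 * qInf q (q / a) * qInf q (a * q) := by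
  unfold psi6
  rw [tsum_eq_single 0]
  · simp only [psi6Term, core, pairFn, mul_zero, zero_mul, qInf_zero, mul_inv_cancel₀ ha, zpow_zero,
      zero_add, zpow_one, sub_zero, neg_zero, one_mul, mul_one, ne_eq, OfNat.ofNat_ne_zero,
      not_false_eq_true, zero_pow, inv_mul_eq_div]
    ring
  · intro n hn
    unfold psi6Term core
    rcases lt_or_gt_of_ne hn with h | h
    · have : pairFn q a a⁻¹ n = 0 := by
        unfold pairFn
        rw [mul_inv_cancel₀ ha, one_mul, qInf_zpow_of_nonpos hq0 hq1 (by omega), zero_mul]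
      rw [this]; ring
    · have : pairFn q a 1 n = 0 := by
        unfold pairFn
        rw [one_mul, qInf_zpow_of_nonpos hq0 hq1 (m := 1 - n) (by omega), mul_zero]
      rw [this]; ring

theorem psi6_two (hq0 : q ≠ 0) (hq1 : ‖q‖ < 1) (hσ : σ ^ 2 = q) (ha : a ≠ 0) (p₁ p₂ : ℂ) :
    psi6 q a p₁ p₂ 0 0 = qInf q (a * q * p₁ * p₂) * psi6 q a 0 0 0 0 := by
  have h1 := psi6_eq_mul_zero (p₁ := p₁) (p₂ := 0) (p₃ := 0) (p₄ := p₂) hq0 hq1 hσ ha (by simp)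
  have h2 := psi6_eq_mul_zero (p₁ := 0) (p₂ := 0) (p₃ := 0) (p₄ := p₁) hq0 hq1 hσ ha (by simp)
  simp only [mul_zero, zero_mul, qInf_zero, one_mul, mul_one] at h1 h2
  have h3 : psi6 q a p₁ p₂ 0 0 = psi6 q a p₁ 0 0 p₂ := by
    unfold psi6 psi6Term core
    exact tsum_congr fun n => by ring
  rw [h3, h1, psi6_rotate, psi6_rotate, psi6_rotate, h2]

/-- The value does not depend on p₁, p₂ beyond the product in `psi6_two`, so it can be read off from
the one-term case p₁ = 1/a, p₂ = 1. -/
theorem psi6_zero (hq0 : q ≠ 0) (hq1 : ‖q‖ < 1) (hσ : σ ^ 2 = q) (ha : a ≠ 0) :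
    psi6 q a 0 0 0 0 = qInf q q * qTheta q a := by
  have h := psi6_two hq0 hq1 hσ ha a⁻¹ 1
  rw [psi6_single hq0 hq1 ha, show a * q * a⁻¹ * 1 = q by field_simp] at h
  have hP := qInf_self_ne_zero hq1
  refine mul_left_cancel₀ hP ?_
  rw [← h, qTheta, qInf_step hq1 a]
  ring

/-- Bailey's very-well-poised `₆ψ₆` summation, in regularized form. -/
theorem psi6_eq (hq0 : q ≠ 0) (hq1 : ‖q‖ < 1) (hσ : σ ^ 2 = q) (ha : a ≠ 0)
    {p₁ p₂ p₃ p₄ : ℂ} (h : ‖a ^ 2 * q * (p₁ * p₂ * p₃ * p₄)‖ < 1) :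
    qInf q (a ^ 2 * q * (p₁ * p₂ * p₃ * p₄)) * psi6 q a p₁ p₂ p₃ p₄ =
      qInf q q * qTheta q a * (qInf q (a * q * p₁ * p₂) * qInf q (a * q * p₁ * p₃) *
        qInf q (a * q * p₁ * p₄) * qInf q (a * q * p₂ * p₃) * qInf q (a * q * p₂ * p₄) *
        qInf q (a * q * p₃ * p₄)) := by
  rw [psi6_eq_mul_zero hq0 hq1 hσ ha h]
  have h1 := psi6_eq_mul_zero (p₁ := p₁) (p₂ := p₂) (p₃ := 0) (p₄ := p₃) hq0 hq1 hσ ha (by simp)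
  simp only [mul_zero, zero_mul, qInf_zero, one_mul, mul_one] at h1
  have h2 : psi6 q a p₁ p₂ p₃ 0 = psi6 q a p₁ p₂ 0 p₃ := by
    unfold psi6 psi6Term core
    exact tsum_congr fun n => by ring
  rw [h2, h1, psi6_two hq0 hq1 hσ ha, psi6_zero hq0 hq1 hσ ha]
  ring

end psi6

/-! ### Jacobi's triple product and Weierstrass' theta identity. -/

section theta

variable {q σ : ℂ}

theorem zpow_half (hσ : σ ^ 2 = q) (n : ℤ) : q ^ (n * (n - 1) / 2) = σ ^ (n * (n - 1)) := by
  have h : n * (n - 1) = 2 * (n * (n - 1) / 2) := by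
    have : (2 : ℤ) ∣ n * (n - 1) := (Int.even_mul_pred_self n).two_dvd
    omega
  conv_rhs => rw [h, zpow_mul]
  rw [← hσ]
  rfl

theorem summable_norm_sq_zpow {t y : ℂ} (ht0 : t ≠ 0) (ht : ‖t‖ < 1) (hy : y ≠ 0) :
    Summable fun n : ℤ => ‖t ^ (n ^ 2) * y ^ n‖ := by
  have key : ∀ w : ℂ, w ≠ 0 → Summable fun n : ℕ => ‖t ^ (n ^ 2) * w ^ n‖ := by
    intro w hw
    refine summable_of_ratio_test_tendsto_lt_one (l := 0) one_pos
      (Eventually.of_forall fun n => norm_ne_zero_iff.2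
        (mul_ne_zero (pow_ne_zero _ ht0) (pow_ne_zero _ hw))) ?_
    have h1 : Tendsto (fun n : ℕ => ‖w * t‖ * (‖t‖ ^ 2) ^ n) atTop (𝓝 0) := by
      simpa using (tendsto_pow_atTop_nhds_zero_of_lt_one (by positivity)
        (by nlinarith [norm_nonneg t] : ‖t‖ ^ 2 < 1)).const_mul ‖w * t‖
    refine h1.congr fun n => ?_
    rw [norm_norm, norm_norm, eq_div_iff (norm_ne_zero_iff.2
      (mul_ne_zero (pow_ne_zero _ ht0) (pow_ne_zero _ hw)))]
    simp only [norm_mul, norm_pow]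
    ring
  apply Summable.of_nat_of_neg
  · refine (key y hy).congr fun n => ?_
    norm_cast
  · refine (key y⁻¹ (inv_ne_zero hy)).congr fun n => ?_
    rw [neg_sq, zpow_neg, ← inv_zpow]
    norm_cast

theorem thetaTerm_eq (hσ : σ ^ 2 = q) (hσ0 : σ ≠ 0) (x : ℂ) (n : ℤ) :
    (-1) ^ n * q ^ (n * (n - 1) / 2) * x ^ n = σ ^ (n ^ 2) * (-(x / σ)) ^ n := by
  rw [zpow_half hσ, show n * (n - 1) = n ^ 2 - n by ring, zpow_sub₀ hσ0,
    show -(x / σ) = (-1) * (x / σ) by ring, mul_zpow, div_zpow]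
  ring

theorem summable_norm_thetaTerm (hq0 : q ≠ 0) (hq1 : ‖q‖ < 1) (hσ : σ ^ 2 = q) {x : ℂ}
    (hx : x ≠ 0) : Summable fun n : ℤ => ‖(-1) ^ n * q ^ (n * (n - 1) / 2) * x ^ n‖ := by
  have hσ0 : σ ≠ 0 := by rintro rfl; exact hq0 (by rw [← hσ]; simp)
  have hσ1 : ‖σ‖ < 1 := by
    rw [← hσ, norm_pow] at hq1
    exact (sq_lt_one_iff₀ (norm_nonneg _)).1 hq1
  simp only [thetaTerm_eq hσ hσ0]
  exact summable_norm_sq_zpow hσ0 hσ1 (neg_ne_zero.2 (div_ne_zero hx hσ0))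

theorem hasSum_of_cover {α β : Type*} {f : α → ℂ} {i₁ i₂ : β → α} {s t : ℂ}
    (h₁ : Function.Injective i₁) (h₂ : Function.Injective i₂) (hd : ∀ x y, i₁ x ≠ i₂ y)
    (hc : ∀ z, (∃ x, i₁ x = z) ∨ ∃ x, i₂ x = z) (hs : HasSum (fun x => f (i₁ x)) s)
    (ht : HasSum (fun x => f (i₂ x)) t) : HasSum f (s + t) := by
  refine HasSum.add_isCompl (s := Set.range i₁) (t := Set.range i₂) ⟨?_, ?_⟩
    (h₁.hasSum_range_iff.2 hs) (h₂.hasSum_range_iff.2 ht)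
  · rw [Set.disjoint_left]
    rintro _ ⟨x, rfl⟩ ⟨y, hy⟩
    exact hd x y hy.symm
  · rw [codisjoint_iff]
    exact Set.eq_univ_of_forall fun z => hc z

theorem tsum_int_even_add_odd {f : ℤ → ℂ} (hf : Summable f) :
    ∑' n, f n = ∑' n, f (2 * n) + ∑' n, f (2 * n + 1) := by
  have i1 : Function.Injective fun n : ℤ => 2 * n := fun m n h => by simpa using h
  have i2 : Function.Injective fun n : ℤ => 2 * n + 1 := fun m n h => by simpa using h
  refine (hasSum_of_cover i1 i2 (fun x y => by omega) (fun z => ?_)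
    (hf.comp_injective i1).hasSum (hf.comp_injective i2).hasSum).tsum_eq
  obtain ⟨k, hk | hk⟩ := Int.even_or_odd' z
  · exact Or.inl ⟨k, hk.symm⟩
  · exact Or.inr ⟨k, hk.symm⟩

/-- The Jacobi triple product identity. -/
theorem theta_eq_qTheta (hq0 : q ≠ 0) (hq1 : ‖q‖ < 1) (hσ : σ ^ 2 = q) {x : ℂ} (hx : x ≠ 0) :
    theta q x = qTheta q x := by
  have hs := (summable_norm_thetaTerm hq0 hq1 hσ hx).of_norm
  have hP := qInf_self_ne_zero hq1
  unfold theta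
  -- Grouping the theta series into the pairs of indices 2n, 2n + 1 gives a factor q^{-n} - x q^n,
  -- which is the very-well-poised factor of the ₆ψ₆ with all parameters 0.
  rw [inv_mul_eq_iff_eq_mul₀ hP, ← psi6_zero hq0 hq1 hσ hx, tsum_int_even_add_odd hs,
    ← Summable.tsum_add]
  · unfold psi6
    refine tsum_congr fun n => ?_
    have e1 : 2 * n * (2 * n - 1) / 2 = 2 * n ^ 2 + -n := by
      rw [mul_assoc, Int.mul_ediv_cancel_left _ two_ne_zero]; ring
    have e2 : (2 * n + 1) * (2 * n + 1 - 1) / 2 = 2 * n ^ 2 + n := by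
      rw [show (2 * n + 1) * (2 * n + 1 - 1) = 2 * (2 * n ^ 2 + n) by ring,
        Int.mul_ediv_cancel_left _ two_ne_zero]
    rw [e1, e2, zpow_add₀ hq0, zpow_add₀ hq0, zpow_add_one₀ hx, zpow_add_one₀ (by norm_num),
      zpow_mul (-1 : ℂ)]
    simp only [psi6Term, core, pairFn_zero_left]
    norm_num
    ring
  · exact hs.comp_injective fun m n h => by simpa using h
  · exact hs.comp_injective fun m n h => by simpa using h

/-- Even part of the duplication of the Jacobi theta series. -/
noncomputable def thetaEven (q x : ℂ) : ℂ := ∑' n : ℤ, q ^ (n ^ 2) * x ^ (2 * n)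

/-- Odd part of the duplication of the Jacobi theta series. -/
noncomputable def thetaOdd (q x : ℂ) : ℂ := ∑' n : ℤ, q ^ (n ^ 2 + n) * x ^ (2 * n + 1)

theorem summable_norm_thetaEven (hq0 : q ≠ 0) (hq1 : ‖q‖ < 1) {x : ℂ} (hx : x ≠ 0) :
    Summable fun n : ℤ => ‖q ^ (n ^ 2) * x ^ (2 * n)‖ := by
  refine (summable_norm_sq_zpow hq0 hq1 (pow_ne_zero 2 hx)).congr fun n => ?_
  rw [zpow_mul]; rfl

theorem summable_norm_thetaOdd (hq0 : q ≠ 0) (hq1 : ‖q‖ < 1) {x : ℂ} (hx : x ≠ 0) :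
    Summable fun n : ℤ => ‖q ^ (n ^ 2 + n) * x ^ (2 * n + 1)‖ := by
  refine ((summable_norm_sq_zpow hq0 hq1 (mul_ne_zero hq0 (pow_ne_zero 2 hx))).mul_left
    ‖x‖).congr fun n => ?_
  rw [← norm_mul, zpow_add₀ hq0, zpow_add_one₀ hx, zpow_mul, mul_zpow]
  congr 1
  norm_cast
  ring

/-- In the double sum over (m, n) the exponents of x and a are m + n and m - n, which have equal
parity. On each parity class the sum factors into a function of x times a function of a, and the
sign (-1)^{m+n} turns the total into a determinant. -/
theorem theta_mul_theta (hq0 : q ≠ 0) (hq1 : ‖q‖ < 1) (hσ : σ ^ 2 = q) {x a : ℂ} (hx : x ≠ 0)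
    (ha : a ≠ 0) : theta q (x * a) * theta q (x / a) = ((qInf q q)⁻¹) ^ 2 *
      (x * (thetaOdd q x * thetaEven q a - thetaEven q x * thetaOdd q a)) := by
  have hσ0 : σ ≠ 0 := by rintro rfl; exact hq0 (by rw [← hσ]; simp)
  have hmul := tsum_mul_tsum_of_summable_norm
    (summable_norm_thetaTerm hq0 hq1 hσ (mul_ne_zero hx ha))
    (summable_norm_thetaTerm hq0 hq1 hσ (div_ne_zero hx ha))
  have hqσ : ∀ m : ℤ, q ^ m = σ ^ (2 * m) := fun m => by rw [zpow_mul, ← hσ]; rfl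
  have hf : ∀ m n : ℤ, (-1) ^ m * q ^ (m * (m - 1) / 2) * (x * a) ^ m *
      ((-1) ^ n * q ^ (n * (n - 1) / 2) * (x / a) ^ n) = (-1) ^ (m + n) *
      (σ ^ (m * (m - 1) + n * (n - 1)) * (x ^ (m + n) * a ^ (m - n))) := by
    intro m n
    rw [zpow_half hσ, zpow_half hσ, zpow_add₀ (by norm_num), zpow_add₀ hσ0, zpow_add₀ hx,
      zpow_sub₀ ha, mul_zpow, div_zpow]
    ring
  have h1 : HasSum (fun w : ℤ × ℤ => x * ((q ^ (w.1 ^ 2 + w.1) * x ^ (2 * w.1 + 1)) *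
      (q ^ (w.2 ^ 2) * a ^ (2 * w.2)))) (x * (thetaOdd q x * thetaEven q a)) := by
    have e := (summable_mul_of_summable_norm (summable_norm_thetaOdd hq0 hq1 hx)
      (summable_norm_thetaEven hq0 hq1 ha)).hasSum.mul_left x
    rwa [← tsum_mul_tsum_of_summable_norm (summable_norm_thetaOdd hq0 hq1 hx)
      (summable_norm_thetaEven hq0 hq1 ha)] at e
  have h2 : HasSum (fun w : ℤ × ℤ => -x * ((q ^ (w.1 ^ 2) * x ^ (2 * w.1)) *
      (q ^ (w.2 ^ 2 + w.2) * a ^ (2 * w.2 + 1)))) (-x * (thetaEven q x * thetaOdd q a)) := by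
    have e := (summable_mul_of_summable_norm (summable_norm_thetaEven hq0 hq1 hx)
      (summable_norm_thetaOdd hq0 hq1 ha)).hasSum.mul_left (-x)
    rwa [← tsum_mul_tsum_of_summable_norm (summable_norm_thetaEven hq0 hq1 hx)
      (summable_norm_thetaOdd hq0 hq1 ha)] at e
  have hsum : HasSum (fun w : ℤ × ℤ => (-1) ^ (w.1 + w.2) *
      (σ ^ (w.1 * (w.1 - 1) + w.2 * (w.2 - 1)) * (x ^ (w.1 + w.2) * a ^ (w.1 - w.2))))
      (x * (thetaOdd q x * thetaEven q a) + -x * (thetaEven q x * thetaOdd q a)) := by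
    -- The even class uses m + n = 2(s + 1), not 2s. With this shift m(m-1) + n(n-1) becomes 2(s² +
    -- s + d²), so the x-part is the odd series times x.
    refine hasSum_of_cover (i₁ := fun w : ℤ × ℤ => (w.1 + 1 + w.2, w.1 + 1 - w.2))
      (i₂ := fun w : ℤ × ℤ => (w.1 + w.2 + 1, w.1 - w.2)) ?_ ?_ ?_ ?_ (h1.congr_fun ?_)
      (h2.congr_fun ?_)
    · rintro ⟨a, b⟩ ⟨c, d⟩ h
      simp only [Prod.mk.injEq] at h ⊢
      omega
    · rintro ⟨a, b⟩ ⟨c, d⟩ h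
      simp only [Prod.mk.injEq] at h ⊢
      omega
    · rintro ⟨a, b⟩ ⟨c, d⟩ h
      simp only [Prod.mk.injEq] at h
      omega
    · rintro ⟨m, n⟩
      obtain ⟨k, hk | hk⟩ := Int.even_or_odd' (m + n)
      · exact Or.inl ⟨(k - 1, m - k), by simp only [Prod.mk.injEq]; omega⟩
      · exact Or.inr ⟨(k, m - k - 1), by simp only [Prod.mk.injEq]; omega⟩
    · rintro ⟨s, d⟩
      simp only
      rw [show s + 1 + d + (s + 1 - d) = 2 * (s + 1) by ring, zpow_mul,
        show s + 1 + d - (s + 1 - d) = 2 * d by ring,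
        show (s + 1 + d) * (s + 1 + d - 1) + (s + 1 - d) * (s + 1 - d - 1)
          = 2 * (s ^ 2 + s + d ^ 2) by ring, ← hqσ, zpow_add₀ hq0 (s ^ 2 + s),
        show 2 * (s + 1) = 2 * s + 1 + 1 by ring, zpow_add_one₀ hx (2 * s + 1)]
      norm_num
      ring
    · rintro ⟨s, d⟩
      simp only
      rw [show s + d + 1 + (s - d) = 2 * s + 1 by ring, zpow_add_one₀ (by norm_num), zpow_mul,
        show s + d + 1 - (s - d) = 2 * d + 1 by ring,
        show (s + d + 1) * (s + d + 1 - 1) + (s - d) * (s - d - 1)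
          = 2 * (s ^ 2 + (d ^ 2 + d)) by ring, ← hqσ, zpow_add₀ hq0 (s ^ 2), zpow_add_one₀ hx]
      norm_num
      ring
  unfold theta
  rw [mul_mul_mul_comm, hmul]
  simp only [hf]
  rw [hsum.tsum_eq]
  ring

/-- Weierstrass' theta identity in its usual form. -/
theorem theta_weierstrass (hq0 : q ≠ 0) (hq1 : ‖q‖ < 1) (hσ : σ ^ 2 = q) {x a b c : ℂ}
    (hx : x ≠ 0) (ha : a ≠ 0) (hb : b ≠ 0) (hc : c ≠ 0) :
    theta q (x * a) * theta q (x / a) * (theta q (b * c) * theta q (b / c)) -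
      theta q (x * c) * theta q (x / c) * (theta q (b * a) * theta q (b / a)) =
      b / a * (theta q (x * b) * theta q (x / b) * (theta q (a * c) * theta q (a / c))) := by
  -- Writing [uv] for the determinant of u and v, what remains is the Plücker relation [xa][bc] -
  -- [xc][ba] = [xb][ac].
  simp only [theta_mul_theta hq0 hq1 hσ, hx, ha, hb, hc, ne_eq, not_false_eq_true]
  field_simp
  ring

/-- Weierstrass' theta identity for the products `(x, q/x; q)_∞`. -/
theorem qTheta_weierstrass (hq0 : q ≠ 0) (hq1 : ‖q‖ < 1) (hσ : σ ^ 2 = q) {a b c d e : ℂ}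
    (ha : a ≠ 0) (hb : b ≠ 0) (hc : c ≠ 0) (hd : d ≠ 0) (he : e ≠ 0)
    (h : a ^ 2 * q = b * c * d * e) :
    qTheta q b * qTheta q c * qTheta q d * qTheta q e -
      qTheta q a * qTheta q (b * c / a) * qTheta q (b * d / a) * qTheta q (b * e / a) =
      a * (qTheta q (b / a) * qTheta q (c / a) * qTheta q (d / a) * qTheta q (e / a)) := by
  -- With x² = bc, the choice (x, b/x, dx/a, a/x) in the usual form produces exactly the twelve
  -- arguments below, up to the inversions y ↦ q/y and y ↦ 1/y of the theta product.
  obtain ⟨x, hx2⟩ := IsAlgClosed.exists_pow_nat_eq (b * c) two_pos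
  have hx : x ≠ 0 := by
    rintro rfl
    exact mul_ne_zero hb hc (by rw [← hx2]; simp)
  have key := theta_weierstrass hq0 hq1 hσ (x := x) (a := b / x) (b := d * x / a) (c := a / x) hx
    (div_ne_zero hb hx) (div_ne_zero (mul_ne_zero hd hx) ha) (div_ne_zero ha hx)
  have e' : e = a ^ 2 * q / (b * c * d) := by
    rw [eq_div_iff (by simp [hb, hc, hd]), h]; ring
  rw [show x * (b / x) = b by field_simp, show x / (b / x) = c by field_simp; rw [hx2],
    show d * x / a * (a / x) = d by field_simp,
    show d * x / a / (a / x) = q / e by rw [e']; field_simp; rw [hx2],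
    show x * (a / x) = a by field_simp,
    show x / (a / x) = b * c / a by field_simp; rw [hx2],
    show d * x / a * (b / x) = b * d / a by field_simp,
    show d * x / a / (b / x) = q / (b * e / a) by rw [e']; field_simp; rw [hx2],
    show x * (d * x / a) = q / (e / a) by rw [e']; field_simp; rw [hx2],
    show x / (d * x / a) = 1 / (d / a) by field_simp,
    show b / x * (a / x) = 1 / (c / a) by field_simp; rw [hx2],
    show b / x / (a / x) = b / a by field_simp] at key
  have hda := div_ne_zero hd ha
  have hca := div_ne_zero hc ha
  have hea := div_ne_zero he ha
  have hba := div_ne_zero hb ha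
  have i1 := qTheta_inv hq0 hq1 hda
  have i2 := qTheta_inv hq0 hq1 hca
  have i3 := qTheta_div hq0 hea
  rw [theta_eq_qTheta hq0 hq1 hσ hb, theta_eq_qTheta hq0 hq1 hσ hc, theta_eq_qTheta hq0 hq1 hσ hd,
    theta_eq_qTheta hq0 hq1 hσ (div_ne_zero hq0 he), theta_eq_qTheta hq0 hq1 hσ ha,
    theta_eq_qTheta hq0 hq1 hσ (div_ne_zero (mul_ne_zero hb hc) ha),
    theta_eq_qTheta hq0 hq1 hσ (div_ne_zero (mul_ne_zero hb hd) ha),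
    theta_eq_qTheta hq0 hq1 hσ (div_ne_zero hq0 (div_ne_zero (mul_ne_zero hb he) ha)),
    theta_eq_qTheta hq0 hq1 hσ (div_ne_zero hq0 hea),
    theta_eq_qTheta hq0 hq1 hσ (one_div_ne_zero hda),
    theta_eq_qTheta hq0 hq1 hσ (one_div_ne_zero hca), theta_eq_qTheta hq0 hq1 hσ hba,
    qTheta_div hq0 he, qTheta_div hq0 (div_ne_zero (mul_ne_zero hb he) ha), i3] at key
  have f1 : qTheta q (1 / (d / a)) = - (a / d) * qTheta q (d / a) := by
    rw [← mul_right_inj' hda, i1]; field_simp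
  have f2 : qTheta q (1 / (c / a)) = - (a / c) * qTheta q (c / a) := by
    rw [← mul_right_inj' hca, i2]; field_simp
  rw [f1, f2] at key
  have f3 : q / (b * e / a) * (a / d) * (a / c) = a := by rw [e']; field_simp
  linear_combination key + (qTheta q (b / a) * qTheta q (c / a) * qTheta q (d / a) *
    qTheta q (e / a)) * f3

end theta

/-! ### The regularized ₈ψ₈ and its contiguous relation. -/

/-- The rational factor distinguishing the regularized `₈ψ₈` term from its core. -/
noncomputable def psi8Weight (q a z : ℂ) (n : ℤ) : ℂ :=
  (1 - a * q ^ (2 * n)) / ((1 - z * q ^ n) * (1 - a / z * q ^ n))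

/-- The regularized term of the very-well-poised `₈ψ₈` series with parameters `1/pᵢ, a/z, z`. -/
noncomputable def psi8Term (q a z p₁ p₂ p₃ p₄ : ℂ) (n : ℤ) : ℂ :=
  core q a p₁ p₂ p₃ p₄ n * psi8Weight q a z n

/-- The regularized very-well-poised `₈ψ₈` series. -/
noncomputable def psi8 (q a z p₁ p₂ p₃ p₄ : ℂ) : ℂ := ∑' n : ℤ, psi8Term q a z p₁ p₂ p₃ p₄ n

section psi8

variable {q σ a z : ℂ}

theorem psi8Weight_neg (hq0 : q ≠ 0) (ha : a ≠ 0) (hz : z ≠ 0) (n : ℤ) :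
    psi8Weight q a z (-n) = -psi8Weight q a⁻¹ z⁻¹ n := by
  unfold psi8Weight
  have hy : q ^ n ≠ 0 := zpow_ne_zero _ hq0
  have e1 : q ^ (2 * n) = (q ^ n) ^ 2 := by rw [mul_comm, zpow_mul]; rfl
  have e2 : q ^ (2 * -n) = ((q ^ n) ^ 2)⁻¹ := by rw [mul_neg, zpow_neg, e1]
  rw [e1, e2, zpow_neg]
  generalize q ^ n = y at hy
  have f1 : 1 - a * (y ^ 2)⁻¹ = -(a / y ^ 2) * (1 - a⁻¹ * y ^ 2) := by field_simp; ring
  have f2 : (1 - z * y⁻¹) * (1 - a / z * y⁻¹)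
      = (a / y ^ 2) * ((1 - z⁻¹ * y) * (1 - a⁻¹ / z⁻¹ * y)) := by field_simp; ring
  rw [f1, f2, mul_div_mul_comm, neg_div, div_self (div_ne_zero ha (pow_ne_zero 2 hy))]
  ring

/-- The weight tends to 1, and a convergent sequence is bounded. A vanishing denominator at some n
gives the value 0 and does no harm. -/
theorem psi8Weight_natCast_bounded (hq1 : ‖q‖ < 1) :
    ∃ C : ℝ, ∀ n : ℕ, ‖psi8Weight q a z n‖ ≤ C := by
  have h : Tendsto (fun n : ℕ => psi8Weight q a z n) atTop (𝓝 ((1 - 0) / ((1 - 0) * (1 - 0)))) := by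
    have h2 : Tendsto (fun n : ℕ => a * q ^ (2 * n)) atTop (𝓝 0) := by
      refine (tendsto_mul_pow_zero (q := q ^ 2) ?_ a).congr fun n => by rw [pow_mul]
      rw [norm_pow]; nlinarith [norm_nonneg q]
    have := ((h2.const_sub 1).div (((tendsto_mul_pow_zero hq1 z).const_sub 1).mul
      ((tendsto_mul_pow_zero hq1 (a / z)).const_sub 1)) (by simp))
    refine this.congr fun n => ?_
    unfold psi8Weight
    norm_cast
  obtain ⟨C, hC⟩ := (Metric.isBounded_range_of_tendsto _ h).exists_norm_le
  exact ⟨C, fun n => hC _ ⟨n, rfl⟩⟩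

theorem psi8Weight_bounded (hq0 : q ≠ 0) (hq1 : ‖q‖ < 1) (ha : a ≠ 0) (hz : z ≠ 0) :
    ∃ C : ℝ, 0 ≤ C ∧ ∀ n : ℤ, ‖psi8Weight q a z n‖ ≤ C := by
  obtain ⟨C, hC⟩ := psi8Weight_natCast_bounded (a := a) (z := z) hq1
  obtain ⟨C', hC'⟩ := psi8Weight_natCast_bounded (a := a⁻¹) (z := z⁻¹) hq1
  refine ⟨max C C', ((norm_nonneg _).trans (hC 0)).trans (le_max_left _ _), fun n => ?_⟩
  obtain ⟨m, rfl | rfl⟩ := n.eq_nat_or_neg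
  · exact (hC m).trans (le_max_left _ _)
  · rw [psi8Weight_neg hq0 ha hz, norm_neg]
    exact (hC' m).trans (le_max_right _ _)

theorem norm_psi8Term_le (hq0 : q ≠ 0) (hq1 : ‖q‖ < 1) (hσ : σ ^ 2 = q) (ha : a ≠ 0) (hz : z ≠ 0)
    {r₁ r₂ r₃ r₄ : ℝ} (hr₁ : 0 < r₁) (hr₂ : 0 < r₂) (hr₃ : 0 < r₃) (hr₄ : 0 < r₄) :
    ∃ C : ℝ, 0 ≤ C ∧
      ∀ p₁ p₂ p₃ p₄ : ℂ, ‖p₁‖ ≤ r₁ → ‖p₂‖ ≤ r₂ → ‖p₃‖ ≤ r₃ → ‖p₄‖ ≤ r₄ → ∀ n : ℤ,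
      ‖psi8Term q a z p₁ p₂ p₃ p₄ n‖ ≤
        C * (‖a‖ ^ 2 * ‖q‖ ^ 2 * (r₁ * r₂ * r₃ * r₄)) ^ n.natAbs := by
  obtain ⟨C, hC0, hC⟩ := norm_core_le hq0 hq1 hσ ha hr₁ hr₂ hr₃ hr₄
  obtain ⟨M, hM0, hM⟩ := psi8Weight_bounded hq0 hq1 ha hz
  refine ⟨C * M, by positivity, fun p₁ p₂ p₃ p₄ h₁ h₂ h₃ h₄ n => ?_⟩
  unfold psi8Term
  rw [norm_mul]
  refine (mul_le_mul (hC p₁ p₂ p₃ p₄ h₁ h₂ h₃ h₄ n) (hM n)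
    (norm_nonneg _) (by positivity)).trans (le_of_eq ?_)
  ring

theorem summable_psi8Term (hq0 : q ≠ 0) (hq1 : ‖q‖ < 1) (hσ : σ ^ 2 = q) (ha : a ≠ 0) (hz : z ≠ 0)
    {p₁ p₂ p₃ p₄ : ℂ} (h : ‖a ^ 2 * q ^ 2 * (p₁ * p₂ * p₃ * p₄)‖ < 1) :
    Summable (psi8Term q a z p₁ p₂ p₃ p₄) := by
  simp only [norm_mul, norm_pow] at h
  obtain ⟨r₁, r₂, r₃, r₄, g₁, g₂, g₃, g₄, h₁, h₂, h₃, h₄, hr⟩ := exists_radii (norm_nonneg p₁)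
    (norm_nonneg p₂) (norm_nonneg p₃) (norm_nonneg p₄) h
  obtain ⟨C, hC0, hC⟩ := norm_psi8Term_le hq0 hq1 hσ ha hz g₁ g₂ g₃ g₄
  exact Summable.of_norm_bounded ((summable_pow_natAbs (by positivity) hr).mul_left C)
    (hC p₁ p₂ p₃ p₄ h₁ h₂ h₃ h₄)

/-- The extra factor (1 - a p₄ q^{n+1})(1 - p₄ q^{1-n}) equals its value at the root q^n = 1/z plus
a multiple of (1 - z q^n)(1 - a q^n/z)q^{-n}. The multiple cancels the weight's denominator and
leaves a ₆ψ₆ term. -/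
theorem psi8_shift (hq0 : q ≠ 0) (hq1 : ‖q‖ < 1) (hσ : σ ^ 2 = q) (ha : a ≠ 0) (hz : z ≠ 0)
    (hzq : ∀ n : ℤ, z * q ^ n ≠ 1) (hazq : ∀ n : ℤ, a / z * q ^ n ≠ 1)
    {p₁ p₂ p₃ p₄ : ℂ} (h : ‖a ^ 2 * q ^ 2 * (p₁ * p₂ * p₃ * p₄)‖ < 1) :
    psi8 q a z p₁ p₂ p₃ p₄ = (1 - q * p₄ * z) * (1 - q * a * p₄ / z) *
      psi8 q a z p₁ p₂ p₃ (q * p₄) - q * p₄ * psi6 q a p₁ p₂ p₃ (q * p₄) := by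
  have h6 : ‖a ^ 2 * q * (p₁ * p₂ * p₃ * (q * p₄))‖ < 1 := by
    rwa [show a ^ 2 * q * (p₁ * p₂ * p₃ * (q * p₄)) = a ^ 2 * q ^ 2 * (p₁ * p₂ * p₃ * p₄) by ring]
  have h8 : ‖a ^ 2 * q ^ 2 * (p₁ * p₂ * p₃ * (q * p₄))‖ < 1 := by
    rw [show a ^ 2 * q ^ 2 * (p₁ * p₂ * p₃ * (q * p₄))
      = a ^ 2 * q ^ 2 * (p₁ * p₂ * p₃ * p₄) * q ^ 1 by ring]
    exact (norm_mul_pow_le hq1 le_rfl 1).trans_lt h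
  have s6 := summable_psi6Term hq0 hq1 hσ ha h6
  have s8 := summable_psi8Term hq0 hq1 hσ ha hz h8
  unfold psi8 psi6
  rw [← tsum_mul_left, ← tsum_mul_left, ← (s8.mul_left _).tsum_sub (s6.mul_left _)]
  refine tsum_congr fun n => ?_
  have hcore : core q a p₁ p₂ p₃ p₄ n = core q a p₁ p₂ p₃ (q * p₄) n *
      ((1 - a * p₄ * q ^ (n + 1)) * (1 - p₄ * q ^ (1 - n))) := by
    unfold core
    rw [pairFn_shift hq1 p₄ n]
    ring
  unfold psi8Term psi6Term psi8Weight
  rw [hcore]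
  generalize core q a p₁ p₂ p₃ (q * p₄) n = c
  have hy : q ^ n ≠ 0 := zpow_ne_zero _ hq0
  have e1 : q ^ (n + 1) = q ^ n * q := zpow_add_one₀ hq0 n
  have e2 : q ^ (1 - n) = q / q ^ n := by rw [zpow_sub₀ hq0, zpow_one]
  have e3 : q ^ (-n) = (q ^ n)⁻¹ := zpow_neg _ _
  have e4 : q ^ (2 * n) = (q ^ n) ^ 2 := by rw [mul_comm, zpow_mul]; rfl
  have n1 : 1 - z * q ^ n ≠ 0 := sub_ne_zero.2 (hzq n).symm
  have n2 : 1 - a / z * q ^ n ≠ 0 := sub_ne_zero.2 (hazq n).symm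
  rw [e1, e2, e3, e4]
  generalize q ^ n = y at hy n1 n2
  have key : (1 - a * p₄ * (y * q)) * (1 - p₄ * (q / y)) = (1 - q * p₄ * z) * (1 - q * a * p₄ / z)
      - q * p₄ * ((1 - z * y) * (1 - a / z * y)) * y⁻¹ := by field_simp; ring
  rw [key]
  have hw : ((1 - z * y) * (1 - a / z * y)) * ((1 - a * y ^ 2) / ((1 - z * y) * (1 - a / z * y)))
      = 1 - a * y ^ 2 := mul_div_cancel₀ _ (mul_ne_zero n1 n2)
  have hw2 : y⁻¹ * (1 - a * y ^ 2) = y⁻¹ - a * y := by field_simp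
  linear_combination (-(c * q * p₄ * y⁻¹)) * hw - c * q * p₄ * hw2

/-- The two-parameter shift of the regularized `₈ψ₈` series. -/
theorem psi8_shift_pair (hq0 : q ≠ 0) (hq1 : ‖q‖ < 1) (hσ : σ ^ 2 = q) (ha : a ≠ 0) (hz : z ≠ 0)
    (hzq : ∀ n : ℤ, z * q ^ n ≠ 1) (hazq : ∀ n : ℤ, a / z * q ^ n ≠ 1)
    {p₁ p₂ p₃ p₄ : ℂ} (h : ‖a ^ 2 * q ^ 2 * (p₁ * p₂ * p₃ * p₄)‖ < 1) :
    (1 - p₃ * z) * (1 - a * p₃ / z) * psi8 q a z p₁ p₂ p₃ p₄ -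
      (1 - q * p₄ * z) * (1 - q * a * p₄ / z) * psi8 q a z p₁ p₂ (p₃ / q) (q * p₄) =
      (p₃ - q * p₄) * (1 - q * a * p₃ * p₄) * psi6 q a p₁ p₂ p₃ (q * p₄) := by
  -- Both series of the pair shift to the same one, at (p₃, q p₄). Eliminating it leaves only a ₆ψ₆.
  have h1 := psi8_shift hq0 hq1 hσ ha hz hzq hazq h
  have h2 := psi8_shift (p₁ := p₁) (p₂ := p₂) (p₃ := q * p₄) (p₄ := p₃ / q) hq0 hq1 hσ ha hz hzq
    hazq (by convert h using 2; field_simp)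
  have e8 : ∀ x y, psi8 q a z p₁ p₂ x y = psi8 q a z p₁ p₂ y x := fun x y => by
    unfold psi8 psi8Term core
    exact tsum_congr fun n => by ring
  have e6 : ∀ x y, psi6 q a p₁ p₂ x y = psi6 q a p₁ p₂ y x := fun x y => by
    unfold psi6 psi6Term core
    exact tsum_congr fun n => by ring
  rw [show q * (p₃ / q) = p₃ by field_simp, show q * a * (p₃ / q) / z = a * p₃ / z by field_simp,
    e8 (q * p₄) (p₃ / q), e8 (q * p₄) p₃, e6 (q * p₄) p₃] at h2
  rw [h1, h2]
  field_simp
  ring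

end psi8

/-! ### The regularized ₈W₇ and its telescoping certificate. -/

/-- The factor of the regularized `₈W₇` term attached to the parameter `1 / (p z)`. -/
noncomputable def wPair (q z p : ℂ) (k : ℕ) : ℂ := qFin q (1 / (p * z)) k * qInf q (q * p * q ^ k)

/-- The part of the regularized `₈W₇` term that depends on `a` and `z` only. -/
noncomputable def wBase (q a z : ℂ) (k : ℕ) : ℂ :=
  qFin q (1 / z) k * qFin q (z / a) k * qInf q (q * q ^ k) * qInf q (a * q / z ^ 2 * q ^ k)

/-- The regularized term of the very-well-poised `₈W₇` series with special parameter `1 / z`. -/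
noncomputable def w7Term (q a z p₁ p₂ p₃ p₄ : ℂ) (k : ℕ) : ℂ :=
  q ^ k * (1 - q ^ (2 * k) / z) * wBase q a z k *
    (wPair q z p₁ k * wPair q z p₂ k * wPair q z p₃ k * wPair q z p₄ k)

/-- The regularized very-well-poised `₈W₇` series. -/
noncomputable def w7 (q a z p₁ p₂ p₃ p₄ : ℂ) : ℂ := ∑' k : ℕ, w7Term q a z p₁ p₂ p₃ p₄ k

section w7

variable {q a z : ℂ}

/-- A uniform bound for the factors `wPair`. -/
noncomputable def expConst (q : ℂ) (r : ℝ) : ℝ := Real.exp (r / (1 - ‖q‖))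

theorem expConst_pos (q : ℂ) (r : ℝ) : 0 < expConst q r := Real.exp_pos _

theorem norm_wPair_le (hq1 : ‖q‖ < 1) {p : ℂ} {r s : ℝ} (hr : ‖1 / (p * z)‖ ≤ r)
    (hs : ‖q * p‖ ≤ s) (k : ℕ) : ‖wPair q z p k‖ ≤ expConst q r * expConst q s := by
  unfold wPair
  rw [norm_mul]
  exact mul_le_mul (norm_qFin_le hq1 hr k) (norm_qInf_le hq1 (norm_mul_pow_le hq1 hs k))
    (norm_nonneg _) (expConst_pos _ _).le

theorem norm_wBase_le (hq1 : ‖q‖ < 1) : ∃ C : ℝ, 0 ≤ C ∧ ∀ k : ℕ,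
    ‖(1 - q ^ (2 * k) / z) * wBase q a z k‖ ≤ C := by
  refine ⟨(1 + ‖1 / z‖) * (expConst q ‖1 / z‖ * expConst q ‖z / a‖ * expConst q ‖q‖ *
    expConst q ‖a * q / z ^ 2‖), ?_, fun k => ?_⟩
  · have := expConst_pos q
    have := this ‖1 / z‖; have := expConst_pos q ‖z / a‖; have := expConst_pos q ‖q‖
    have := expConst_pos q ‖a * q / z ^ 2‖
    positivity
  · unfold wBase
    simp only [norm_mul]
    have h0 : ‖1 - q ^ (2 * k) / z‖ ≤ 1 + ‖1 / z‖ := by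
      refine (norm_sub_le _ _).trans ?_
      rw [norm_one, div_eq_mul_one_div, norm_mul, norm_pow]
      have := pow_le_one₀ (norm_nonneg q) hq1.le (n := 2 * k)
      have := mul_le_mul_of_nonneg_right this (norm_nonneg (1 / z))
      linarith
    have h1 := norm_qFin_le hq1 (le_refl ‖1 / z‖) k
    have h2 := norm_qFin_le hq1 (le_refl ‖z / a‖) k
    have h3 := norm_qInf_le hq1 (norm_mul_pow_le hq1 (le_refl ‖q‖) k)
    have h4 := norm_qInf_le hq1 (norm_mul_pow_le hq1 (le_refl ‖a * q / z ^ 2‖) k)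
    unfold expConst
    gcongr

theorem norm_w7Term_le (hq1 : ‖q‖ < 1) (r : ℝ) : ∃ C : ℝ, ∀ p₁ p₂ p₃ p₄ : ℂ,
    ‖1 / (p₁ * z)‖ ≤ r → ‖1 / (p₂ * z)‖ ≤ r → ‖1 / (p₃ * z)‖ ≤ r → ‖1 / (p₄ * z)‖ ≤ r →
    ‖q * p₁‖ ≤ r → ‖q * p₂‖ ≤ r → ‖q * p₃‖ ≤ r → ‖q * p₄‖ ≤ r → ∀ k : ℕ,
    ‖w7Term q a z p₁ p₂ p₃ p₄ k‖ ≤ C * ‖q‖ ^ k := by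
  obtain ⟨C, hC0, hC⟩ := norm_wBase_le (a := a) (z := z) hq1
  refine ⟨C * (expConst q r * expConst q r) ^ 4, ?_⟩
  intro p₁ p₂ p₃ p₄ h₁ h₂ h₃ h₄ g₁ g₂ g₃ g₄ k
  have b₁ := norm_wPair_le hq1 h₁ g₁ k
  have b₂ := norm_wPair_le hq1 h₂ g₂ k
  have b₃ := norm_wPair_le hq1 h₃ g₃ k
  have b₄ := norm_wPair_le hq1 h₄ g₄ k
  have hE := expConst_pos q r
  calc ‖w7Term q a z p₁ p₂ p₃ p₄ k‖ = ‖q‖ ^ k * ‖(1 - q ^ (2 * k) / z) * wBase q a z k‖ *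
        (‖wPair q z p₁ k‖ * ‖wPair q z p₂ k‖ * ‖wPair q z p₃ k‖ * ‖wPair q z p₄ k‖) := by
        unfold w7Term; simp only [norm_mul, norm_pow]; ring
    _ ≤ ‖q‖ ^ k * C * ((expConst q r * expConst q r) * (expConst q r * expConst q r) *
        (expConst q r * expConst q r) * (expConst q r * expConst q r)) := by
        have := hC k
        gcongr
    _ = _ := by ring

theorem summable_w7Term (hq1 : ‖q‖ < 1) (p₁ p₂ p₃ p₄ : ℂ) :
    Summable (w7Term q a z p₁ p₂ p₃ p₄) := by
  obtain ⟨C, hC⟩ := norm_w7Term_le (a := a) (z := z) hq1 (‖1 / (p₁ * z)‖ + ‖1 / (p₂ * z)‖ +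
    ‖1 / (p₃ * z)‖ + ‖1 / (p₄ * z)‖ + ‖q * p₁‖ + ‖q * p₂‖ + ‖q * p₃‖ + ‖q * p₄‖)
  refine Summable.of_norm_bounded
    ((summable_geometric_of_lt_one (norm_nonneg q) hq1).mul_left C)
    (hC p₁ p₂ p₃ p₄ ?_ ?_ ?_ ?_ ?_ ?_ ?_ ?_) <;>
  linarith [norm_nonneg (1 / (p₁ * z)), norm_nonneg (1 / (p₂ * z)), norm_nonneg (1 / (p₃ * z)),
    norm_nonneg (1 / (p₄ * z)), norm_nonneg (q * p₁), norm_nonneg (q * p₂), norm_nonneg (q * p₃),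
    norm_nonneg (q * p₄)]

/-- The telescoping certificate for the two-parameter shift of the `₈W₇` series. -/
noncomputable def w7Cert (q a z p₁ p₂ p₃ p₄ : ℂ) (k : ℕ) : ℂ :=
  (1 - a / z) * (qFin q (1 / z) (k + 1) * qFin q (q * (z / a)) k * qInf q (q * q ^ k) *
    qInf q (a * q / z ^ 2 * q ^ k)) *
    ((qFin q (1 / (p₁ * z)) (k + 1) * qInf q (q * p₁ * q ^ k)) *
    (qFin q (1 / (p₂ * z)) (k + 1) * qInf q (q * p₂ * q ^ k)) *
    (qFin q (q / (p₃ * z)) k * qInf q (q * p₃ * q ^ k)) *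
    (qFin q (1 / (p₄ * z)) k * qInf q (q * (q * p₄) * q ^ k)))

/-- The induction step of `w7_partial_sum` with common factors removed: summand on the left,
increment of the certificate on the right. Here p₄ stands for q p₄, y for q^{K+1}, and a p₁p₂p₃p₄
for 1/z. -/
theorem w7_cert_poly (a p₁ p₂ p₃ p₄ y : ℂ) :
    y * (1 - a * (p₁ * p₂ * p₃ * p₄) * y ^ 2) *
      ((p₃ - a * (p₁ * p₂ * p₃ * p₄)) * (1 - a ^ 2 * (p₁ * p₂ * p₃ * p₄) * p₃) * (1 - a * p₁ * p₄) *
          (1 - a * p₂ * p₄) * (1 - a * p₁ * p₂ * p₃ * y) * (1 - p₄ * y) -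
        (p₄ - a * (p₁ * p₂ * p₃ * p₄)) * (1 - a ^ 2 * (p₁ * p₂ * p₃ * p₄) * p₄) * (1 - a * p₁ * p₃) *
          (1 - a * p₂ * p₃) * (1 - a * p₁ * p₂ * p₄ * y) * (1 - p₃ * y)) =
    (p₃ - p₄) * ((1 - a * (p₁ * p₂ * p₃ * p₄) * y) * (y - a ^ 2 * (p₁ * p₂ * p₃ * p₄)) *
        (1 - a * p₂ * p₃ * p₄ * y) * (1 - a * p₁ * p₃ * p₄ * y) * (1 - a * p₁ * p₂ * p₄ * y) *
        (1 - a * p₁ * p₂ * p₃ * y) +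
      a ^ 2 * (p₁ * p₂ * p₃ * p₄) * (1 - y) * (1 - a ^ 3 * (p₁ * p₂ * p₃ * p₄) ^ 2 * y) *
        (1 - y * p₁) * (1 - y * p₂) * (1 - y * p₃) * (1 - y * p₄)) := by
  ring

/-- The combination of two contiguous terms is the increment of `w7Cert`, so partial sums are closed
forms. The balancing condition is essential, since it makes the parameters 1/(pᵢz) polynomial in a
and the other p's. -/
theorem w7_partial_sum (hq0 : q ≠ 0) (hq1 : ‖q‖ < 1) (ha : a ≠ 0) (hz : z ≠ 0)
    {p₁ p₂ p₃ p₄ : ℂ} (h₁ : p₁ ≠ 0) (h₂ : p₂ ≠ 0) (h₃ : p₃ ≠ 0) (h₄ : p₄ ≠ 0)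
    (h : a * q * z * (p₁ * p₂ * p₃ * p₄) = 1) (K : ℕ) :
    ∑ k ∈ Finset.range (K + 1), (p₃ * (1 - a * p₃ / z) * (1 - a * q * p₁ * p₄) *
        (1 - a * q * p₂ * p₄) * w7Term q a z p₁ p₂ p₃ p₄ k -
      q * p₄ * (1 - q * a * p₄ / z) * (1 - a * p₁ * p₃) * (1 - a * p₂ * p₃) *
        w7Term q a z p₁ p₂ (p₃ / q) (q * p₄) k) =
    (p₃ - q * p₄) * w7Cert q a z p₁ p₂ p₃ p₄ K := by
  have ha' : a = 1 / (q * z * (p₁ * p₂ * p₃ * p₄)) := by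
    rw [eq_div_iff (by simp [hq0, hz, h₁, h₂, h₃, h₄]), ← h]; ring
  have e3 : q * (p₃ / q) = p₃ := by field_simp
  have e3' : 1 / (p₃ / q * z) = q / (p₃ * z) := by field_simp
  have s3 : ∀ k : ℕ, qInf q (p₃ * q ^ k) = (1 - p₃ * q ^ k) * qInf q (q * p₃ * q ^ k) := fun k => by
    rw [qInf_step hq1 (p₃ * q ^ k)]; ring_nf
  have s4 : ∀ k : ℕ, qInf q (q * p₄ * q ^ k)
      = (1 - q * p₄ * q ^ k) * qInf q (q * (q * p₄) * q ^ k) := fun k => by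
    rw [qInf_step hq1 (q * p₄ * q ^ k)]; ring_nf
  have s0 : ∀ (x : ℂ) (k : ℕ), qInf q (x * q ^ k)
      = (1 - x * q ^ k) * qInf q (x * q ^ (k + 1)) := fun x k => by
    rw [qInf_step hq1 (x * q ^ k)]; ring_nf
  induction K with
  | zero =>
    rw [zero_add, Finset.sum_range_one]
    unfold w7Term w7Cert wBase wPair
    rw [e3, e3', s3, s4]
    simp only [qFin_zero, qFin_succ, pow_zero, mul_one, one_mul, mul_zero]
    generalize qInf q q = c₀
    generalize qInf q (a * q / z ^ 2) = c₁
    generalize qInf q (q * p₁) = c₂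
    generalize qInf q (q * p₂) = c₃
    generalize qInf q (q * p₃) = c₄
    generalize qInf q (q * (q * p₄)) = c₅
    -- For K = 0 the balancing condition eliminates a, and a rational identity in q, z, pᵢ remains.
    rw [ha']
    field_simp
    ring
  | succ K ih =>
    rw [Finset.sum_range_succ, ih]
    unfold w7Term w7Cert wBase wPair
    rw [e3, e3', s3, s4]
    rw [qFin_succ' (z / a) K, show z / a * q = q * (z / a) by ring,
      qFin_succ' (1 / (p₃ * z)) K, show 1 / (p₃ * z) * q = q / (p₃ * z) by ring,
      qFin_succ' (1 / (q * p₄ * z)) K, show 1 / (q * p₄ * z) * q = 1 / (p₄ * z) by field_simp,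
      qFin_succ (1 / z) (K + 1), qFin_succ (q * (z / a)) K, qFin_succ (1 / (p₁ * z)) (K + 1),
      qFin_succ (1 / (p₂ * z)) (K + 1), qFin_succ (q / (p₃ * z)) K, qFin_succ (1 / (p₄ * z)) K,
      s0 q K, s0 (a * q / z ^ 2) K, s0 (q * p₁) K, s0 (q * p₂) K, s0 (q * p₃) K,
      s0 (q * (q * p₄)) K]
    simp only [pow_succ q K, pow_mul' q 2 (K + 1)]
    generalize qInf q (q * (q ^ K * q)) = c₀
    generalize qInf q (a * q / z ^ 2 * (q ^ K * q)) = c₁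
    generalize qInf q (q * p₁ * (q ^ K * q)) = c₂
    generalize qInf q (q * p₂ * (q ^ K * q)) = c₃
    generalize qInf q (q * p₃ * (q ^ K * q)) = c₄
    generalize qInf q (q * (q * p₄) * (q ^ K * q)) = c₅
    generalize qFin q (1 / z) (K + 1) = d₀
    generalize qFin q (q * (z / a)) K = d₁
    generalize qFin q (1 / (p₁ * z)) (K + 1) = d₂
    generalize qFin q (1 / (p₂ * z)) (K + 1) = d₃
    generalize qFin q (q / (p₃ * z)) K = d₄
    generalize qFin q (1 / (p₄ * z)) K = d₅
    generalize q ^ K = y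
    have ez : 1 / z = a * (p₁ * p₂ * p₃ * (q * p₄)) := by rw [div_eq_iff hz, ← h]; ring
    have e₁ : 1 / (p₁ * z) = a * p₂ * p₃ * (q * p₄) := by
      rw [div_eq_iff (mul_ne_zero h₁ hz), ← h]; ring
    have e₂ : 1 / (p₂ * z) = a * p₁ * p₃ * (q * p₄) := by
      rw [div_eq_iff (mul_ne_zero h₂ hz), ← h]; ring
    have e₃ : 1 / (p₃ * z) = a * p₁ * p₂ * (q * p₄) := by
      rw [div_eq_iff (mul_ne_zero h₃ hz), ← h]; ring
    have e₄ : 1 / (q * p₄ * z) = a * p₁ * p₂ * p₃ := by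
      rw [div_eq_iff (by simp [hq0, h₄, hz]), ← h]; ring
    have e₄' : 1 / (p₄ * z) = q * (a * p₁ * p₂ * p₃) := by rw [← e₄]; field_simp
    have e₃' : q / (p₃ * z) = q * (a * p₁ * p₂ * (q * p₄)) := by rw [← e₃]; ring
    have es : a / z = a ^ 2 * (p₁ * p₂ * p₃ * (q * p₄)) := by
      rw [div_eq_mul_one_div, ez]; ring
    have et : (z / a) * (a ^ 2 * (p₁ * p₂ * p₃ * (q * p₄))) = 1 := by rw [← es]; field_simp
    have key := w7_cert_poly a p₁ p₂ p₃ (q * p₄) (y * q)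
    have f1 : a * p₃ / z = a / z * p₃ := by ring
    have f2 : q * a * p₄ / z = a / z * (q * p₄) := by ring
    have f3 : a * q / z ^ 2 = q * (a / z * (1 / z)) := by field_simp
    have f4 : (y * q) ^ 2 / z = 1 / z * (y * q) ^ 2 := by ring
    rw [f1, f2, f3, f4, e₁, e₂, e₃, e₃', e₄, e₄', es, ez]
    -- The ratio z/a survives only through d₁ and the factors 1 - z/a, 1 - t y q. It is treated as
    -- an independent variable t tied to the rest by `et`.
    generalize z / a = t at et ⊢
    linear_combination (d₀ * d₁ * d₂ * d₃ * d₄ * d₅ * c₀ * c₁ * c₂ * c₃ * c₄ * c₅) * ((1 - t) * key +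
      (p₃ - q * p₄) * ((1 - y * q) * ((1 - a * (p₁ * p₂ * p₃ * (q * p₄)) * (y * q)) *
        (1 - a * p₂ * p₃ * (q * p₄) * (y * q)) * (1 - a * p₁ * p₃ * (q * p₄) * (y * q)) *
        (1 - a * p₁ * p₂ * (q * p₄) * (y * q)) * (1 - a * p₁ * p₂ * p₃ * (y * q))) -
        (1 - y * q) * (1 - a ^ 3 * (p₁ * p₂ * p₃ * (q * p₄)) ^ 2 * (y * q)) * (1 - y * q * p₁) *
        (1 - y * q * p₂) * (1 - y * q * p₃) * (1 - y * q * (q * p₄))) * et)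

/-- The two-parameter shift of the regularized `₈W₇` series. -/
theorem w7_shift_pair (hq0 : q ≠ 0) (hq1 : ‖q‖ < 1) (ha : a ≠ 0) (hz : z ≠ 0)
    {p₁ p₂ p₃ p₄ : ℂ} (h₁ : p₁ ≠ 0) (h₂ : p₂ ≠ 0) (h₃ : p₃ ≠ 0) (h₄ : p₄ ≠ 0)
    (h : a * q * z * (p₁ * p₂ * p₃ * p₄) = 1) :
    p₃ * (1 - a * p₃ / z) * (1 - a * q * p₁ * p₄) * (1 - a * q * p₂ * p₄) * w7 q a z p₁ p₂ p₃ p₄ -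
      q * p₄ * (1 - q * a * p₄ / z) * (1 - a * p₁ * p₃) * (1 - a * p₂ * p₃) *
        w7 q a z p₁ p₂ (p₃ / q) (q * p₄) =
    (p₃ - q * p₄) * ((1 - a / z) * (qInf q (1 / z) * qInf q (q * (z / a))) *
      (qInf q (1 / (p₁ * z)) * qInf q (1 / (p₂ * z)) * qInf q (q / (p₃ * z)) *
        qInf q (1 / (p₄ * z)))) := by
  have s1 := (summable_w7Term (a := a) (z := z) hq1 p₁ p₂ p₃ p₄).hasSum.mul_left
    (p₃ * (1 - a * p₃ / z) * (1 - a * q * p₁ * p₄) * (1 - a * q * p₂ * p₄))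
  have s2 := (summable_w7Term (a := a) (z := z) hq1 p₁ p₂ (p₃ / q) (q * p₄)).hasSum.mul_left
    (q * p₄ * (1 - q * a * p₄ / z) * (1 - a * p₁ * p₃) * (1 - a * p₂ * p₃))
  -- The partial sums have K + 1 terms, hence the shift by one. In the certificate every (x q^K;
  -- q)_∞ tends to 1, so only the limits of the finite products survive.
  have hlim := ((s1.sub s2).tendsto_sum_nat).comp (tendsto_add_atTop_nat 1)
  refine tendsto_nhds_unique hlim ?_
  simp only [Function.comp_def, w7_partial_sum hq0 hq1 ha hz h₁ h₂ h₃ h₄ h]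
  refine Tendsto.const_mul _ ?_
  have hF := fun x => tendsto_qFin hq1 x
  have hF1 := fun x => (tendsto_qFin hq1 x).comp (tendsto_add_atTop_nat 1)
  have hP := fun x => tendsto_qInf_mul_pow hq1 x
  have := (((((hF1 (1 / z)).mul (hF (q * (z / a)))).mul (hP q)).mul (hP (a * q / z ^ 2))).const_mul
    (1 - a / z)).mul (((((hF1 (1 / (p₁ * z))).mul (hP (q * p₁))).mul
      ((hF1 (1 / (p₂ * z))).mul (hP (q * p₂)))).mul
      ((hF (q / (p₃ * z))).mul (hP (q * p₃)))).mul ((hF (1 / (p₄ * z))).mul (hP (q * (q * p₄)))))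
  simp only [mul_one] at this
  exact this

end w7

/-! ### Homogeneous recurrence for the difference of the two sides. -/

/-- The product of `(a q pᵢ pⱼ; q)_∞` over all pairs. -/
noncomputable def pairProd (q a p₁ p₂ p₃ p₄ : ℂ) : ℂ :=
  qInf q (a * q * p₁ * p₂) * qInf q (a * q * p₁ * p₃) * qInf q (a * q * p₁ * p₄) *
    qInf q (a * q * p₂ * p₃) * qInf q (a * q * p₂ * p₄) * qInf q (a * q * p₃ * p₄)

/-- The regularized left-hand side of the transformation. -/
noncomputable def regPsi (q a z p₁ p₂ p₃ p₄ : ℂ) : ℂ :=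
  qInf q (1 / (p₁ * z)) * qInf q (1 / (p₂ * z)) * qInf q (1 / (p₃ * z)) * qInf q (1 / (p₄ * z)) *
    psi8 q a z p₁ p₂ p₃ p₄

/-- The regularized `₈W₇` contribution. -/
noncomputable def regW (q a z p₁ p₂ p₃ p₄ : ℂ) : ℂ :=
  pairProd q a p₁ p₂ p₃ p₄ * w7 q a z p₁ p₂ p₃ p₄

/-- The regularized product contribution. -/
noncomputable def regProd (q a z p₁ p₂ p₃ p₄ : ℂ) : ℂ :=
  (qTheta q (1 / p₁) * qInf q (a * q * p₁ / z)) * (qTheta q (1 / p₂) * qInf q (a * q * p₂ / z)) *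
    (qTheta q (1 / p₃) * qInf q (a * q * p₃ / z)) * (qTheta q (1 / p₄) * qInf q (a * q * p₄ / z))

/-- The coefficient of the `₈W₇` contribution. -/
noncomputable def coeffW (q a z : ℂ) : ℂ :=
  -(qInf q q * qTheta q a / (z * qInf q (1 / z) * qTheta q (a / z)))

/-- The coefficient of the product contribution. -/
noncomputable def coeffProd (q a z : ℂ) : ℂ :=
  qInf q q ^ 2 * qTheta q a / (z * qTheta q z * qTheta q (a / z))

/-- The difference of the two sides of the regularized transformation. -/
noncomputable def regDiff (q a z p₁ p₂ p₃ p₄ : ℂ) : ℂ :=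
  regPsi q a z p₁ p₂ p₃ p₄ - coeffW q a z * regW q a z p₁ p₂ p₃ p₄ -
    coeffProd q a z * regProd q a z p₁ p₂ p₃ p₄

section shift

variable {q σ a z : ℂ}

theorem qInf_one_div_ne_zero (hq0 : q ≠ 0) (hq1 : ‖q‖ < 1) (hz : z ≠ 0)
    (hzq : ∀ n : ℤ, z * q ^ n ≠ 1) : qInf q (1 / z) ≠ 0 := by
  rw [qInf_ne_zero_iff hq1]
  intro n hn
  refine hzq (-n) ?_
  rw [zpow_neg, zpow_natCast]
  have hqn : q ^ n ≠ 0 := pow_ne_zero _ hq0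
  field_simp at hn ⊢
  exact hn.symm

theorem qTheta_ne_zero (hq0 : q ≠ 0) (hq1 : ‖q‖ < 1) (hz : z ≠ 0)
    (hzq : ∀ n : ℤ, z * q ^ n ≠ 1) : qTheta q z ≠ 0 := by
  unfold qTheta
  refine mul_ne_zero ((qInf_ne_zero_iff hq1 _).2 fun n => by simpa using hzq n) ?_
  have h := qInf_one_div_ne_zero hq0 hq1 hz hzq
  rw [qInf_step hq1, one_div_mul_eq_div] at h
  exact right_ne_zero_of_mul h

/-- The prefactors (1/(pᵢz); q)_∞ absorb the coefficients 1 - p₃z and 1 - q p₄z of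
`psi8_shift_pair`, bringing all three contributions to the same pair of coefficients. -/
theorem regPsi_shift (hq0 : q ≠ 0) (hq1 : ‖q‖ < 1) (hσ : σ ^ 2 = q) (ha : a ≠ 0) (hz : z ≠ 0)
    (hzq : ∀ n : ℤ, z * q ^ n ≠ 1) (hazq : ∀ n : ℤ, a / z * q ^ n ≠ 1) (hlt : ‖a * q / z‖ < 1)
    {p₁ p₂ p₃ p₄ : ℂ} (h₃ : p₃ ≠ 0) (h₄ : p₄ ≠ 0) (h : a * q * z * (p₁ * p₂ * p₃ * p₄) = 1) :
    p₃ * (1 - a * p₃ / z) * regPsi q a z p₁ p₂ p₃ p₄ -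
      q * p₄ * (1 - q * a * p₄ / z) * regPsi q a z p₁ p₂ (p₃ / q) (q * p₄) =
    -(1 / z) * (p₃ - q * p₄) * (qInf q (1 / (p₁ * z)) * qInf q (1 / (p₂ * z)) *
      qInf q (q / (p₃ * z)) * qInf q (1 / (p₄ * z))) * ((1 - q * a * p₃ * p₄) *
      psi6 q a p₁ p₂ p₃ (q * p₄)) := by
  have hE : a ^ 2 * q ^ 2 * (p₁ * p₂ * p₃ * p₄) = a * q / z := by
    rw [eq_div_iff hz]; linear_combination a * q * h
  have key := psi8_shift_pair (p₁ := p₁) (p₂ := p₂) (p₃ := p₃) (p₄ := p₄) hq0 hq1 hσ ha hz hzq hazq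
    (by rw [hE]; exact hlt)
  unfold regPsi
  have s3 : qInf q (1 / (p₃ * z)) = (1 - 1 / (p₃ * z)) * qInf q (q / (p₃ * z)) := by
    rw [qInf_step hq1, one_div_mul_eq_div]
  have s4 : qInf q (1 / (q * p₄ * z)) = (1 - 1 / (q * p₄ * z)) * qInf q (1 / (p₄ * z)) := by
    rw [qInf_step hq1, show 1 / (q * p₄ * z) * q = 1 / (p₄ * z) by field_simp]
  rw [s3, s4, show 1 / (p₃ / q * z) = q / (p₃ * z) by field_simp]
  have f3 : p₃ * (1 - 1 / (p₃ * z)) = -(1 / z) * (1 - p₃ * z) := by field_simp; ring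
  have f4 : q * p₄ * (1 - 1 / (q * p₄ * z)) = -(1 / z) * (1 - q * p₄ * z) := by field_simp; ring
  linear_combination (qInf q (1 / (p₁ * z)) * qInf q (1 / (p₂ * z)) *
      qInf q (q / (p₃ * z)) * qInf q (1 / (p₄ * z))) * ((1 - a * p₃ / z) * psi8 q a z p₁ p₂ p₃ p₄ *
      f3 - (1 - q * a * p₄ / z) * psi8 q a z p₁ p₂ (p₃ / q) (q * p₄) * f4 - (1 / z) * key)

theorem regW_shift (hq0 : q ≠ 0) (hq1 : ‖q‖ < 1) (ha : a ≠ 0) (hz : z ≠ 0)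
    {p₁ p₂ p₃ p₄ : ℂ} (h₁ : p₁ ≠ 0) (h₂ : p₂ ≠ 0) (h₃ : p₃ ≠ 0) (h₄ : p₄ ≠ 0)
    (h : a * q * z * (p₁ * p₂ * p₃ * p₄) = 1) :
    p₃ * (1 - a * p₃ / z) * regW q a z p₁ p₂ p₃ p₄ -
      q * p₄ * (1 - q * a * p₄ / z) * regW q a z p₁ p₂ (p₃ / q) (q * p₄) =
    (p₃ - q * p₄) * ((1 - a / z) * (qInf q (1 / z) * qInf q (q * (z / a))) *
      (qInf q (1 / (p₁ * z)) * qInf q (1 / (p₂ * z)) * qInf q (q / (p₃ * z)) *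
        qInf q (1 / (p₄ * z)))) *
      ((1 - q * a * p₃ * p₄) * pairProd q a p₁ p₂ p₃ (q * p₄)) := by
  have key := w7_shift_pair hq0 hq1 ha hz h₁ h₂ h₃ h₄ h
  unfold regW pairProd
  have s : ∀ x : ℂ, qInf q (a * q * x * p₄) = (1 - a * q * x * p₄) *
      qInf q (a * q * x * (q * p₄)) := fun x => by
    rw [qInf_step hq1]; ring_nf
  have s' : ∀ x : ℂ, qInf q (a * q * x * (p₃ / q)) = (1 - a * x * p₃) *
      qInf q (a * q * x * p₃) := fun x => by
    rw [qInf_step hq1, show a * q * x * (p₃ / q) = a * x * p₃ by field_simp]; ring_nf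
  rw [s p₁, s p₂, s' p₁, s' p₂, show a * q * (p₃ / q) * (q * p₄) = a * q * p₃ * p₄ by field_simp,
    s p₃]
  linear_combination (qInf q (a * q * p₁ * p₂) * qInf q (a * q * p₁ * p₃) *
    qInf q (a * q * p₁ * (q * p₄)) * qInf q (a * q * p₂ * p₃) * qInf q (a * q * p₂ * (q * p₄)) *
    ((1 - q * a * p₃ * p₄) * qInf q (a * q * p₃ * (q * p₄)))) * key

theorem regProd_shift (hq0 : q ≠ 0) (hq1 : ‖q‖ < 1) {p₁ p₂ p₃ p₄ : ℂ} (h₃ : p₃ ≠ 0) (h₄ : p₄ ≠ 0) :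
    p₃ * (1 - a * p₃ / z) * regProd q a z p₁ p₂ p₃ p₄ =
      q * p₄ * (1 - q * a * p₄ / z) * regProd q a z p₁ p₂ (p₃ / q) (q * p₄) := by
  unfold regProd
  have t3 := qTheta_mul hq0 hq1 (x := 1 / p₃) (by simpa using h₃)
  have t4 := qTheta_mul hq0 hq1 (x := 1 / (q * p₄)) (by simp [hq0, h₄])
  rw [show 1 / (q * p₄) * q = 1 / p₄ by field_simp] at t4
  have f3 : qTheta q (1 / (p₃ / q)) = -(p₃ * qTheta q (1 / p₃)) := by
    rw [show 1 / (p₃ / q) = 1 / p₃ * q by field_simp, ← mul_neg, ← t3]; field_simp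
  have f4 : qTheta q (1 / p₄) = -(q * p₄ * qTheta q (1 / (q * p₄))) := by
    rw [← mul_neg, ← t4]; field_simp
  have g3 : qInf q (a * q * (p₃ / q) / z) = (1 - a * p₃ / z) * qInf q (a * q * p₃ / z) := by
    rw [qInf_step hq1, show a * q * (p₃ / q) / z = a * p₃ / z by field_simp]
    ring_nf
  have g4 : qInf q (a * q * p₄ / z) = (1 - q * a * p₄ / z) * qInf q (a * q * (q * p₄) / z) := by
    rw [qInf_step hq1]; ring_nf
  rw [f3, f4, g3, g4]
  ring

/-- The inhomogeneous term for the ₈ψ₈ is a ₆ψ₆ with convergence ratio aq/z, evaluated by `psi6_eq`.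
`coeffW` is the constant for which it cancels the boundary term of the ₈W₇. -/
theorem regDiff_shift (hq0 : q ≠ 0) (hq1 : ‖q‖ < 1) (hσ : σ ^ 2 = q) (ha : a ≠ 0) (hz : z ≠ 0)
    (hzq : ∀ n : ℤ, z * q ^ n ≠ 1) (hazq : ∀ n : ℤ, a / z * q ^ n ≠ 1) (hlt : ‖a * q / z‖ < 1)
    {p₁ p₂ p₃ p₄ : ℂ} (h₁ : p₁ ≠ 0) (h₂ : p₂ ≠ 0) (h₃ : p₃ ≠ 0) (h₄ : p₄ ≠ 0)
    (h : a * q * z * (p₁ * p₂ * p₃ * p₄) = 1) :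
    p₃ * (1 - a * p₃ / z) * regDiff q a z p₁ p₂ p₃ p₄ =
      q * p₄ * (1 - q * a * p₄ / z) * regDiff q a z p₁ p₂ (p₃ / q) (q * p₄) := by
  have e1 := regPsi_shift hq0 hq1 hσ ha hz hzq hazq hlt h₃ h₄ h
  have e2 := regW_shift hq0 hq1 ha hz h₁ h₂ h₃ h₄ h
  have e3 := regProd_shift (a := a) (z := z) (p₁ := p₁) (p₂ := p₂) hq0 hq1 h₃ h₄
  have hE : a ^ 2 * q * (p₁ * p₂ * p₃ * (q * p₄)) = a * q / z := by
    rw [eq_div_iff hz]; linear_combination a * q * h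
  have e6 := psi6_eq (p₁ := p₁) (p₂ := p₂) (p₃ := p₃) (p₄ := q * p₄) hq0 hq1 hσ ha
    (by rw [hE]; exact hlt)
  rw [hE, ← pairProd] at e6
  have n1 := qInf_one_div_ne_zero hq0 hq1 hz hzq
  have n2 := qTheta_ne_zero hq0 hq1 (div_ne_zero ha hz) hazq
  have n3 := qInf_ne_zero_of_norm_lt hq1 hlt
  have hth : qTheta q (a / z) = (1 - a / z) * qInf q (a * q / z) * qInf q (q * (z / a)) := by
    unfold qTheta
    rw [qInf_step hq1, show a / z * q = a * q / z by ring, show q / (a / z) = q * (z / a) by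
      field_simp]
  have hc : coeffW q a z * ((1 - a / z) * (qInf q (1 / z) * qInf q (q * (z / a)))) *
      qInf q (a * q / z) = -(1 / z) * (qInf q q * qTheta q a) := by
    unfold coeffW
    rw [show -(qInf q q * qTheta q a / (z * qInf q (1 / z) * qTheta q (a / z))) *
        ((1 - a / z) * (qInf q (1 / z) * qInf q (q * (z / a)))) * qInf q (a * q / z) =
        -(qInf q q * qTheta q a / (z * qInf q (1 / z) * qTheta q (a / z))) * (qInf q (1 / z) *
          ((1 - a / z) * qInf q (a * q / z) * qInf q (q * (z / a)))) by ring, ← hth]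
    field_simp
  have main : -(1 / z) * psi6 q a p₁ p₂ p₃ (q * p₄) = coeffW q a z *
      ((1 - a / z) * (qInf q (1 / z) * qInf q (q * (z / a)))) * pairProd q a p₁ p₂ p₃ (q * p₄) := by
    refine mul_left_cancel₀ n3 ?_
    linear_combination -(1 / z) * e6 - pairProd q a p₁ p₂ p₃ (q * p₄) * hc
  unfold regDiff
  linear_combination e1 - coeffW q a z * e2 - coeffProd q a z * e3 + (p₃ - q * p₄) *
    (qInf q (1 / (p₁ * z)) * qInf q (1 / (p₂ * z)) * qInf q (q / (p₃ * z)) *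
        qInf q (1 / (p₄ * z))) * (1 - q * a * p₃ * p₄) * main

/-- The normalization of the iterated shift. -/
noncomputable def shiftNorm (σ q a z p₃ p₄ : ℂ) (N : ℕ) : ℂ :=
  σ ^ (3 * (N * (N + 1))) / (-(a * q ^ 2 * p₃ ^ 2 / (p₄ * z))) ^ N

/-- The coefficient 1 - a p₃/(z q^N) is rewritten as a monomial times 1 - (z/(a p₃))q^N, so that the
coefficients accumulate into convergent finite products. All monomials are collected in `shiftNorm`,
which compensates the growth of `regDiff`. -/
theorem regDiff_iterate (hq0 : q ≠ 0) (hq1 : ‖q‖ < 1) (hσ : σ ^ 2 = q) (ha : a ≠ 0) (hz : z ≠ 0)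
    (hzq : ∀ n : ℤ, z * q ^ n ≠ 1) (hazq : ∀ n : ℤ, a / z * q ^ n ≠ 1) (hlt : ‖a * q / z‖ < 1)
    {p₁ p₂ p₃ p₄ : ℂ} (h₁ : p₁ ≠ 0) (h₂ : p₂ ≠ 0) (h₃ : p₃ ≠ 0) (h₄ : p₄ ≠ 0)
    (h : a * q * z * (p₁ * p₂ * p₃ * p₄) = 1) (N : ℕ) :
    qFin q (z / (a * p₃)) N * regDiff q a z p₁ p₂ p₃ p₄ = qFin q (a * q * p₄ / z) N *
      (regDiff q a z p₁ p₂ (p₃ / q ^ N) (p₄ * q ^ N) * shiftNorm σ q a z p₃ p₄ N) := by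
  induction N with
  | zero => simp [qFin, shiftNorm]
  | succ N ih =>
    have hqN : q ^ N ≠ 0 := pow_ne_zero _ hq0
    have hs := regDiff_shift (p₃ := p₃ / q ^ N) (p₄ := p₄ * q ^ N) hq0 hq1 hσ ha hz hzq hazq hlt h₁
      h₂ (div_ne_zero h₃ hqN) (mul_ne_zero h₄ hqN) (by rw [← h]; field_simp)
    rw [show p₃ / q ^ N / q = p₃ / q ^ (N + 1) by rw [pow_succ]; field_simp,
      show q * (p₄ * q ^ N) = p₄ * q ^ (N + 1) by ring] at hs
    have hσ0 : σ ≠ 0 := by rintro rfl; exact hq0 (by rw [← hσ]; simp)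
    have hn : shiftNorm σ q a z p₃ p₄ (N + 1) = shiftNorm σ q a z p₃ p₄ N *
        (-(q ^ (3 * N) * q * p₄ * z / (a * p₃ ^ 2))) := by
      unfold shiftNorm
      rw [show 3 * ((N + 1) * (N + 1 + 1)) = 3 * (N * (N + 1)) + 2 * (3 * N + 3) by ring, pow_add,
        pow_mul σ 2, hσ, pow_succ (-(a * q ^ 2 * p₃ ^ 2 / (p₄ * z))) N, mul_div_mul_comm]
      congr 1
      rw [pow_add]
      field_simp
    rw [qFin_succ, qFin_succ, hn]
    have f1 : 1 - z / (a * p₃) * q ^ N = -(z * q ^ N / (a * p₃)) * (1 - a * (p₃ / q ^ N) / z) := by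
      field_simp; ring
    have f2 : (1 - q * a * (p₄ * q ^ N) / z) = 1 - a * q * p₄ / z * q ^ N := by ring
    rw [f2] at hs
    have hs' : -(z * q ^ N / (a * p₃)) * (1 - a * (p₃ / q ^ N) / z) *
        regDiff q a z p₁ p₂ (p₃ / q ^ N) (p₄ * q ^ N) = (1 - a * q * p₄ / z * q ^ N) *
        regDiff q a z p₁ p₂ (p₃ / q ^ (N + 1)) (p₄ * q ^ (N + 1)) *
        (-(q ^ (3 * N) * q * p₄ * z / (a * p₃ ^ 2))) := by
      have e : -(z * q ^ N / (a * p₃)) = p₃ / q ^ N * (-(z * q ^ (2 * N) / (a * p₃ ^ 2))) := by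
        rw [two_mul, pow_add]; field_simp
      rw [e]
      have e2 : q ^ (3 * N) = q ^ N * q ^ (2 * N) := by rw [← pow_add]; ring_nf
      rw [e2]
      linear_combination (-(z * q ^ (2 * N) / (a * p₃ ^ 2))) * hs
    rw [f1]
    linear_combination (-(z * q ^ N / (a * p₃)) * (1 - a * (p₃ / q ^ N) / z)) * ih +
      qFin q (a * q * p₄ / z) N * shiftNorm σ q a z p₃ p₄ N * hs'

end shift

/-! ### Limit of the shifted ₈ψ₈. -/

/-- The bilateral series to which the `₈ψ₈` series degenerates. -/
noncomputable def psi8Two (q a z p₁ p₂ : ℂ) : ℂ :=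
  ∑' n : ℤ, a ^ n * q ^ (n ^ 2) * (pairFn q a p₁ n * pairFn q a p₂ n) * psi8Weight q a z n

section psi8Limit

variable {q σ a z : ℂ}

/-- The majorant for dominated convergence, uniform in N. The shifted factors change behaviour at n
= N: the terms decay with ratio a q p₁p₂ up to N and with ratio a²q²p₁p₂p₃p₄ beyond, so ρ must
dominate both. -/
theorem norm_core_shift_natCast_le (hq0 : q ≠ 0) (hq1 : ‖q‖ < 1) (hσ : σ ^ 2 = q) (ha : a ≠ 0)
    {p₁ p₂ p₃ p₄ : ℂ} (h₁ : p₁ ≠ 0) (h₂ : p₂ ≠ 0) (h₃ : p₃ ≠ 0) (h₄ : p₄ ≠ 0) {ρ : ℝ}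
    (hρ : ‖a * q * (p₁ * p₂)‖ ≤ ρ) (hρ' : ‖a ^ 2 * q ^ 2 * (p₁ * p₂ * p₃ * p₄)‖ ≤ ρ) :
    ∃ C : ℝ, 0 ≤ C ∧ ∀ N n : ℕ, ‖core q a p₁ p₂ (p₃ / q ^ N) (p₄ * q ^ N) n‖ *
      ‖σ‖ ^ (2 * (N * (N + 1))) ≤ C * ρ ^ n * (‖a‖ * (‖p₃‖ * ‖q‖) ^ 2) ^ N := by
  have hs : ‖σ‖ ^ 2 = ‖q‖ := by rw [← norm_pow, hσ]
  have hq : 0 < ‖q‖ := norm_pos_iff.2 hq0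
  have hs0 : 0 < ‖σ‖ := by
    refine norm_pos_iff.2 fun h => hq0 ?_
    rw [← hσ, h]; simp
  have han : 0 < ‖a‖ := norm_pos_iff.2 ha
  have n₁ : 0 < ‖p₁‖ := norm_pos_iff.2 h₁
  have n₂ : 0 < ‖p₂‖ := norm_pos_iff.2 h₂
  have n₃ : 0 < ‖p₃‖ := norm_pos_iff.2 h₃
  have n₄ : 0 < ‖p₄‖ := norm_pos_iff.2 h₄
  have hρ0 : 0 ≤ ρ := (norm_nonneg _).trans hρ
  simp only [norm_mul, norm_pow] at hρ hρ'
  let G : ℝ → ℝ := growthConst q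
  have hG : ∀ r, 0 < G r := growthConst_pos q
  let K : ℝ → ℝ := fun r => G (‖a‖ * r * ‖q‖) * G (r * ‖q‖)
  have hK : ∀ r, 0 < K r := fun r => mul_pos (hG _) (hG _)
  refine ⟨K ‖p₁‖ * K ‖p₂‖ * (G (‖a‖ * ‖p₃‖ * ‖q‖) * G (‖p₃‖ * ‖q‖)) *
    (G (‖a‖ * ‖p₄‖ * ‖q‖) * G (‖p₄‖ * ‖q‖)), ?_, fun N n => ?_⟩
  · have := hK ‖p₁‖; have := hK ‖p₂‖
    have := hG (‖a‖ * ‖p₃‖ * ‖q‖); have := hG (‖p₃‖ * ‖q‖)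
    have := hG (‖a‖ * ‖p₄‖ * ‖q‖); have := hG (‖p₄‖ * ‖q‖)
    positivity
  have b₁ := norm_pairFn_le hq0 hq1 hσ ha n₁ le_rfl n
  have b₂ := norm_pairFn_le hq0 hq1 hσ ha n₂ le_rfl n
  have c₁ := norm_qInf_div_pow_le hq0 hq1 hσ (x := p₃ * q) (r := ‖p₃‖ * ‖q‖) (by positivity)
    (by rw [norm_mul]) (N + n)
  have c₂ := norm_qInf_le_growthConst hq1 (x := a * p₄ * q) (r := ‖a‖ * ‖p₄‖ * ‖q‖) (by positivity)
    (by rw [norm_mul, norm_mul]) (N + n)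
  have e : ‖core q a p₁ p₂ (p₃ / q ^ N) (p₄ * q ^ N) n‖ = ‖a‖ ^ (2 * n) * ‖σ‖ ^ (4 * n ^ 2) *
      (‖pairFn q a p₁ n‖ * ‖pairFn q a p₂ n‖ *
      (‖qInf q (a * (p₃ / q ^ N) * q ^ ((n : ℤ) + 1))‖ * ‖qInf q (p₃ * q / q ^ (N + n))‖) *
      (‖qInf q (a * p₄ * q * q ^ (N + n))‖ * ‖qInf q (p₄ * q ^ N * q ^ (1 - (n : ℤ)))‖)) := by
    unfold core
    rw [show pairFn q a (p₃ / q ^ N) n = qInf q (a * (p₃ / q ^ N) * q ^ ((n : ℤ) + 1)) *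
        qInf q (p₃ * q / q ^ (N + n)) by
      unfold pairFn
      rw [zpow_sub₀ hq0, zpow_one, zpow_natCast, pow_add]; congr 2; field_simp]
    rw [show pairFn q a (p₄ * q ^ N) n = qInf q (a * p₄ * q * q ^ (N + n)) *
        qInf q (p₄ * q ^ N * q ^ (1 - (n : ℤ))) by
      unfold pairFn
      rw [zpow_add_one₀ hq0, zpow_natCast, pow_add]; congr 2; ring]
    simp only [norm_mul, norm_zpow]
    congr 2
    rw [← hs]
    norm_cast
    rw [← pow_mul]; congr 1; ring
  rw [e]
  rcases le_total n N with hnN | hnN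
  · obtain ⟨m, rfl⟩ := Nat.exists_eq_add_of_le hnN
    have c₃ := norm_qInf_div_pow_le hq0 hq1 hσ (x := a * p₃ * q) (r := ‖a‖ * ‖p₃‖ * ‖q‖)
      (by positivity) (by rw [norm_mul, norm_mul]) m
    have c₄ := norm_qInf_le_growthConst hq1 (x := p₄ * q) (r := ‖p₄‖ * ‖q‖) (by positivity)
      (by rw [norm_mul]) m
    rw [show a * (p₃ / q ^ (n + m)) * q ^ ((n : ℤ) + 1) = a * p₃ * q / q ^ m by
        rw [zpow_add_one₀ hq0, zpow_natCast, pow_add]; field_simp,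
      show p₄ * q ^ (n + m) * q ^ (1 - (n : ℤ)) = p₄ * q * q ^ m by
        rw [zpow_sub₀ hq0, zpow_one, zpow_natCast, pow_add]; field_simp]
    -- The exponent is the total power of ‖σ‖ used up by the growing factors; multiplying through by
    -- it lets each bound be applied without division.
    have hpos : 0 < ‖σ‖ ^ (2 * (n * (n + 1)) + (n + m + n) * (n + m + n + 1) + m * (m + 1)) := by
      positivity
    refine le_of_mul_le_mul_right ?_ hpos
    calc _ = ‖a‖ ^ (2 * n) * ‖σ‖ ^ (4 * n ^ 2 + 2 * ((n + m) * (n + m + 1))) *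
          ((‖pairFn q a p₁ n‖ * ‖σ‖ ^ (n * (n + 1))) * (‖pairFn q a p₂ n‖ * ‖σ‖ ^ (n * (n + 1))) *
          ((‖qInf q (a * p₃ * q / q ^ m)‖ * ‖σ‖ ^ (m * (m + 1))) *
          (‖qInf q (p₃ * q / q ^ (n + m + n))‖ * ‖σ‖ ^ ((n + m + n) * (n + m + n + 1)))) *
          (‖qInf q (a * p₄ * q * q ^ (n + m + n))‖ * ‖qInf q (p₄ * q * q ^ m)‖)) := by ring
      _ ≤ ‖a‖ ^ (2 * n) * ‖σ‖ ^ (4 * n ^ 2 + 2 * ((n + m) * (n + m + 1))) *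
          ((K ‖p₁‖ * (‖p₁‖ * ‖q‖) ^ n) * (K ‖p₂‖ * (‖p₂‖ * ‖q‖) ^ n) *
          ((G (‖a‖ * ‖p₃‖ * ‖q‖) * (‖a‖ * ‖p₃‖ * ‖q‖) ^ m) *
          (G (‖p₃‖ * ‖q‖) * (‖p₃‖ * ‖q‖) ^ (n + m + n))) *
          (G (‖a‖ * ‖p₄‖ * ‖q‖) * G (‖p₄‖ * ‖q‖))) := by
          have := (hK ‖p₁‖).le; have := (hK ‖p₂‖).le
          have := (hG (‖a‖ * ‖p₃‖ * ‖q‖)).le; have := (hG (‖p₃‖ * ‖q‖)).le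
          have := (hG (‖a‖ * ‖p₄‖ * ‖q‖)).le
          gcongr
      _ = (K ‖p₁‖ * K ‖p₂‖ * (G (‖a‖ * ‖p₃‖ * ‖q‖) * G (‖p₃‖ * ‖q‖)) *
          (G (‖a‖ * ‖p₄‖ * ‖q‖) * G (‖p₄‖ * ‖q‖))) * (‖a‖ * ‖q‖ * (‖p₁‖ * ‖p₂‖)) ^ n *
          (‖a‖ * (‖p₃‖ * ‖q‖) ^ 2) ^ (n + m) *
          ‖σ‖ ^ (2 * (n * (n + 1)) + (n + m + n) * (n + m + n + 1) + m * (m + 1)) := by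
          rw [← hs]; ring
      _ ≤ _ := by
          have := (hK ‖p₁‖).le; have := (hK ‖p₂‖).le
          have := (hG (‖a‖ * ‖p₃‖ * ‖q‖)).le; have := (hG (‖p₃‖ * ‖q‖)).le
          have := (hG (‖a‖ * ‖p₄‖ * ‖q‖)).le; have := (hG (‖p₄‖ * ‖q‖)).le
          gcongr
  · obtain ⟨m, rfl⟩ := Nat.exists_eq_add_of_le hnN
    have c₃ := norm_qInf_le_growthConst hq1 (x := a * p₃ * q) (r := ‖a‖ * ‖p₃‖ * ‖q‖)
      (by positivity) (by rw [norm_mul, norm_mul]) m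
    have c₄ := norm_qInf_div_pow_le hq0 hq1 hσ (x := p₄ * q) (r := ‖p₄‖ * ‖q‖) (by positivity)
      (by rw [norm_mul]) m
    rw [show a * (p₃ / q ^ N) * q ^ (((N + m : ℕ) : ℤ) + 1) = a * p₃ * q * q ^ m by
        rw [zpow_add_one₀ hq0, zpow_natCast, pow_add]; field_simp,
      show p₄ * q ^ N * q ^ (1 - ((N + m : ℕ) : ℤ)) = p₄ * q / q ^ m by
        rw [zpow_sub₀ hq0, zpow_one, zpow_natCast, pow_add]; field_simp]
    have hpos : 0 < ‖σ‖ ^ (2 * ((N + m) * (N + m + 1)) + (N + (N + m)) * (N + (N + m) + 1) +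
        m * (m + 1)) := by positivity
    refine le_of_mul_le_mul_right ?_ hpos
    calc _ = ‖a‖ ^ (2 * (N + m)) * ‖σ‖ ^ (4 * (N + m) ^ 2 + 2 * (N * (N + 1))) *
          ((‖pairFn q a p₁ (N + m : ℕ)‖ * ‖σ‖ ^ ((N + m) * (N + m + 1))) *
          (‖pairFn q a p₂ (N + m : ℕ)‖ * ‖σ‖ ^ ((N + m) * (N + m + 1))) *
          (‖qInf q (a * p₃ * q * q ^ m)‖ * (‖qInf q (p₃ * q / q ^ (N + (N + m)))‖ *
            ‖σ‖ ^ ((N + (N + m)) * (N + (N + m) + 1)))) *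
          (‖qInf q (a * p₄ * q * q ^ (N + (N + m)))‖ * (‖qInf q (p₄ * q / q ^ m)‖ *
            ‖σ‖ ^ (m * (m + 1))))) := by ring
      _ ≤ ‖a‖ ^ (2 * (N + m)) * ‖σ‖ ^ (4 * (N + m) ^ 2 + 2 * (N * (N + 1))) *
          ((K ‖p₁‖ * (‖p₁‖ * ‖q‖) ^ (N + m)) * (K ‖p₂‖ * (‖p₂‖ * ‖q‖) ^ (N + m)) *
          (G (‖a‖ * ‖p₃‖ * ‖q‖) * (G (‖p₃‖ * ‖q‖) * (‖p₃‖ * ‖q‖) ^ (N + (N + m)))) *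
          (G (‖a‖ * ‖p₄‖ * ‖q‖) * (G (‖p₄‖ * ‖q‖) * (‖p₄‖ * ‖q‖) ^ m))) := by
          have := (hK ‖p₁‖).le; have := (hK ‖p₂‖).le
          have := (hG (‖a‖ * ‖p₃‖ * ‖q‖)).le; have := (hG (‖p₃‖ * ‖q‖)).le
          have := (hG (‖a‖ * ‖p₄‖ * ‖q‖)).le
          gcongr
      _ = (K ‖p₁‖ * K ‖p₂‖ * (G (‖a‖ * ‖p₃‖ * ‖q‖) * G (‖p₃‖ * ‖q‖)) *
          (G (‖a‖ * ‖p₄‖ * ‖q‖) * G (‖p₄‖ * ‖q‖))) * ((‖a‖ * ‖q‖ * (‖p₁‖ * ‖p₂‖)) ^ N *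
          (‖a‖ ^ 2 * ‖q‖ ^ 2 * (‖p₁‖ * ‖p₂‖ * ‖p₃‖ * ‖p₄‖)) ^ m) *
          (‖a‖ * (‖p₃‖ * ‖q‖) ^ 2) ^ N *
          ‖σ‖ ^ (2 * ((N + m) * (N + m + 1)) + (N + (N + m)) * (N + (N + m) + 1) +
            m * (m + 1)) := by
          rw [← hs]; ring
      _ ≤ _ := by
          have := (hK ‖p₁‖).le; have := (hK ‖p₂‖).le
          have := (hG (‖a‖ * ‖p₃‖ * ‖q‖)).le; have := (hG (‖p₃‖ * ‖q‖)).le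
          have := (hG (‖a‖ * ‖p₄‖ * ‖q‖)).le; have := (hG (‖p₄‖ * ‖q‖)).le
          rw [pow_add ρ]
          gcongr

theorem norm_core_shift_le (hq0 : q ≠ 0) (hq1 : ‖q‖ < 1) (hσ : σ ^ 2 = q) (ha : a ≠ 0)
    {p₁ p₂ p₃ p₄ : ℂ} (h₁ : p₁ ≠ 0) (h₂ : p₂ ≠ 0) (h₃ : p₃ ≠ 0) (h₄ : p₄ ≠ 0) {ρ : ℝ}
    (hρ : ‖a * q * (p₁ * p₂)‖ ≤ ρ) (hρ' : ‖a ^ 2 * q ^ 2 * (p₁ * p₂ * p₃ * p₄)‖ ≤ ρ) :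
    ∃ C : ℝ, 0 ≤ C ∧ ∀ (N : ℕ) (n : ℤ), ‖core q a p₁ p₂ (p₃ / q ^ N) (p₄ * q ^ N) n‖ *
      ‖σ‖ ^ (2 * (N * (N + 1))) ≤ C * ρ ^ n.natAbs * (‖a‖ * (‖p₃‖ * ‖q‖) ^ 2) ^ N := by
  have hρ0 : 0 ≤ ρ := (norm_nonneg _).trans hρ
  have han : 0 < ‖a‖ := norm_pos_iff.2 ha
  obtain ⟨C, hC0, hC⟩ := norm_core_shift_natCast_le hq0 hq1 hσ ha h₁ h₂ h₃ h₄ hρ hρ'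
  obtain ⟨C', hC'0, hC'⟩ := norm_core_shift_natCast_le hq0 hq1 hσ (inv_ne_zero ha) (mul_ne_zero ha h₁)
    (mul_ne_zero ha h₂) (mul_ne_zero ha h₃) (mul_ne_zero ha h₄) (ρ := ρ)
    (by convert hρ using 2; field_simp) (by convert hρ' using 2; field_simp)
  refine ⟨max C C', hC0.trans (le_max_left _ _), fun N n => ?_⟩
  obtain ⟨m, rfl | rfl⟩ := n.eq_nat_or_neg
  · refine (hC N m).trans ?_
    rw [Int.natAbs_natCast]
    have := le_max_left C C'
    gcongr
  · have e : ‖a⁻¹‖ * (‖a * p₃‖ * ‖q‖) ^ 2 = ‖a‖ * (‖p₃‖ * ‖q‖) ^ 2 := by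
      rw [norm_inv, norm_mul]; field_simp
    have := hC' N m
    rw [e] at this
    rw [core_neg ha, Int.natAbs_neg, Int.natAbs_natCast, ← mul_div_assoc, ← mul_assoc]
    refine this.trans ?_
    have := le_max_right C C'
    gcongr

/-- The p₄ factor tends to 1, and the p₃ factor tends to two thetas shifted by q^n and q^{-n}.
Quasi-periodicity extracts a^{-n}q^{-n²}, halving the exponents of a^{2n}q^{2n²}. -/
theorem tendsto_core_shift (hq0 : q ≠ 0) (hq1 : ‖q‖ < 1) (hσ : σ ^ 2 = q) (ha : a ≠ 0)
    {p₃ : ℂ} (h₃ : p₃ ≠ 0) (p₁ p₂ p₄ : ℂ) (n : ℤ) :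
    Tendsto (fun N : ℕ => core q a p₁ p₂ (p₃ / q ^ N) (p₄ * q ^ N) n *
      (σ ^ (2 * (N * (N + 1))) / (a * p₃ ^ 2 * q ^ 2) ^ N)) atTop
      (𝓝 (qTheta q (a * p₃ * q) * qTheta q (p₃ * q) *
        (a ^ n * q ^ (n ^ 2) * (pairFn q a p₁ n * pairFn q a p₂ n)))) := by
  have hqn : ∀ m : ℤ, q ^ m ≠ 0 := fun m => zpow_ne_zero _ hq0
  have t1 := tendsto_qInf_div_pow hq0 hq1 hσ (x := a * p₃ * q * q ^ n) (by simp [ha, h₃, hq0, hqn])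
  have t2 := tendsto_qInf_div_pow hq0 hq1 hσ (x := p₃ * q * q ^ (-n)) (by simp [h₃, hq0, hqn])
  have t3 := tendsto_pairFn_mul_pow (a := a) hq1 p₄ n
  have hth := qTheta_pair_zpow hq0 hq1 (x := a * p₃ * q) (y := p₃ * q) (by simp [ha, h₃, hq0])
    (by simp [h₃, hq0]) n
  have hlim : a ^ (2 * n) * q ^ (2 * n ^ 2) * (pairFn q a p₁ n * pairFn q a p₂ n) *
      (qTheta q (a * p₃ * q * q ^ n) * qTheta q (p₃ * q * q ^ (-n)) * 1) =
      qTheta q (a * p₃ * q) * qTheta q (p₃ * q) *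
        (a ^ n * q ^ (n ^ 2) * (pairFn q a p₁ n * pairFn q a p₂ n)) := by
    rw [hth, show p₃ * q / (a * p₃ * q) = a⁻¹ by field_simp, inv_zpow, zpow_neg, two_mul, two_mul,
      zpow_add₀ ha, zpow_add₀ hq0]
    have h1 : a ^ n ≠ 0 := zpow_ne_zero _ ha
    have h2 := hqn (n ^ 2)
    field_simp
  rw [← hlim]
  refine (((t1.mul t2).mul t3).const_mul (a ^ (2 * n) * q ^ (2 * n ^ 2) *
    (pairFn q a p₁ n * pairFn q a p₂ n))).congr fun N => ?_
  unfold core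
  rw [show pairFn q a (p₃ / q ^ N) n = qInf q (a * p₃ * q * q ^ n / q ^ N) *
      qInf q (p₃ * q * q ^ (-n) / q ^ N) by
    unfold pairFn
    rw [zpow_add_one₀ hq0, show (1 : ℤ) - n = -n + 1 by ring, zpow_add_one₀ hq0]
    congr 2 <;> ring]
  have e : (-(a * p₃ * q * q ^ n)) ^ N * (-(p₃ * q * q ^ (-n))) ^ N = (a * p₃ ^ 2 * q ^ 2) ^ N := by
    rw [← mul_pow]
    congr 1
    have := hqn n
    rw [zpow_neg]
    field_simp
  rw [← e, show 2 * (N * (N + 1)) = N * (N + 1) + N * (N + 1) by ring, pow_add σ]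
  ring

theorem tendsto_psi8_shift (hq0 : q ≠ 0) (hq1 : ‖q‖ < 1) (hσ : σ ^ 2 = q) (ha : a ≠ 0)
    (hz : z ≠ 0) {p₁ p₂ p₃ p₄ : ℂ} (h₁ : p₁ ≠ 0) (h₂ : p₂ ≠ 0) (h₃ : p₃ ≠ 0) (h₄ : p₄ ≠ 0)
    (h : ‖a * q * (p₁ * p₂)‖ < 1) (h' : ‖a ^ 2 * q ^ 2 * (p₁ * p₂ * p₃ * p₄)‖ < 1) :
    Tendsto (fun N : ℕ => psi8 q a z p₁ p₂ (p₃ / q ^ N) (p₄ * q ^ N) *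
      (σ ^ (2 * (N * (N + 1))) / (a * p₃ ^ 2 * q ^ 2) ^ N)) atTop
      (𝓝 (qTheta q (a * p₃ * q) * qTheta q (p₃ * q) * psi8Two q a z p₁ p₂)) := by
  obtain ⟨ρ, hρ⟩ : ∃ ρ, ρ = max ‖a * q * (p₁ * p₂)‖ ‖a ^ 2 * q ^ 2 * (p₁ * p₂ * p₃ * p₄)‖ :=
    ⟨_, rfl⟩
  have hρ1 : ρ < 1 := hρ ▸ max_lt h h'
  have hρa : ‖a * q * (p₁ * p₂)‖ ≤ ρ := hρ ▸ le_max_left _ _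
  have hρ0 : 0 ≤ ρ := (norm_nonneg _).trans hρa
  obtain ⟨C, hC0, hC⟩ := norm_core_shift_le hq0 hq1 hσ ha h₁ h₂ h₃ h₄ hρa (hρ ▸ le_max_right _ _)
  obtain ⟨M, hM0, hM⟩ := psi8Weight_bounded hq0 hq1 ha hz
  unfold psi8 psi8Two
  simp only [← tsum_mul_right, ← tsum_mul_left]
  refine tendsto_tsum_of_dominated_convergence ((summable_pow_natAbs hρ0 hρ1).mul_left (C * M))
    (fun n => ?_) (Eventually.of_forall fun N n => ?_)
  · have := (tendsto_core_shift hq0 hq1 hσ ha h₃ p₁ p₂ p₄ n).mul_const (psi8Weight q a z n)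
    rw [← mul_assoc]
    refine this.congr fun N => ?_
    unfold psi8Term
    ring
  · unfold psi8Term
    rw [mul_right_comm, norm_mul, ← mul_div_assoc, norm_div, norm_mul, norm_pow, norm_pow,
      show C * M * ρ ^ n.natAbs = C * ρ ^ n.natAbs * M by ring]
    refine mul_le_mul ?_ (hM n) (norm_nonneg _) (by positivity)
    have hpos : 0 < ‖a * p₃ ^ 2 * q ^ 2‖ ^ N := by
      have : a * p₃ ^ 2 * q ^ 2 ≠ 0 := by simp [ha, h₃, hq0]
      positivity
    rw [div_le_iff₀ hpos]
    have e : ‖a * p₃ ^ 2 * q ^ 2‖ = ‖a‖ * (‖p₃‖ * ‖q‖) ^ 2 := by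
      rw [norm_mul, norm_mul, norm_pow, norm_pow]
      ring
    rw [e]
    exact hC N n

/-- The two pairs complete (1 - z q^n)(1 - a q^n/z) to θ(z q^n)θ(a q^n/z). This is why the
parameters z and a/z of the ₈ψ₈ amount to a rational weight, and why such a weight can be traded
back for two ₆ψ₆ parameters. -/
theorem pairFn_mul_pairFn (hq0 : q ≠ 0) (hq1 : ‖q‖ < 1) (hz : z ≠ 0) (ha : a ≠ 0) (n : ℤ) :
    pairFn q a (1 / z) n * pairFn q a (z / a) n * ((1 - z * q ^ n) * (1 - a / z * q ^ n)) =
      q ^ n * (a ^ n)⁻¹ * (q ^ (n ^ 2))⁻¹ * (qTheta q z * qTheta q (a / z)) := by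
  have hy : q ^ n ≠ 0 := zpow_ne_zero _ hq0
  have haz : a / z ≠ 0 := div_ne_zero ha hz
  have key := qTheta_pair_zpow hq0 hq1 (x := z) (y := q / (a / z)) hz (div_ne_zero hq0 haz) n
  rw [show q / (a / z) * q ^ (-n) = q / (a / z * q ^ n) by rw [zpow_neg]; field_simp,
    qTheta_div hq0 (mul_ne_zero haz hy), qTheta_div hq0 haz,
    show q / (a / z) / z = q * a⁻¹ by field_simp, mul_zpow, inv_zpow, zpow_neg] at key
  have t1 : qTheta q (z * q ^ n) = (1 - z * q ^ n) * (qInf q (a * (z / a) * q ^ (n + 1)) *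
      qInf q (1 / z * q ^ (1 - n))) := by
    unfold qTheta
    rw [qInf_step hq1, show z * q ^ n * q = a * (z / a) * q ^ (n + 1) by
      rw [zpow_add_one₀ hq0]; field_simp, show q / (z * q ^ n) = 1 / z * q ^ (1 - n) by
      rw [zpow_sub₀ hq0, zpow_one]; field_simp]
    ring
  have t2 : qTheta q (a / z * q ^ n) = (1 - a / z * q ^ n) * (qInf q (a * (1 / z) * q ^ (n + 1)) *
      qInf q (z / a * q ^ (1 - n))) := by
    unfold qTheta
    rw [qInf_step hq1, show a / z * q ^ n * q = a * (1 / z) * q ^ (n + 1) by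
      rw [zpow_add_one₀ hq0]; field_simp, show q / (a / z * q ^ n) = z / a * q ^ (1 - n) by
      rw [zpow_sub₀ hq0, zpow_one]; field_simp]
    ring
  rw [← key, t1, t2]
  unfold pairFn
  ring

/-- The limiting series is a `₆ψ₆` series. -/
theorem qTheta_mul_psi8Two (hq0 : q ≠ 0) (hq1 : ‖q‖ < 1) (hz : z ≠ 0) (ha : a ≠ 0)
    (hzq : ∀ n : ℤ, z * q ^ n ≠ 1) (hazq : ∀ n : ℤ, a / z * q ^ n ≠ 1) (p₁ p₂ : ℂ) :
    qTheta q z * qTheta q (a / z) * psi8Two q a z p₁ p₂ = psi6 q a p₁ p₂ (1 / z) (z / a) := by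
  unfold psi8Two psi6
  rw [← tsum_mul_left]
  refine tsum_congr fun n => ?_
  unfold psi6Term core psi8Weight
  have hqn : ∀ m : ℤ, q ^ m ≠ 0 := fun m => zpow_ne_zero _ hq0
  have d1 : 1 - z * q ^ n ≠ 0 := sub_ne_zero.2 (hzq n).symm
  have d2 : 1 - a / z * q ^ n ≠ 0 := sub_ne_zero.2 (hazq n).symm
  have hpair := pairFn_mul_pairFn hq0 hq1 hz ha n
  have han : a ^ n ≠ 0 := zpow_ne_zero _ ha
  have e1 : q ^ (2 * n) = q ^ n * q ^ n := by rw [two_mul, zpow_add₀ hq0]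
  have e2 : q ^ (2 * n ^ 2) = q ^ (n ^ 2) * q ^ (n ^ 2) := by rw [two_mul, zpow_add₀ hq0]
  have e3 : a ^ (2 * n) = a ^ n * a ^ n := by rw [two_mul, zpow_add₀ ha]
  have hd := mul_ne_zero d1 d2
  rw [e1, e2, e3, zpow_neg]
  have hy := hqn n
  have hw := hqn (n ^ 2)
  generalize q ^ n = y at *
  generalize q ^ n ^ 2 = w at *
  generalize a ^ n = v at *
  generalize pairFn q a p₁ n * pairFn q a p₂ n = c
  rw [mul_assoc c, eq_div_of_mul_eq hd hpair]
  generalize (1 - z * y) * (1 - a / z * y) = d at *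
  field_simp

end psi8Limit

/-! ### Limit of the shifted ₈W₇. -/

/-- The unilateral series to which the `₈W₇` series degenerates. -/
noncomputable def w5 (q a z p₁ p₂ : ℂ) : ℂ :=
  ∑' k : ℕ, (a * q * (p₁ * p₂)) ^ k * (1 - q ^ (2 * k) / z) * wBase q a z k *
    (wPair q z p₁ k * wPair q z p₂ k)

section w7Limit

variable {q σ a z : ℂ}

theorem qFin_div_pow (hq0 : q ≠ 0) (hσ : σ ^ 2 = q) {x : ℂ} (hx : x ≠ 0) (k : ℕ) :
    qFin q (x / q ^ k) k * σ ^ (k * (k + 1)) = (-x) ^ k * qFin q (q / x) k := by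
  induction k with
  | zero => simp [qFin]
  | succ k ih =>
    have hqk : q ^ k ≠ 0 := pow_ne_zero _ hq0
    rw [qFin_succ', show x / q ^ (k + 1) * q = x / q ^ k by rw [pow_succ]; field_simp, qFin_succ,
      show (k + 1) * (k + 1 + 1) = k * (k + 1) + 2 * (k + 1) by ring, pow_add σ, pow_mul σ 2, hσ,
      pow_succ (-x)]
    calc _ = (qFin q (x / q ^ k) k * σ ^ (k * (k + 1))) *
          ((1 - x / q ^ (k + 1)) * q ^ (k + 1)) := by ring
      _ = _ := by
        rw [ih, pow_succ]
        field_simp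
        ring

theorem qTheta_mul_pow (hq0 : q ≠ 0) (hq1 : ‖q‖ < 1) {y : ℂ} (hy : y ≠ 0) (x : ℂ) (k : ℕ) :
    (∏ j ∈ Finset.range k, (-(x * q ^ j))) * qTheta q (y * q ^ k) = (x / y) ^ k * qTheta q y := by
  induction k with
  | zero => simp
  | succ k ih =>
    have hqk : q ^ k ≠ 0 := pow_ne_zero _ hq0
    have h := qTheta_mul hq0 hq1 (mul_ne_zero hy hqk)
    rw [Finset.prod_range_succ, pow_succ, pow_succ (x / y), mul_right_comm ((x / y) ^ k), ← ih,
      ← mul_assoc y]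
    have : qTheta q (y * q ^ k * q) = -qTheta q (y * q ^ k) / (y * q ^ k) := by
      rw [← h]; field_simp
    rw [this]
    field_simp

/-- Each factor 1 - x q^j/q^N behaves like -x q^j/q^N, while the infinite product gives θ(y q^k). By
quasi-periodicity the powers of q cancel and only (x/y)^k is left. -/
theorem tendsto_qFin_div_pow_mul (hq0 : q ≠ 0) (hq1 : ‖q‖ < 1) (hσ : σ ^ 2 = q) {y : ℂ}
    (hy : y ≠ 0) (x : ℂ) (k : ℕ) :
    Tendsto (fun N : ℕ => qFin q (x / q ^ N) k * qInf q (y * q ^ k / q ^ N) *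
      (σ ^ (N * (N + 1)) / (-y) ^ N)) atTop (𝓝 ((x / y) ^ k * qTheta q y)) := by
  have hqk : q ^ k ≠ 0 := pow_ne_zero _ hq0
  have t1 := tendsto_qInf_div_pow hq0 hq1 hσ (mul_ne_zero hy hqk)
  have t2 : Tendsto (fun N : ℕ => ∏ j ∈ Finset.range k, (q ^ N - x * q ^ j)) atTop
      (𝓝 (∏ j ∈ Finset.range k, (0 - x * q ^ j))) :=
    tendsto_finsetProd _ fun j _ => (tendsto_pow_atTop_nhds_zero_of_norm_lt_one hq1).sub_const _
  have := t2.mul t1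
  simp only [zero_sub] at this
  rw [qTheta_mul_pow hq0 hq1 hy] at this
  refine this.congr fun N => ?_
  have hqN : q ^ N ≠ 0 := pow_ne_zero _ hq0
  have e : qFin q (x / q ^ N) k * (q ^ k) ^ N = ∏ j ∈ Finset.range k, (q ^ N - x * q ^ j) := by
    unfold qFin
    rw [← pow_mul, mul_comm k N, pow_mul, ← Finset.card_range k, ← Finset.prod_const,
      Finset.card_range, ← Finset.prod_mul_distrib]
    refine Finset.prod_congr rfl fun j _ => ?_
    field_simp
  rw [← e, ← neg_mul, mul_pow (-y)]
  field_simp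

/-- The majorant for the ₈W₇ limit: ratio ‖qx/y‖ for k ≤ N and ‖q‖ afterwards. -/
theorem norm_qFin_div_pow_mul_le (hq0 : q ≠ 0) (hq1 : ‖q‖ < 1) (hσ : σ ^ 2 = q) {x y : ℂ}
    (hx : x ≠ 0) (hy : y ≠ 0) {ρ : ℝ} (hρ : ‖q * x / y‖ ≤ ρ) (hρ' : ‖q‖ ≤ ρ) :
    ∃ C : ℝ, 0 ≤ C ∧ ∀ N k : ℕ, ‖qFin q (x / q ^ N) k * qInf q (y * q ^ k / q ^ N)‖ *
      ‖σ‖ ^ (N * (N + 1)) * ‖q‖ ^ k ≤ C * ρ ^ k * ‖y‖ ^ N := by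
  have hs : ‖σ‖ ^ 2 = ‖q‖ := by rw [← norm_pow, hσ]
  have hq : 0 < ‖q‖ := norm_pos_iff.2 hq0
  have nx : 0 < ‖x‖ := norm_pos_iff.2 hx
  have ny : 0 < ‖y‖ := norm_pos_iff.2 hy
  have hρ0 : 0 ≤ ρ := hq.le.trans hρ'
  have hG := (growthConst_pos q ‖y‖).le
  have hE := (expConst_pos q ‖q / x‖).le
  have hE' := (expConst_pos q ‖x‖).le
  -- The summand 1 serves the case k ≤ N and `expConst q ‖x‖` the case k ≥ N.
  refine ⟨growthConst q ‖y‖ * (expConst q ‖q / x‖ * (1 + expConst q ‖x‖)), by positivity,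
    fun N k => ?_⟩
  have hb : ∀ m k : ℕ, ‖qFin q (x / q ^ m / q ^ k) k‖ * ‖σ‖ ^ (k * (k + 1)) * ‖q‖ ^ (m * k) ≤
      ‖x‖ ^ k * expConst q ‖q / x‖ := by
    intro m k
    have hqm : q ^ m ≠ 0 := pow_ne_zero _ hq0
    have h := congrArg norm (qFin_div_pow hq0 hσ (div_ne_zero hx hqm) k)
    rw [norm_mul, norm_mul, norm_pow, norm_pow, norm_neg, norm_div, norm_pow, div_pow, ← pow_mul]
      at h
    rw [h, show q / (x / q ^ m) = q / x * q ^ m by field_simp, div_mul_eq_mul_div,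
      div_mul_cancel₀ _ (by positivity)]
    have := norm_qFin_le hq1 (norm_mul_pow_le hq1 (le_refl ‖q / x‖) m) k
    unfold expConst
    gcongr
  have hxy : ‖q * x / y‖ = ‖q‖ * ‖x‖ / ‖y‖ := by rw [norm_div, norm_mul]
  rcases le_total k N with hk | hk
  · obtain ⟨m, rfl⟩ := Nat.exists_eq_add_of_le hk
    have b1 := hb m k
    have b2 := norm_qInf_div_pow_le hq0 hq1 hσ ny le_rfl m
    have e1 : y * q ^ k / q ^ (k + m) = y / q ^ m := by
      have := pow_ne_zero k hq0
      rw [pow_add]; field_simp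
    have e2 : x / q ^ (k + m) = x / q ^ m / q ^ k := by rw [pow_add, div_div, mul_comm]
    rw [e1, e2, norm_mul]
    calc _ = (‖qFin q (x / q ^ m / q ^ k) k‖ * ‖σ‖ ^ (k * (k + 1)) * ‖q‖ ^ (m * k)) *
          (‖qInf q (y / q ^ m)‖ * ‖σ‖ ^ (m * (m + 1))) * ‖q‖ ^ k := by rw [← hs]; ring
      _ ≤ (‖x‖ ^ k * expConst q ‖q / x‖) * (growthConst q ‖y‖ * ‖y‖ ^ m) * ‖q‖ ^ k := by gcongr
      _ = growthConst q ‖y‖ * (expConst q ‖q / x‖ * (1 + 0)) * ‖q * x / y‖ ^ k *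
          ‖y‖ ^ (k + m) := by
          rw [hxy, pow_add, div_pow, mul_pow]
          field_simp
          ring
      _ ≤ _ := by gcongr
  · obtain ⟨m, rfl⟩ := Nat.exists_eq_add_of_le hk
    have b1 := hb 0 N
    have b2 := norm_qInf_le_growthConst hq1 ny le_rfl m
    have b3 := norm_qFin_le hq1 (le_refl ‖x‖) m
    have e1 : y * q ^ (N + m) / q ^ N = y * q ^ m := by
      have := pow_ne_zero N hq0
      rw [pow_add]; field_simp
    have e2 : qFin q (x / q ^ N) (N + m) = qFin q (x / q ^ N) N * qFin q x m := by
      have := pow_ne_zero N hq0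
      unfold qFin
      rw [Finset.prod_range_add]
      congr 1
      refine Finset.prod_congr rfl fun j _ => ?_
      rw [pow_add]; field_simp
    rw [e1, e2, norm_mul, norm_mul]
    simp only [pow_zero, div_one, zero_mul, mul_one] at b1
    calc _ = (‖qFin q (x / q ^ N) N‖ * ‖σ‖ ^ (N * (N + 1))) * ‖qFin q x m‖ * ‖qInf q (y * q ^ m)‖ *
          ‖q‖ ^ N * ‖q‖ ^ m := by ring
      _ ≤ (‖x‖ ^ N * expConst q ‖q / x‖) * expConst q ‖x‖ * growthConst q ‖y‖ * ‖q‖ ^ N *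
          ‖q‖ ^ m := by
          unfold expConst at *
          gcongr
      _ = growthConst q ‖y‖ * (expConst q ‖q / x‖ * (0 + expConst q ‖x‖)) *
          (‖q * x / y‖ ^ N * ‖q‖ ^ m) * ‖y‖ ^ N := by
          rw [hxy, div_pow, mul_pow]
          field_simp
          ring
      _ ≤ _ := by
          rw [pow_add ρ]
          gcongr
          exact zero_le_one

theorem tendsto_w7_shift (hq0 : q ≠ 0) (hq1 : ‖q‖ < 1) (hσ : σ ^ 2 = q)
    (hz : z ≠ 0) {p₁ p₂ p₃ p₄ : ℂ} (h₃ : p₃ ≠ 0) (h₄ : p₄ ≠ 0)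
    (h : a * q * z * (p₁ * p₂ * p₃ * p₄) = 1) (hlt : ‖a * q * (p₁ * p₂)‖ < 1) :
    Tendsto (fun N : ℕ => w7 q a z p₁ p₂ (p₃ / q ^ N) (p₄ * q ^ N) *
      (σ ^ (N * (N + 1)) / (-(q * p₃)) ^ N)) atTop (𝓝 (qTheta q (q * p₃) * w5 q a z p₁ p₂)) := by
  have hx : 1 / (p₄ * z) ≠ 0 := by simp [h₄, hz]
  have hy : q * p₃ ≠ 0 := mul_ne_zero hq0 h₃
  -- By the balancing condition, the factor q^k of the term and the limiting (x/y)^k combine to the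
  -- argument a q p₁p₂ of the limiting series.
  have hxy : q * (1 / (p₄ * z)) / (q * p₃) = a * q * (p₁ * p₂) := by
    rw [div_eq_iff hy,
      show q * (1 / (p₄ * z)) = q * (a * q * z * (p₁ * p₂ * p₃ * p₄)) / (p₄ * z) by rw [h]; ring]
    field_simp
  obtain ⟨ρ, hρ⟩ : ∃ ρ, ρ = max ‖a * q * (p₁ * p₂)‖ ‖q‖ := ⟨_, rfl⟩
  have hρ1 : ρ < 1 := hρ ▸ max_lt hlt hq1
  have hρq : ‖q‖ ≤ ρ := hρ ▸ le_max_right _ _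
  have hρ0 : 0 ≤ ρ := (norm_nonneg _).trans hρq
  obtain ⟨C, hC0, hC⟩ := norm_qFin_div_pow_mul_le hq0 hq1 hσ hx hy (ρ := ρ)
    (by rw [hxy]; exact hρ ▸ le_max_left _ _) hρq
  obtain ⟨M, hM0, hM⟩ := norm_wBase_le (a := a) (z := z) hq1
  have split : ∀ N k : ℕ, wPair q z (p₃ / q ^ N) k * wPair q z (p₄ * q ^ N) k =
      qFin q (1 / (p₃ * z) * q ^ N) k * qInf q (q * p₄ * q ^ k * q ^ N) *
      (qFin q (1 / (p₄ * z) / q ^ N) k * qInf q (q * p₃ * q ^ k / q ^ N)) := fun N k => by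
    have hqN : q ^ N ≠ 0 := pow_ne_zero _ hq0
    unfold wPair
    rw [show 1 / (p₃ / q ^ N * z) = 1 / (p₃ * z) * q ^ N by field_simp,
      show 1 / (p₄ * q ^ N * z) = 1 / (p₄ * z) / q ^ N by field_simp,
      show q * (p₃ / q ^ N) * q ^ k = q * p₃ * q ^ k / q ^ N by ring,
      show q * (p₄ * q ^ N) * q ^ k = q * p₄ * q ^ k * q ^ N by ring]
    ring
  unfold w7 w5
  simp only [← tsum_mul_right, ← tsum_mul_left]
  let B : ℝ := expConst q ‖1 / (p₁ * z)‖ * expConst q ‖q * p₁‖ *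
    (expConst q ‖1 / (p₂ * z)‖ * expConst q ‖q * p₂‖) *
    (expConst q ‖1 / (p₃ * z)‖ * expConst q ‖q * p₄‖)
  have hB : 0 ≤ B := by
    have := fun r => (expConst_pos q r).le
    have := this ‖1 / (p₁ * z)‖; have := (expConst_pos q ‖q * p₁‖).le
    have := (expConst_pos q ‖1 / (p₂ * z)‖).le; have := (expConst_pos q ‖q * p₂‖).le
    have := (expConst_pos q ‖1 / (p₃ * z)‖).le; have := (expConst_pos q ‖q * p₄‖).le
    positivity
  refine tendsto_tsum_of_dominated_convergence
    ((summable_geometric_of_lt_one hρ0 hρ1).mul_left (M * B * C))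
    (fun k => ?_) (Eventually.of_forall fun N k => ?_)
  · have t := (((tendsto_qFin_mul_pow hq1 (1 / (p₃ * z)) k).mul
      (tendsto_qInf_mul_pow hq1 (q * p₄ * q ^ k))).mul
      (tendsto_qFin_div_pow_mul hq0 hq1 hσ hy (1 / (p₄ * z)) k)).const_mul
      (q ^ k * (1 - q ^ (2 * k) / z) * wBase q a z k * (wPair q z p₁ k * wPair q z p₂ k))
    rw [one_mul, one_mul] at t
    convert t using 1
    · funext N
      unfold w7Term
      rw [mul_assoc (wPair q z p₁ k * wPair q z p₂ k), split]
      ring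
    · rw [← hxy, mul_div_assoc, mul_pow]
      ring_nf
  · unfold w7Term
    rw [mul_assoc (wPair q z p₁ k * wPair q z p₂ k), split]
    have b1 := norm_wPair_le (z := z) hq1 (le_refl ‖1 / (p₁ * z)‖) (le_refl ‖q * p₁‖) k
    have b2 := norm_wPair_le (z := z) hq1 (le_refl ‖1 / (p₂ * z)‖) (le_refl ‖q * p₂‖) k
    have b3 := norm_qFin_le hq1 (norm_mul_pow_le hq1 (le_refl ‖1 / (p₃ * z)‖) N) k
    have b4 := norm_qInf_le hq1 (norm_mul_pow_le hq1 (norm_mul_pow_le hq1 (le_refl ‖q * p₄‖) k) N)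
    have hpos : 0 < ‖q * p₃‖ ^ N := by positivity
    have b5 : ‖qFin q (1 / (p₄ * z) / q ^ N) k * qInf q (q * p₃ * q ^ k / q ^ N)‖ *
      ‖σ‖ ^ (N * (N + 1)) * ‖q‖ ^ k / ‖q * p₃‖ ^ N ≤ C * ρ ^ k := (div_le_iff₀ hpos).2 (hC N k)
    have b6 := hM k
    calc _ = ‖(1 - q ^ (2 * k) / z) * wBase q a z k‖ * (‖wPair q z p₁ k‖ * ‖wPair q z p₂ k‖ *
          (‖qFin q (1 / (p₃ * z) * q ^ N) k‖ * ‖qInf q (q * p₄ * q ^ k * q ^ N)‖)) *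
          (‖qFin q (1 / (p₄ * z) / q ^ N) k * qInf q (q * p₃ * q ^ k / q ^ N)‖ *
      ‖σ‖ ^ (N * (N + 1)) * ‖q‖ ^ k / ‖q * p₃‖ ^ N) := by
          simp only [norm_mul, norm_div, norm_pow, norm_neg]
          ring
      _ ≤ M * B * (C * ρ ^ k) := by
          simp only [B]
          unfold expConst at *
          gcongr
      _ = _ := by ring

/-- The limiting series is a ₆ψ₆ with special parameter 1/z. One of its parameters equals the
special parameter, which makes it unilateral. -/
theorem w5_term (hq0 : q ≠ 0) (hq1 : ‖q‖ < 1) (hσ : σ ^ 2 = q) (ha : a ≠ 0) (hz : z ≠ 0)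
    {p₁ p₂ : ℂ} (h₁ : p₁ ≠ 0) (h₂ : p₂ ≠ 0) (n : ℕ) :
    psi6Term q (1 / z) (p₁ * z) (p₂ * z) (a / z) z n =
      qInf q (p₁ * z * q) * qInf q (p₂ * z * q) * qInf q (a * q / z) * qInf q (z * q) *
      ((a * q * (p₁ * p₂)) ^ n * (1 - q ^ (2 * n) / z) * wBase q a z n *
        (wPair q z p₁ n * wPair q z p₂ n)) := by
  have hσ0 : σ ≠ 0 := by rintro rfl; exact hq0 (by rw [← hσ]; simp)
  have hqn : q ^ n ≠ 0 := pow_ne_zero _ hq0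
  have hP : ∀ {y : ℂ}, y ≠ 0 → qInf q (y * q ^ (1 - (n : ℤ))) * σ ^ (n * (n + 1)) =
      (-(y * q)) ^ n * qFin q (1 / y) n * qInf q (y * q) := by
    intro y hy
    have := qInf_div_pow hq0 hq1 hσ (mul_ne_zero hy hq0) n
    rw [show y * q / q ^ n = y * q ^ (1 - (n : ℤ)) by
      rw [zpow_sub₀ hq0, zpow_one, zpow_natCast]; ring, show q / (y * q) = 1 / y by field_simp] at this
    exact this
  have k1 := hP (mul_ne_zero h₁ hz)
  have k2 := hP (mul_ne_zero h₂ hz)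
  have k3 := hP (div_ne_zero ha hz)
  have k4 := hP hz
  have hs : σ ^ (4 * (n * (n + 1))) ≠ 0 := pow_ne_zero _ hσ0
  -- Multiplying by σ^{4n(n+1)} supplies one σ^{n(n+1)} to each of the four backward-shifted
  -- products.
  refine mul_right_cancel₀ hs ?_
  unfold psi6Term core pairFn
  rw [show (1 : ℂ) / (a / z) = z / a by field_simp] at k3
  have e0 : ∀ x : ℂ, 1 / z * (x * z) * q ^ ((n : ℤ) + 1) = q * x * q ^ n := fun x => by
    rw [zpow_add_one₀ hq0, zpow_natCast]; field_simp
  rw [e0 p₁, e0 p₂, show 1 / z * z * q ^ ((n : ℤ) + 1) = q * q ^ n by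
    rw [zpow_add_one₀ hq0, zpow_natCast]; field_simp,
    show 1 / z * (a / z) * q ^ ((n : ℤ) + 1) = a * q / z ^ 2 * q ^ n by
    rw [zpow_add_one₀ hq0, zpow_natCast]; field_simp]
  have e1 : q ^ (2 * (n : ℤ) ^ 2) = σ ^ (4 * n ^ 2) := by
    rw [← hσ]; norm_cast; rw [← pow_mul]; ring_nf
  have e2 : (1 / z) ^ (2 * (n : ℤ)) = ((1 / z) ^ n) ^ 2 := by
    norm_cast; rw [← pow_mul, mul_comm]
  have e3 : q ^ (-(n : ℤ)) - 1 / z * q ^ (n : ℤ) = (1 - q ^ (2 * n) / z) / q ^ n := by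
    rw [zpow_neg, zpow_natCast, mul_comm 2 n, pow_mul]; field_simp
  rw [e1, e2, e3]
  unfold wBase wPair
  have e4 : σ ^ (4 * (n * (n + 1))) = σ ^ (4 * n ^ 2) * (q ^ n) ^ 2 := by
    rw [← hσ, ← pow_mul, ← pow_mul, ← pow_add]; ring_nf
  calc _ = ((1 / z) ^ n) ^ 2 * σ ^ (4 * n ^ 2) * (qInf q (q * p₁ * q ^ n) * qInf q (q * p₂ * q ^ n) *
        qInf q (a * q / z ^ 2 * q ^ n) * qInf q (q * q ^ n)) * ((1 - q ^ (2 * n) / z) / q ^ n) *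
        ((qInf q (p₁ * z * q ^ (1 - (n : ℤ))) * σ ^ (n * (n + 1))) *
        (qInf q (p₂ * z * q ^ (1 - (n : ℤ))) * σ ^ (n * (n + 1))) *
        (qInf q (a / z * q ^ (1 - (n : ℤ))) * σ ^ (n * (n + 1))) *
        (qInf q (z * q ^ (1 - (n : ℤ))) * σ ^ (n * (n + 1)))) := by ring
    _ = _ := by
      rw [k1, k2, k3, k4, e4, show a / z * q = a * q / z by ring]
      have ez : (-(p₁ * z * q)) ^ n * (-(p₂ * z * q)) ^ n * (-(a * q / z)) ^ n * (-(z * q)) ^ n *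
          ((1 / z) ^ n) ^ 2 / q ^ n = (a * q * (p₁ * p₂)) ^ n * (q ^ n) ^ 2 := by
        rw [div_eq_iff hqn, mul_assoc (_ ^ n) ((q ^ n) ^ 2), ← pow_succ (q ^ n)]
        rw [← mul_pow, ← mul_pow, ← mul_pow, ← pow_mul, ← pow_mul, mul_comm n 2, mul_comm n 3,
          pow_mul, pow_mul q 3, ← mul_pow, ← mul_pow]
        congr 1
        field_simp
      generalize (-(p₁ * z * q)) ^ n = x₁ at *
      generalize (-(p₂ * z * q)) ^ n = x₂ at *
      generalize (-(a * q / z)) ^ n = x₃ at *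
      generalize (-(z * q)) ^ n = x₄ at *
      generalize ((1 / z) ^ n) ^ 2 = x₅ at *
      generalize (a * q * (p₁ * p₂)) ^ n = x₆ at *
      linear_combination (σ ^ (4 * n ^ 2) * (qInf q (q * p₁ * q ^ n) * qInf q (q * p₂ * q ^ n) *
        qInf q (a * q / z ^ 2 * q ^ n) * qInf q (q * q ^ n)) * (1 - q ^ (2 * n) / z) *
        (qFin q (1 / (p₁ * z)) n * qInf q (p₁ * z * q) * (qFin q (1 / (p₂ * z)) n *
        qInf q (p₂ * z * q)) * (qFin q (z / a) n * qInf q (a * q / z)) *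
        (qFin q (1 / z) n * qInf q (z * q)))) * ez

/-- The limiting unilateral series is summed by the `₆ψ₆` summation. -/
theorem w5_eq (hq0 : q ≠ 0) (hq1 : ‖q‖ < 1) (hσ : σ ^ 2 = q) (ha : a ≠ 0) (hz : z ≠ 0)
    (hzq : ∀ n : ℤ, z * q ^ n ≠ 1) (hlt : ‖a * q / z‖ < 1) {p₁ p₂ : ℂ} (h₁ : p₁ ≠ 0) (h₂ : p₂ ≠ 0)
    (h : ‖a * q * (p₁ * p₂)‖ < 1) (g₁ : qInf q (p₁ * z * q) ≠ 0) (g₂ : qInf q (p₂ * z * q) ≠ 0) :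
    qInf q (a * q * (p₁ * p₂)) * w5 q a z p₁ p₂ = qInf q q * qInf q (1 / z) *
      qInf q (q * z * (p₁ * p₂)) * (qInf q (a * q * p₁ / z) * qInf q (a * q * p₂ / z)) := by
  have hE : (1 / z) ^ 2 * q * (p₁ * z * (p₂ * z) * (a / z) * z) = a * q * (p₁ * p₂) := by field_simp
  have key := psi6_eq (p₁ := p₁ * z) (p₂ := p₂ * z) (p₃ := a / z) (p₄ := z) hq0 hq1 hσ
    (one_div_ne_zero hz) (by rw [hE]; exact h)
  have hsum : psi6 q (1 / z) (p₁ * z) (p₂ * z) (a / z) z = qInf q (p₁ * z * q) *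
      qInf q (p₂ * z * q) * qInf q (a * q / z) * qInf q (z * q) * w5 q a z p₁ p₂ := by
    unfold psi6 w5
    rw [← tsum_mul_left]
    simp only [← w5_term hq0 hq1 hσ ha hz h₁ h₂]
    -- Terms with n < 0 vanish, since the parameter p = z contributes (q^{n+1}; q)_∞.
    refine (Function.Injective.tsum_eq (g := ((↑) : ℕ → ℤ)) Nat.cast_injective ?_).symm
    intro n hn
    by_contra hcon
    refine hn ?_
    have hneg : n < 0 := by
      by_contra h0
      exact hcon ⟨n.toNat, Int.toNat_of_nonneg (not_lt.1 h0)⟩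
    unfold psi6Term core
    have : pairFn q (1 / z) z n = 0 := by
      unfold pairFn
      rw [one_div_mul_cancel hz, one_mul, qInf_zpow_of_nonpos hq0 hq1 (by omega), zero_mul]
    rw [this]; ring
  have hzq' : qInf q (z * q) ≠ 0 := by
    rw [qInf_ne_zero_iff hq1]
    intro n
    have := hzq (n + 1)
    rwa [zpow_add_one₀ hq0, zpow_natCast, mul_comm (q ^ n), ← mul_assoc] at this
  have hth : qTheta q (1 / z) = qInf q (1 / z) * qInf q (z * q) := by
    unfold qTheta
    rw [show q / (1 / z) = z * q by field_simp]
  rw [hE, hsum, hth, show 1 / z * q * (p₁ * z) * (p₂ * z) = q * z * (p₁ * p₂) by field_simp,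
    show 1 / z * q * (p₁ * z) * (a / z) = a * q * p₁ / z by field_simp,
    show 1 / z * q * (p₁ * z) * z = p₁ * z * q by field_simp,
    show 1 / z * q * (p₂ * z) * (a / z) = a * q * p₂ / z by field_simp,
    show 1 / z * q * (p₂ * z) * z = p₂ * z * q by field_simp,
    show 1 / z * q * (a / z) * z = a * q / z by field_simp] at key
  have n3 := qInf_ne_zero_of_norm_lt hq1 hlt
  refine mul_left_cancel₀ (mul_ne_zero (mul_ne_zero (mul_ne_zero g₁ g₂) n3) hzq') ?_
  linear_combination key

end w7Limit

/-! ### Cancellation of the three limits by Weierstrass' identity. -/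

section limit

variable {q σ a z : ℂ}

theorem tendsto_regPsi_shift (hq0 : q ≠ 0) (hq1 : ‖q‖ < 1) (hσ : σ ^ 2 = q) (ha : a ≠ 0)
    (hz : z ≠ 0) {p₁ p₂ p₃ p₄ : ℂ} (h₁ : p₁ ≠ 0) (h₂ : p₂ ≠ 0) (h₃ : p₃ ≠ 0) (h₄ : p₄ ≠ 0)
    (h : ‖a * q * (p₁ * p₂)‖ < 1) (h' : ‖a ^ 2 * q ^ 2 * (p₁ * p₂ * p₃ * p₄)‖ < 1) :
    Tendsto (fun N : ℕ => regPsi q a z p₁ p₂ (p₃ / q ^ N) (p₄ * q ^ N) * shiftNorm σ q a z p₃ p₄ N)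
      atTop (𝓝 (qInf q (1 / (p₁ * z)) * qInf q (1 / (p₂ * z)) * qTheta q (1 / (p₄ * z)) *
        (qTheta q (a * p₃ * q) * qTheta q (p₃ * q) * psi8Two q a z p₁ p₂))) := by
  have t := (((tendsto_qInf_mul_pow hq1 (1 / (p₃ * z))).mul (tendsto_qInf_div_pow hq0 hq1 hσ
    (x := 1 / (p₄ * z)) (by simp [h₄, hz]))).const_mul (qInf q (1 / (p₁ * z)) *
    qInf q (1 / (p₂ * z)))).mul (tendsto_psi8_shift hq0 hq1 hσ ha hz h₁ h₂ h₃ h₄ h h')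
  rw [one_mul] at t
  refine t.congr fun N => ?_
  have hqN : q ^ N ≠ 0 := pow_ne_zero _ hq0
  unfold regPsi shiftNorm
  rw [show 1 / (p₃ / q ^ N * z) = 1 / (p₃ * z) * q ^ N by field_simp,
    show 1 / (p₄ * q ^ N * z) = 1 / (p₄ * z) / q ^ N by field_simp,
    show -(a * q ^ 2 * p₃ ^ 2 / (p₄ * z)) = -(1 / (p₄ * z)) * (a * p₃ ^ 2 * q ^ 2) by ring,
    mul_pow (-(1 / (p₄ * z))), show 3 * (N * (N + 1)) = N * (N + 1) + 2 * (N * (N + 1)) by ring,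
    pow_add σ]
  ring

theorem tendsto_regW_shift (hq0 : q ≠ 0) (hq1 : ‖q‖ < 1) (hσ : σ ^ 2 = q) (ha : a ≠ 0)
    (hz : z ≠ 0) {p₁ p₂ p₃ p₄ : ℂ} (h₁ : p₁ ≠ 0) (h₂ : p₂ ≠ 0) (h₃ : p₃ ≠ 0) (h₄ : p₄ ≠ 0)
    (h : a * q * z * (p₁ * p₂ * p₃ * p₄) = 1) (hlt : ‖a * q * (p₁ * p₂)‖ < 1) :
    Tendsto (fun N : ℕ => regW q a z p₁ p₂ (p₃ / q ^ N) (p₄ * q ^ N) * shiftNorm σ q a z p₃ p₄ N)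
      atTop (𝓝 (qInf q (a * q * p₁ * p₂) * qInf q (a * q * p₃ * p₄) *
        (qTheta q (a * q * p₁ * p₃) * qTheta q (a * q * p₂ * p₃)) *
        (qTheta q (q * p₃) * w5 q a z p₁ p₂))) := by
  have t := (((((tendsto_qInf_mul_pow hq1 (a * q * p₁ * p₄)).mul
    (tendsto_qInf_mul_pow hq1 (a * q * p₂ * p₄))).const_mul (qInf q (a * q * p₁ * p₂) *
    qInf q (a * q * p₃ * p₄))).mul ((tendsto_qInf_div_pow hq0 hq1 hσ
    (x := a * q * p₁ * p₃) (by simp [ha, hq0, h₁, h₃])).mul (tendsto_qInf_div_pow hq0 hq1 hσ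
    (x := a * q * p₂ * p₃) (by simp [ha, hq0, h₂, h₃]))))).mul
    (tendsto_w7_shift hq0 hq1 hσ hz h₃ h₄ h hlt)
  rw [one_mul, mul_one] at t
  refine t.congr fun N => ?_
  have hqN : q ^ N ≠ 0 := pow_ne_zero _ hq0
  unfold regW pairProd shiftNorm
  -- The balancing condition splits the base of `shiftNorm` into three factors, one for each
  -- normalized theta limit.
  have e : 1 / (p₄ * z) = a * q * (p₁ * p₂ * p₃) := by
    rw [div_eq_iff (mul_ne_zero h₄ hz)]; linear_combination -h
  rw [show -(a * q ^ 2 * p₃ ^ 2 / (p₄ * z)) =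
      -(a * q * p₁ * p₃) * -(a * q * p₂ * p₃) * -(q * p₃) by
      rw [div_eq_mul_one_div, e]; ring,
    mul_pow (-(a * q * p₁ * p₃) * -(a * q * p₂ * p₃)), mul_pow (-(a * q * p₁ * p₃)),
    show 3 * (N * (N + 1)) = N * (N + 1) + N * (N + 1) + N * (N + 1) by ring,
    pow_add σ, pow_add σ, show a * q * (p₃ / q ^ N) * (p₄ * q ^ N) = a * q * p₃ * p₄ by field_simp,
    ← mul_div_assoc (a * q * p₁), ← mul_div_assoc (a * q * p₂), ← mul_assoc (a * q * p₁),
    ← mul_assoc (a * q * p₂)]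
  ring

theorem tendsto_regProd_shift (hq0 : q ≠ 0) (hq1 : ‖q‖ < 1) (hσ : σ ^ 2 = q) (ha : a ≠ 0)
    (hz : z ≠ 0) {p₁ p₂ p₃ p₄ : ℂ} (h₃ : p₃ ≠ 0) (h₄ : p₄ ≠ 0) :
    Tendsto (fun N : ℕ => regProd q a z p₁ p₂ (p₃ / q ^ N) (p₄ * q ^ N) *
      shiftNorm σ q a z p₃ p₄ N) atTop (𝓝 (qTheta q (1 / p₁) * qInf q (a * q * p₁ / z) *
        (qTheta q (1 / p₂) * qInf q (a * q * p₂ / z)) * (qTheta q (q * p₃) *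
        qTheta q (a * q * p₃ / z) * qTheta q (1 / p₄)))) := by
  have t := ((((tendsto_qInf_mul_pow hq1 (1 / p₃)).mul
    (tendsto_qInf_mul_pow hq1 (q * p₄))).mul (tendsto_qInf_mul_pow hq1 (a * q * p₄ / z))).const_mul
    (qTheta q (1 / p₁) * qInf q (a * q * p₁ / z) *
        (qTheta q (1 / p₂) * qInf q (a * q * p₂ / z)))).mul
    (((tendsto_qInf_div_pow hq0 hq1 hσ (x := q * p₃) (by simp [hq0, h₃])).mul
    (tendsto_qInf_div_pow hq0 hq1 hσ (x := a * q * p₃ / z) (by simp [ha, hq0, hz, h₃]))).mul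
    (tendsto_qInf_div_pow hq0 hq1 hσ (x := 1 / p₄) (by simp [h₄])))
  rw [one_mul, mul_one, mul_one] at t
  refine t.congr fun N => ?_
  have hqN : q ^ N ≠ 0 := pow_ne_zero _ hq0
  have e3 : qTheta q (1 / (p₃ / q ^ N)) = qInf q (1 / p₃ * q ^ N) * qInf q (q * p₃ / q ^ N) := by
    unfold qTheta
    rw [show 1 / (p₃ / q ^ N) = 1 / p₃ * q ^ N by field_simp,
      show q / (1 / p₃ * q ^ N) = q * p₃ / q ^ N by field_simp]
  have e4 : qTheta q (1 / (p₄ * q ^ N)) = qInf q (1 / p₄ / q ^ N) * qInf q (q * p₄ * q ^ N) := by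
    unfold qTheta
    rw [show 1 / (p₄ * q ^ N) = 1 / p₄ / q ^ N by field_simp,
      show q / (1 / p₄ / q ^ N) = q * p₄ * q ^ N by field_simp]
  unfold regProd shiftNorm
  rw [e3, e4, show -(a * q ^ 2 * p₃ ^ 2 / (p₄ * z)) =
      -(q * p₃) * -(a * q * p₃ / z) * -(1 / p₄) by field_simp,
    mul_pow (-(q * p₃) * -(a * q * p₃ / z)), mul_pow (-(q * p₃)),
    show 3 * (N * (N + 1)) = N * (N + 1) + N * (N + 1) + N * (N + 1) by ring,
    pow_add σ, pow_add σ, show a * q * (p₃ / q ^ N) / z = a * q * p₃ / z / q ^ N by field_simp,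
    show a * q * (p₄ * q ^ N) / z = a * q * p₄ / z * q ^ N by field_simp]
  ring

theorem psi8Two_eq (hq0 : q ≠ 0) (hq1 : ‖q‖ < 1) (hσ : σ ^ 2 = q) (ha : a ≠ 0) (hz : z ≠ 0)
    (hzq : ∀ n : ℤ, z * q ^ n ≠ 1) (hazq : ∀ n : ℤ, a / z * q ^ n ≠ 1) {p₁ p₂ : ℂ}
    (h : ‖a * q * (p₁ * p₂)‖ < 1) :
    qTheta q z * qTheta q (a / z) * psi8Two q a z p₁ p₂ = qInf q q ^ 2 * qTheta q a *
      (qInf q (a * q * p₁ / z) * qInf q (q * p₁ * z) *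
        (qInf q (a * q * p₂ / z) * qInf q (q * p₂ * z))) := by
  have hE : a ^ 2 * q * (p₁ * p₂ * (1 / z) * (z / a)) = a * q * (p₁ * p₂) := by field_simp
  have key := psi6_eq (p₁ := p₁) (p₂ := p₂) (p₃ := 1 / z) (p₄ := z / a) hq0 hq1 hσ ha
    (by rw [hE]; exact h)
  rw [qTheta_mul_psi8Two hq0 hq1 hz ha hzq hazq]
  refine mul_left_cancel₀ (qInf_ne_zero_of_norm_lt hq1 h) ?_
  rw [hE, show a * q * p₁ * (z / a) = q * p₁ * z by field_simp,
    show a * q * p₂ * (z / a) = q * p₂ * z by field_simp,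
    show a * q * (1 / z) * (z / a) = q by field_simp,
    show a * q * p₁ * (1 / z) = a * q * p₁ / z by ring,
    show a * q * p₂ * (1 / z) = a * q * p₂ / z by ring, show a * q * p₁ * p₂ = a * q * (p₁ * p₂) by
      ring] at key
  linear_combination key

/-- The limits of the three contributions cancel, by Weierstrass' identity. -/
theorem limit_combination (hq0 : q ≠ 0) (hq1 : ‖q‖ < 1) (hσ : σ ^ 2 = q) (ha : a ≠ 0) (hz : z ≠ 0)
    (hzq : ∀ n : ℤ, z * q ^ n ≠ 1) (hazq : ∀ n : ℤ, a / z * q ^ n ≠ 1) (hlt : ‖a * q / z‖ < 1)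
    {p₁ p₂ p₃ p₄ : ℂ} (h₁ : p₁ ≠ 0) (h₂ : p₂ ≠ 0) (h₃ : p₃ ≠ 0) (h₄ : p₄ ≠ 0)
    (h : a * q * z * (p₁ * p₂ * p₃ * p₄) = 1) (h' : ‖a * q * (p₁ * p₂)‖ < 1)
    (g₁ : qInf q (p₁ * z * q) ≠ 0) (g₂ : qInf q (p₂ * z * q) ≠ 0) :
    qInf q (1 / (p₁ * z)) * qInf q (1 / (p₂ * z)) * qTheta q (1 / (p₄ * z)) *
        (qTheta q (a * p₃ * q) * qTheta q (p₃ * q) * psi8Two q a z p₁ p₂) -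
      coeffW q a z * (qInf q (a * q * p₁ * p₂) * qInf q (a * q * p₃ * p₄) *
        (qTheta q (a * q * p₁ * p₃) * qTheta q (a * q * p₂ * p₃)) *
        (qTheta q (q * p₃) * w5 q a z p₁ p₂)) -
      coeffProd q a z * (qTheta q (1 / p₁) * qInf q (a * q * p₁ / z) *
        (qTheta q (1 / p₂) * qInf q (a * q * p₂ / z)) * (qTheta q (q * p₃) *
        qTheta q (a * q * p₃ / z) * qTheta q (1 / p₄))) = 0 := by
  have hψ := psi8Two_eq hq0 hq1 hσ ha hz hzq hazq h'
  have hw := w5_eq hq0 hq1 hσ ha hz hzq hlt h₁ h₂ h' g₁ g₂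
  have m1 := qInf_one_div_ne_zero hq0 hq1 hz hzq
  have m2 := qTheta_ne_zero hq0 hq1 hz hzq
  have m3 := qTheta_ne_zero hq0 hq1 (div_ne_zero ha hz) hazq
  -- Weierstrass' identity with base z; its hypothesis z²q = bcde is the balancing condition for
  -- these arguments.
  have W := qTheta_weierstrass hq0 hq1 hσ (a := z) (b := 1 / p₁) (c := 1 / p₂) (d := 1 / p₄)
    (e := z / (a * p₃)) hz (one_div_ne_zero h₁) (one_div_ne_zero h₂) (one_div_ne_zero h₄)
    (div_ne_zero hz (mul_ne_zero ha h₃)) (by field_simp; linear_combination h)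
  have t1 : ∀ {p : ℂ}, p ≠ 0 → qTheta q (1 / (p * z)) = qInf q (1 / (p * z)) * qInf q (q * p * z) := by
    intro p hp
    unfold qTheta
    rw [show q / (1 / (p * z)) = q * p * z by field_simp]
  have t2 : ∀ {x y : ℂ}, x ≠ 0 → x * y = q → qTheta q x = qTheta q y := by
    intro x y hx hxy
    rw [← qTheta_div hq0 hx, ← hxy, mul_div_cancel_left₀ _ hx]
  have t3 : qTheta q (1 / p₁ * (1 / p₂) / z) = qInf q (a * q * p₃ * p₄) *
      qInf q (q * z * (p₁ * p₂)) := by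
    unfold qTheta
    rw [show 1 / p₁ * (1 / p₂) / z = a * q * p₃ * p₄ by field_simp; linear_combination -h,
      show q / (a * q * p₃ * p₄) = q * z * (p₁ * p₂) by field_simp; linear_combination -h]
  have e1 : 1 / p₁ * (1 / p₄) / z = a * q * p₂ * p₃ := by field_simp; linear_combination -h
  have e2 : qTheta q (1 / p₁ * (z / (a * p₃)) / z) = qTheta q (a * q * p₁ * p₃) :=
    t2 (by simp [h₁, hz, ha, h₃]) (by field_simp)
  have e3 : qTheta q (z / (a * p₃)) = qTheta q (a * q * p₃ / z) :=
    t2 (by simp [hz, ha, h₃]) (by field_simp)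
  have e4 : qTheta q (z / (a * p₃) / z) = qTheta q (a * p₃ * q) :=
    t2 (by simp [hz, ha, h₃]) (by field_simp)
  rw [t3, e1, e2, e3, e4, show 1 / p₁ / z = 1 / (p₁ * z) by field_simp,
    show 1 / p₂ / z = 1 / (p₂ * z) by field_simp, show 1 / p₄ / z = 1 / (p₄ * z) by field_simp,
    t1 h₁, t1 h₂] at W
  have hψ' : psi8Two q a z p₁ p₂ = coeffProd q a z * z *
      (qInf q (a * q * p₁ / z) * qInf q (q * p₁ * z) *
        (qInf q (a * q * p₂ / z) * qInf q (q * p₂ * z))) := by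
    unfold coeffProd
    refine mul_left_cancel₀ (mul_ne_zero m2 m3) ?_
    rw [hψ]
    field_simp
  have hcW : coeffW q a z * (qInf q q * qInf q (1 / z)) = -(coeffProd q a z * qTheta q z) := by
    unfold coeffW coeffProd
    field_simp
  rw [show a * q * p₁ * p₂ = a * q * (p₁ * p₂) by ring, hψ', mul_comm p₃ q]
  linear_combination (-(coeffProd q a z * (qTheta q (q * p₃) * (qInf q (a * q * p₁ / z) *
    qInf q (a * q * p₂ / z))))) * W - coeffW q a z * (qInf q (a * q * p₃ * p₄) *
    (qTheta q (a * q * p₁ * p₃) * qTheta q (a * q * p₂ * p₃)) * qTheta q (q * p₃)) * hw -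
    (qInf q (q * z * (p₁ * p₂)) * (qInf q (a * q * p₁ / z) * qInf q (a * q * p₂ / z)) *
    qInf q (a * q * p₃ * p₄) * (qTheta q (a * q * p₁ * p₃) * qTheta q (a * q * p₂ * p₃)) *
    qTheta q (q * p₃)) * hcW

/-- Letting N → ∞ in `regDiff_iterate` gives a convergent product times the limit 0 on the right.
The hypothesis `g₃` allows the infinite product on the left to be cancelled. -/
theorem regDiff_eq_zero_of_generic (hq0 : q ≠ 0) (hq1 : ‖q‖ < 1) (hσ : σ ^ 2 = q) (ha : a ≠ 0)
    (hz : z ≠ 0) (hzq : ∀ n : ℤ, z * q ^ n ≠ 1) (hazq : ∀ n : ℤ, a / z * q ^ n ≠ 1)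
    (hlt : ‖a * q / z‖ < 1) {p₁ p₂ p₃ p₄ : ℂ} (h₁ : p₁ ≠ 0) (h₂ : p₂ ≠ 0) (h₃ : p₃ ≠ 0)
    (h₄ : p₄ ≠ 0) (h : a * q * z * (p₁ * p₂ * p₃ * p₄) = 1) (h' : ‖a * q * (p₁ * p₂)‖ < 1)
    (g₁ : qInf q (p₁ * z * q) ≠ 0) (g₂ : qInf q (p₂ * z * q) ≠ 0)
    (g₃ : qInf q (z / (a * p₃)) ≠ 0) : regDiff q a z p₁ p₂ p₃ p₄ = 0 := by
  have hE : a ^ 2 * q ^ 2 * (p₁ * p₂ * p₃ * p₄) = a * q / z := by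
    rw [eq_div_iff hz]; linear_combination a * q * h
  have T := ((tendsto_regPsi_shift hq0 hq1 hσ ha hz h₁ h₂ h₃ h₄ h' (by rw [hE]; exact hlt)).sub
    ((tendsto_regW_shift hq0 hq1 hσ ha hz h₁ h₂ h₃ h₄ h h').const_mul (coeffW q a z))).sub
    ((tendsto_regProd_shift (p₁ := p₁) (p₂ := p₂) hq0 hq1 hσ ha hz h₃ h₄).const_mul
      (coeffProd q a z))
  rw [limit_combination hq0 hq1 hσ ha hz hzq hazq hlt h₁ h₂ h₃ h₄ h h' g₁ g₂] at T
  have R := (tendsto_qFin hq1 (a * q * p₄ / z)).mul T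
  have L := (tendsto_qFin hq1 (z / (a * p₃))).mul_const (regDiff q a z p₁ p₂ p₃ p₄)
  have : qInf q (z / (a * p₃)) * regDiff q a z p₁ p₂ p₃ p₄ = qInf q (a * q * p₄ / z) * 0 := by
    refine tendsto_nhds_unique L (R.congr fun N => ?_)
    rw [regDiff_iterate hq0 hq1 hσ ha hz hzq hazq hlt h₁ h₂ h₃ h₄ h]
    unfold regDiff
    ring
  rw [mul_zero] at this
  exact (mul_eq_zero.1 this).resolve_left g₃

end limit

/-! ### Continuity in the parameters and removal of genericity. -/

section continuity

variable {q σ a z : ℂ} {ι : Type*} {l : Filter ι} {f₁ f₂ f₃ f₄ : ι → ℂ} {p₁ p₂ p₃ p₄ : ℂ}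

theorem tendsto_psi8 (hq0 : q ≠ 0) (hq1 : ‖q‖ < 1) (hσ : σ ^ 2 = q) (ha : a ≠ 0) (hz : z ≠ 0)
    (h : ‖a ^ 2 * q ^ 2 * (p₁ * p₂ * p₃ * p₄)‖ < 1)
    (t₁ : Tendsto f₁ l (𝓝 p₁)) (t₂ : Tendsto f₂ l (𝓝 p₂)) (t₃ : Tendsto f₃ l (𝓝 p₃))
    (t₄ : Tendsto f₄ l (𝓝 p₄)) :
    Tendsto (fun i => psi8 q a z (f₁ i) (f₂ i) (f₃ i) (f₄ i)) l (𝓝 (psi8 q a z p₁ p₂ p₃ p₄)) := by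
  simp only [norm_mul, norm_pow] at h
  obtain ⟨r₁, r₂, r₃, r₄, g₁, g₂, g₃, g₄, h₁, h₂, h₃, h₄, hr⟩ := exists_radii_lt (norm_nonneg p₁)
    (norm_nonneg p₂) (norm_nonneg p₃) (norm_nonneg p₄) h
  obtain ⟨C, hC0, hC⟩ := norm_psi8Term_le hq0 hq1 hσ ha hz g₁ g₂ g₃ g₄
  refine tendsto_tsum_of_dominated_convergence
    ((summable_pow_natAbs (by positivity) hr).mul_left C) (fun n => ?_) ?_
  · have c := fun p => (continuous_pairFn (a := a) hq1 n).tendsto p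
    exact ((((((c p₁).comp t₁).mul ((c p₂).comp t₂)).mul ((c p₃).comp t₃)).mul
      ((c p₄).comp t₄)).const_mul _).mul_const _
  · filter_upwards [t₁.norm.eventually (gt_mem_nhds h₁), t₂.norm.eventually (gt_mem_nhds h₂),
      t₃.norm.eventually (gt_mem_nhds h₃), t₄.norm.eventually (gt_mem_nhds h₄)] with i l₁ l₂ l₃ l₄ n
    exact hC _ _ _ _ l₁.le l₂.le l₃.le l₄.le n

theorem tendsto_one_div_mul (hz : z ≠ 0) (hp : p₁ ≠ 0) (t₁ : Tendsto f₁ l (𝓝 p₁)) :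
    Tendsto (fun i => 1 / (f₁ i * z)) l (𝓝 (1 / (p₁ * z))) :=
  tendsto_const_nhds.div (t₁.mul_const z) (mul_ne_zero hp hz)

theorem tendsto_wPair (hq1 : ‖q‖ < 1) (hz : z ≠ 0) (hp : p₁ ≠ 0) (t₁ : Tendsto f₁ l (𝓝 p₁))
    (k : ℕ) : Tendsto (fun i => wPair q z (f₁ i) k) l (𝓝 (wPair q z p₁ k)) :=
  (((continuous_qFin k).tendsto _).comp (tendsto_one_div_mul hz hp t₁)).mul
    (((continuous_qInf hq1).tendsto _).comp ((t₁.const_mul q).mul_const _))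

theorem tendsto_w7 (hq1 : ‖q‖ < 1) (hz : z ≠ 0) (h₁ : p₁ ≠ 0) (h₂ : p₂ ≠ 0) (h₃ : p₃ ≠ 0)
    (h₄ : p₄ ≠ 0) (t₁ : Tendsto f₁ l (𝓝 p₁)) (t₂ : Tendsto f₂ l (𝓝 p₂))
    (t₃ : Tendsto f₃ l (𝓝 p₃)) (t₄ : Tendsto f₄ l (𝓝 p₄)) :
    Tendsto (fun i => w7 q a z (f₁ i) (f₂ i) (f₃ i) (f₄ i)) l (𝓝 (w7 q a z p₁ p₂ p₃ p₄)) := by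
  obtain ⟨r, hr⟩ : ∃ r, r = ‖1 / (p₁ * z)‖ + ‖1 / (p₂ * z)‖ + ‖1 / (p₃ * z)‖ + ‖1 / (p₄ * z)‖ +
    ‖q * p₁‖ + ‖q * p₂‖ + ‖q * p₃‖ + ‖q * p₄‖ + 1 := ⟨_, rfl⟩
  obtain ⟨C, hC⟩ := norm_w7Term_le (a := a) (z := z) hq1 r
  refine tendsto_tsum_of_dominated_convergence
    ((summable_geometric_of_lt_one (norm_nonneg q) hq1).mul_left C) (fun k => ?_) ?_
  · exact ((((tendsto_wPair hq1 hz h₁ t₁ k).mul (tendsto_wPair hq1 hz h₂ t₂ k)).mul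
      (tendsto_wPair hq1 hz h₃ t₃ k)).mul (tendsto_wPair hq1 hz h₄ t₄ k)).const_mul _
  · have n₁ := norm_nonneg (1 / (p₁ * z)); have n₂ := norm_nonneg (1 / (p₂ * z))
    have n₃ := norm_nonneg (1 / (p₃ * z)); have n₄ := norm_nonneg (1 / (p₄ * z))
    have m₁ := norm_nonneg (q * p₁); have m₂ := norm_nonneg (q * p₂)
    have m₃ := norm_nonneg (q * p₃); have m₄ := norm_nonneg (q * p₄)
    filter_upwards [(tendsto_one_div_mul hz h₁ t₁).norm.eventually
        (gt_mem_nhds (show ‖1 / (p₁ * z)‖ < r by linarith)),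
      (tendsto_one_div_mul hz h₂ t₂).norm.eventually
        (gt_mem_nhds (show ‖1 / (p₂ * z)‖ < r by linarith)),
      (tendsto_one_div_mul hz h₃ t₃).norm.eventually
        (gt_mem_nhds (show ‖1 / (p₃ * z)‖ < r by linarith)),
      (tendsto_one_div_mul hz h₄ t₄).norm.eventually
        (gt_mem_nhds (show ‖1 / (p₄ * z)‖ < r by linarith)),
      (t₁.const_mul q).norm.eventually (gt_mem_nhds (show ‖q * p₁‖ < r by linarith)),
      (t₂.const_mul q).norm.eventually (gt_mem_nhds (show ‖q * p₂‖ < r by linarith)),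
      (t₃.const_mul q).norm.eventually (gt_mem_nhds (show ‖q * p₃‖ < r by linarith)),
      (t₄.const_mul q).norm.eventually (gt_mem_nhds (show ‖q * p₄‖ < r by linarith))]
      with i l₁ l₂ l₃ l₄ l₅ l₆ l₇ l₈ k
    exact hC _ _ _ _ l₁.le l₂.le l₃.le l₄.le l₅.le l₆.le l₇.le l₈.le k

theorem tendsto_qTheta_one_div (hq1 : ‖q‖ < 1) (hp : p₁ ≠ 0)
    (t₁ : Tendsto f₁ l (𝓝 p₁)) :
    Tendsto (fun i => qTheta q (1 / f₁ i)) l (𝓝 (qTheta q (1 / p₁))) := by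
  have c := fun p => (continuous_qInf hq1).tendsto p
  have t : Tendsto (fun i => 1 / f₁ i) l (𝓝 (1 / p₁)) := tendsto_const_nhds.div t₁ hp
  exact ((c _).comp t).mul ((c _).comp (tendsto_const_nhds.div t (one_div_ne_zero hp)))

theorem tendsto_regDiff (hq0 : q ≠ 0) (hq1 : ‖q‖ < 1) (hσ : σ ^ 2 = q) (ha : a ≠ 0) (hz : z ≠ 0)
    (h : ‖a ^ 2 * q ^ 2 * (p₁ * p₂ * p₃ * p₄)‖ < 1) (h₁ : p₁ ≠ 0) (h₂ : p₂ ≠ 0) (h₃ : p₃ ≠ 0)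
    (h₄ : p₄ ≠ 0) (t₁ : Tendsto f₁ l (𝓝 p₁)) (t₂ : Tendsto f₂ l (𝓝 p₂))
    (t₃ : Tendsto f₃ l (𝓝 p₃)) (t₄ : Tendsto f₄ l (𝓝 p₄)) :
    Tendsto (fun i => regDiff q a z (f₁ i) (f₂ i) (f₃ i) (f₄ i)) l
      (𝓝 (regDiff q a z p₁ p₂ p₃ p₄)) := by
  have c := fun p => (continuous_qInf hq1).tendsto p
  have d : ∀ {f : ι → ℂ} {p : ℂ}, p ≠ 0 → Tendsto f l (𝓝 p) →
      Tendsto (fun i => qTheta q (1 / f i) * qInf q (a * q * f i / z)) l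
        (𝓝 (qTheta q (1 / p) * qInf q (a * q * p / z))) := fun hp t =>
    (tendsto_qTheta_one_div hq1 hp t).mul ((c _).comp ((t.const_mul _).div_const _))
  have e : ∀ {f g : ι → ℂ} {p r : ℂ}, Tendsto f l (𝓝 p) → Tendsto g l (𝓝 r) →
      Tendsto (fun i => qInf q (a * q * f i * g i)) l (𝓝 (qInf q (a * q * p * r))) := fun t s =>
    (c _).comp ((t.const_mul _).mul s)
  have b := fun {f : ι → ℂ} {p : ℂ} (hp : p ≠ 0) (t : Tendsto f l (𝓝 p)) =>
    (c _).comp (tendsto_one_div_mul hz hp t)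
  exact (((((b h₁ t₁).mul (b h₂ t₂)).mul (b h₃ t₃)).mul (b h₄ t₄)).mul
      (tendsto_psi8 hq0 hq1 hσ ha hz h t₁ t₂ t₃ t₄)).sub
    (((((((((e t₁ t₂).mul (e t₁ t₃)).mul (e t₁ t₄)).mul (e t₂ t₃)).mul (e t₂ t₄)).mul
      (e t₃ t₄)).mul (tendsto_w7 hq1 hz h₁ h₂ h₃ h₄ t₁ t₂ t₃ t₄)).const_mul _)) |>.sub
    (((((d h₁ t₁).mul (d h₂ t₂)).mul (d h₃ t₃)).mul (d h₄ t₄)).const_mul _)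

/-- The deformation (p₁x, p₂/x, p₃x, p₄/x) keeps p₁p₂ and the balancing condition fixed. It is
generic for all x outside a countable set, and x → 1 recovers the given parameters. -/
theorem regDiff_eq_zero_of_norm_lt (hq0 : q ≠ 0) (hq1 : ‖q‖ < 1) (hσ : σ ^ 2 = q) (ha : a ≠ 0)
    (hz : z ≠ 0) (hzq : ∀ n : ℤ, z * q ^ n ≠ 1) (hazq : ∀ n : ℤ, a / z * q ^ n ≠ 1)
    (hlt : ‖a * q / z‖ < 1) (h₁ : p₁ ≠ 0) (h₂ : p₂ ≠ 0) (h₃ : p₃ ≠ 0)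
    (h₄ : p₄ ≠ 0) (h : a * q * z * (p₁ * p₂ * p₃ * p₄) = 1) (h' : ‖a * q * (p₁ * p₂)‖ < 1) :
    regDiff q a z p₁ p₂ p₃ p₄ = 0 := by
  have hE : a ^ 2 * q ^ 2 * (p₁ * p₂ * p₃ * p₄) = a * q / z := by
    rw [eq_div_iff hz]; linear_combination a * q * h
  -- B holds x = 0 and the zeros in x of the three products required to be nonzero. Being countable,
  -- it has dense complement, so 1 is a limit of generic values.
  obtain ⟨B, hB⟩ : ∃ B : Set ℂ, B = {0} ∪ Set.range (fun n : ℕ => 1 / (p₁ * z * q * q ^ n)) ∪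
    Set.range (fun n : ℕ => p₂ * z * q * q ^ n) ∪ Set.range (fun n : ℕ => z / (a * p₃) * q ^ n) :=
    ⟨_, rfl⟩
  have hBc : B.Countable := by
    rw [hB]
    exact (((Set.countable_singleton _).union (Set.countable_range _)).union
      (Set.countable_range _)).union (Set.countable_range _)
  have hne : (𝓝[Bᶜ] (1 : ℂ)).NeBot :=
    mem_closure_iff_nhdsWithin_neBot.1 ((hBc.dense_compl ℝ) 1)
  have s : Tendsto (fun x : ℂ => x) (𝓝[Bᶜ] 1) (𝓝 1) := tendsto_id.mono_left nhdsWithin_le_nhds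
  have T := tendsto_regDiff (p₁ := p₁) (p₂ := p₂) (p₃ := p₃) (p₄ := p₄) hq0 hq1 hσ ha hz
    (by rw [hE]; exact hlt) h₁ h₂ h₃ h₄
    (by simpa using s.const_mul p₁) (by simpa using (tendsto_const_nhds (x := p₂)).div s one_ne_zero)
    (by simpa using s.const_mul p₃) (by simpa using (tendsto_const_nhds (x := p₄)).div s one_ne_zero)
  refine tendsto_nhds_unique T (tendsto_const_nhds.congr' ?_)
  filter_upwards [self_mem_nhdsWithin] with x hx
  rw [hB] at hx
  simp only [Set.mem_compl_iff, Set.mem_union, Set.mem_singleton_iff, Set.mem_range, not_or,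
    not_exists] at hx
  obtain ⟨⟨⟨hx0, x1⟩, x2⟩, x3⟩ := hx
  have hqn : ∀ n : ℕ, q ^ n ≠ 0 := fun n => pow_ne_zero _ hq0
  refine (regDiff_eq_zero_of_generic hq0 hq1 hσ ha hz hzq hazq hlt (mul_ne_zero h₁ hx0)
    (div_ne_zero h₂ hx0) (mul_ne_zero h₃ hx0) (div_ne_zero h₄ hx0) ?_ ?_ ?_ ?_ ?_).symm
  · rw [← h]; field_simp
  · rwa [show p₁ * x * (p₂ / x) = p₁ * p₂ by field_simp]
  · rw [qInf_ne_zero_iff hq1]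
    intro n hn
    refine x1 n ?_
    have := hqn n
    rw [div_eq_iff (by simp [h₁, hz, hq0, this]), ← hn]
    ring
  · rw [qInf_ne_zero_iff hq1]
    intro n hn
    refine x2 n ?_
    have := hqn n
    field_simp at hn
    exact hn
  · rw [qInf_ne_zero_iff hq1]
    intro n hn
    refine x3 n ?_
    have := hqn n
    field_simp at hn ⊢
    exact hn

theorem regDiff_swap : regDiff q a z p₁ p₂ p₃ p₄ = regDiff q a z p₃ p₄ p₁ p₂ := by
  have e1 : psi8 q a z p₁ p₂ p₃ p₄ = psi8 q a z p₃ p₄ p₁ p₂ := by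
    unfold psi8 psi8Term core
    exact tsum_congr fun n => by ring
  have e2 : w7 q a z p₁ p₂ p₃ p₄ = w7 q a z p₃ p₄ p₁ p₂ := by
    unfold w7 w7Term
    exact tsum_congr fun n => by ring
  unfold regDiff regPsi regW pairProd regProd
  rw [e1, e2, show a * q * p₁ * p₃ = a * q * p₃ * p₁ by ring,
    show a * q * p₁ * p₄ = a * q * p₄ * p₁ by ring, show a * q * p₂ * p₃ = a * q * p₃ * p₂ by ring,
    show a * q * p₂ * p₄ = a * q * p₄ * p₂ by ring]
  ring

/-- The regularized transformation formula. -/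
theorem regDiff_eq_zero (hq0 : q ≠ 0) (hq1 : ‖q‖ < 1) (hσ : σ ^ 2 = q) (ha : a ≠ 0)
    (hz : z ≠ 0) (hzq : ∀ n : ℤ, z * q ^ n ≠ 1) (hazq : ∀ n : ℤ, a / z * q ^ n ≠ 1)
    (hlt : ‖a * q / z‖ < 1) (h₁ : p₁ ≠ 0) (h₂ : p₂ ≠ 0) (h₃ : p₃ ≠ 0)
    (h₄ : p₄ ≠ 0) (h : a * q * z * (p₁ * p₂ * p₃ * p₄) = 1) :
    regDiff q a z p₁ p₂ p₃ p₄ = 0 := by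
  rcases lt_or_ge ‖a * q * (p₁ * p₂)‖ 1 with h' | h'
  · exact regDiff_eq_zero_of_norm_lt hq0 hq1 hσ ha hz hzq hazq hlt h₁ h₂ h₃ h₄ h h'
  · rw [regDiff_swap]
    refine regDiff_eq_zero_of_norm_lt hq0 hq1 hσ ha hz hzq hazq hlt h₃ h₄ h₁ h₂
      (by rw [← h]; ring) ?_
    -- The numbers a q p₁p₂ and a q p₃p₄ multiply to aq/z, of norm below 1, so at least one of them
    -- has norm below 1.
    have hE : a * q * (p₁ * p₂) * (a * q * (p₃ * p₄)) = a * q / z := by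
      rw [eq_div_iff hz]; linear_combination a * q * h
    rw [← hE, norm_mul] at hlt
    by_contra hcon
    nlinarith [not_lt.1 hcon]

end continuity

/-! ### Translation between the original and the regularized terms. -/

section conversion

variable {q σ a z : ℂ}

theorem qPoch_natCast (x : ℂ) (n : ℕ) : qPoch q x n = qFin q x n := rfl

theorem qPoch_mul_qInf (hq0 : q ≠ 0) (hq1 : ‖q‖ < 1) (hσ : σ ^ 2 = q) {x : ℂ} (hx : x ≠ 0)
    (h : qInf q (q / x) ≠ 0) (n : ℤ) :
    qPoch q x n * qInf q (q / x) = (-x) ^ n * σ ^ (n * (n - 1)) * qInf q (1 / x * q ^ (1 - n)) := by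
  have hσ0 : σ ≠ 0 := by rintro rfl; exact hq0 (by rw [← hσ]; simp)
  cases n with
  | ofNat n =>
    rw [Int.ofNat_eq_natCast, qPoch_natCast]
    have hqn : q ^ n ≠ 0 := pow_ne_zero _ hq0
    have key := qInf_div_pow hq0 hq1 hσ (x := q / x) (div_ne_zero hq0 hx) n
    rw [show q / (q / x) = x by field_simp, show q / x / q ^ n = 1 / x * q ^ (1 - (n : ℤ)) by
      rw [zpow_sub₀ hq0, zpow_one, zpow_natCast]; field_simp] at key
    have e : σ ^ (n * (n + 1)) = σ ^ ((n : ℤ) * (n - 1)) * q ^ n := by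
      rw [← hσ, ← pow_mul, ← zpow_natCast, ← zpow_natCast, ← zpow_add₀ hσ0]
      congr 1; push_cast; ring
    rw [e] at key
    have e2 : (-x) ^ n * (-(q / x)) ^ n = q ^ n := by
      rw [← mul_pow]; congr 1; field_simp
    refine mul_right_cancel₀ hqn ?_
    rw [zpow_natCast]
    linear_combination (-(-x) ^ n) * key - qFin q x n * qInf q (q / x) * e2
  | negSucc m =>
    have hfin := qInf_eq_qFin_mul hq1 (q / x) (m + 1)
    have hne : qFin q (q / x) (m + 1) ≠ 0 := left_ne_zero_of_mul (hfin ▸ h)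
    have hprod : (∏ k ∈ Finset.range (m + 1), (1 - x / q ^ (k + 1))) * σ ^ ((m + 1) * (m + 2)) =
        (-x) ^ (m + 1) * qFin q (q / x) (m + 1) := by
      unfold qFin
      rw [← Finset.card_range (m + 1), ← Finset.prod_const, Finset.card_range,
        ← Finset.prod_mul_distrib]
      have : σ ^ ((m + 1) * (m + 2)) = ∏ k ∈ Finset.range (m + 1), q ^ (k + 1) := by
        clear hfin hne
        induction m with
        | zero => simp [hσ]
        | succ m ih =>
          rw [Finset.prod_range_succ, ← ih, ← hσ, ← pow_mul, ← pow_add]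
          ring_nf
      rw [this, ← Finset.prod_mul_distrib]
      refine Finset.prod_congr rfl fun k _ => ?_
      have := pow_ne_zero (k + 1) hq0
      rw [show q / x * q ^ k = q ^ (k + 1) / x by ring]
      field_simp
      ring
    have e1 : σ ^ (Int.negSucc m * (Int.negSucc m - 1)) = σ ^ ((m + 1) * (m + 2)) := by
      rw [← zpow_natCast, Int.negSucc_eq]; congr 1
    have e2 : 1 / x * q ^ (1 - Int.negSucc m) = q / x * q ^ (m + 1) := by
      rw [Int.negSucc_eq, show (1 : ℤ) - -((m : ℤ) + 1) = 1 + ((m + 1 : ℕ) : ℤ) by push_cast; ring,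
        zpow_add₀ hq0, zpow_one, zpow_natCast]
      ring
    have hσn : σ ^ ((m + 1) * (m + 2)) ≠ 0 := pow_ne_zero _ hσ0
    have hxn : (-x) ^ (m + 1) ≠ 0 := pow_ne_zero _ (neg_ne_zero.2 hx)
    rw [show qPoch q x (Int.negSucc m) =
      (∏ k ∈ Finset.range (m + 1), (1 - x / q ^ (k + 1)))⁻¹ from rfl, e1, e2, zpow_negSucc, hfin, eq_div_of_mul_eq hσn hprod]
    field_simp

/-- The inverted form needs only (y; q)_∞ ≠ 0, not the nonvanishing of the shifted product, which
may be 0 for negative n. -/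
theorem inv_qPoch (hq0 : q ≠ 0) (hq1 : ‖q‖ < 1) {y : ℂ} (h : qInf q y ≠ 0) (n : ℤ) :
    (qPoch q y n)⁻¹ = qInf q (y * q ^ n) / qInf q y := by
  cases n with
  | ofNat n =>
    rw [Int.ofNat_eq_natCast, qPoch_natCast, zpow_natCast]
    have key := qInf_eq_qFin_mul hq1 y n
    rw [key] at h ⊢
    have h1 := left_ne_zero_of_mul h
    have h2 := right_ne_zero_of_mul h
    field_simp
  | negSucc m =>
    have key := qInf_eq_qFin_mul hq1 (y * q ^ Int.negSucc m) (m + 1)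
    rw [zpow_negSucc, mul_assoc, inv_mul_cancel₀ (pow_ne_zero _ hq0), mul_one] at key
    rw [zpow_negSucc, key, mul_div_assoc, div_self h, mul_one]
    unfold qPoch qFin
    rw [inv_inv, ← Finset.prod_range_reflect]
    refine Finset.prod_congr rfl fun j hj => ?_
    have hj' : j ≤ m := by simpa [Nat.lt_succ_iff] using hj
    obtain ⟨i, rfl⟩ := Nat.exists_eq_add_of_le hj'
    rw [show j + i + 1 - 1 - j = i by omega, show j + i + 1 = (i + 1) + j by ring, pow_add q (i + 1)]
    have := pow_ne_zero j hq0
    field_simp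

theorem qPoch_div (hq0 : q ≠ 0) (hq1 : ‖q‖ < 1) (hσ : σ ^ 2 = q) {x : ℂ} (hx : x ≠ 0)
    (h : qInf q (q / x) ≠ 0) (h' : qInf q (a * q / x) ≠ 0) (n : ℤ) :
    qPoch q x n / qPoch q (a * q / x) n =
      (-x) ^ n * σ ^ (n * (n - 1)) * pairFn q a (1 / x) n / pairFn q a (1 / x) 0 := by
  have k1 := qPoch_mul_qInf hq0 hq1 hσ hx h n
  have k2 := inv_qPoch hq0 hq1 h' n
  unfold pairFn
  rw [div_eq_mul_inv, k2, eq_div_of_mul_eq h k1, sub_zero, zpow_one, zero_add, zpow_one,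
    show 1 / x * q = q / x by ring, show a * (1 / x) * q = a * q / x by ring,
    show a * (1 / x) * q ^ (n + 1) = a * q / x * q ^ n by rw [zpow_add_one₀ hq0]; ring]
  field_simp

theorem zpow_half_pow_six (hσ : σ ^ 2 = q) (hq0 : q ≠ 0) (n : ℤ) :
    (σ ^ (n * (n - 1))) ^ 6 = q ^ (3 * n ^ 2) * (q ^ (3 * n))⁻¹ := by
  have hσ0 : σ ≠ 0 := by rintro rfl; exact hq0 (by rw [← hσ]; simp)
  rw [← zpow_neg, ← zpow_add₀ hq0, ← hσ, ← zpow_natCast, ← zpow_natCast, ← zpow_mul, ← zpow_mul]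
  congr 1; push_cast; ring

/-- The six reflections and the argument contribute a^{3n}q^{3n²-n} once bcde = aqz is used. The
pair z, a/z turns into the weight by `pairFn_mul_pairFn`, taking away a^n q^{n²-n} and leaving the
prefactor of `core`. -/
theorem vwpTerm_eq_psi8Term (hq0 : q ≠ 0) (hq1 : ‖q‖ < 1) (hσ : σ ^ 2 = q) (ha : a ≠ 0)
    (hz : z ≠ 0) (hzq : ∀ n : ℤ, z * q ^ n ≠ 1) (hazq : ∀ n : ℤ, a / z * q ^ n ≠ 1)
    {b c d e : ℂ} (hb : b ≠ 0) (hc : c ≠ 0) (hd : d ≠ 0) (he : e ≠ 0)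
    (h : b * c * d * e = a * q * z)
    (b₁ : qInf q (q / b) ≠ 0) (c₁ : qInf q (q / c) ≠ 0) (d₁ : qInf q (q / d) ≠ 0)
    (e₁ : qInf q (q / e) ≠ 0) (b₂ : qInf q (a * q / b) ≠ 0) (c₂ : qInf q (a * q / c) ≠ 0)
    (d₂ : qInf q (a * q / d) ≠ 0) (e₂ : qInf q (a * q / e) ≠ 0) (n : ℤ) :
    vwpTerm q a [b, c, d, e, a / z, z] (a * q / z) n =
      (1 - z) * (1 - a / z) / ((1 - a) * (pairFn q a (1 / b) 0 * pairFn q a (1 / c) 0 *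
        pairFn q a (1 / d) 0 * pairFn q a (1 / e) 0)) *
      psi8Term q a z (1 / b) (1 / c) (1 / d) (1 / e) n := by
  have haz : a / z ≠ 0 := div_ne_zero ha hz
  have u1 := qTheta_ne_zero hq0 hq1 hz hzq
  have u2 := qTheta_ne_zero hq0 hq1 haz hazq
  have v1 := right_ne_zero_of_mul u1
  have v2 := right_ne_zero_of_mul u2
  have w1 : qInf q (a * q / (a / z)) ≠ 0 := by
    have := left_ne_zero_of_mul u1
    rw [qInf_step hq1] at this
    rw [show a * q / (a / z) = z * q by field_simp]
    exact right_ne_zero_of_mul this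
  have w2 : qInf q (a * q / z) ≠ 0 := by
    have := left_ne_zero_of_mul u2
    rw [qInf_step hq1, show a / z * q = a * q / z by ring] at this
    exact right_ne_zero_of_mul this
  simp only [vwpTerm, List.map_cons, List.map_nil, List.prod_cons, List.prod_nil, mul_one]
  rw [qPoch_div hq0 hq1 hσ hb b₁ b₂, qPoch_div hq0 hq1 hσ hc c₁ c₂, qPoch_div hq0 hq1 hσ hd d₁ d₂,
    qPoch_div hq0 hq1 hσ he e₁ e₂, qPoch_div hq0 hq1 hσ haz v2 w1, qPoch_div hq0 hq1 hσ hz v1 w2,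
    show 1 / (a / z) = z / a by field_simp]
  have k0 := pairFn_mul_pairFn hq0 hq1 hz ha 0
  have kn := pairFn_mul_pairFn hq0 hq1 hz ha n
  have hsix := zpow_half_pow_six hσ hq0 n
  have d1 : 1 - z * q ^ n ≠ 0 := sub_ne_zero.2 (hzq n).symm
  have d2 : 1 - a / z * q ^ n ≠ 0 := sub_ne_zero.2 (hazq n).symm
  have d3 : 1 - z ≠ 0 := sub_ne_zero.2 (by simpa using (hzq 0).symm)
  have d4 : 1 - a / z ≠ 0 := sub_ne_zero.2 (by simpa using (hazq 0).symm)
  simp only [zpow_zero, ne_eq, OfNat.ofNat_ne_zero, not_false_eq_true, zero_pow, inv_one, one_mul,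
    mul_one] at k0
  have hpow : (-b) ^ n * (-c) ^ n * (-d) ^ n * (-e) ^ n * (-(a / z)) ^ n * (-z) ^ n *
      (a * q / z) ^ n = a ^ (3 * n) * q ^ (2 * n) := by
    rw [← mul_zpow, ← mul_zpow, ← mul_zpow, ← mul_zpow, ← mul_zpow, ← mul_zpow, zpow_mul, zpow_mul,
      ← mul_zpow]
    congr 1
    norm_cast
    field_simp
    linear_combination h
  have hk0 : pairFn q a (1 / z) 0 * pairFn q a (z / a) 0 ≠ 0 := by
    intro h0
    rw [h0, zero_mul] at k0
    exact mul_ne_zero u1 u2 k0.symm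
  unfold psi8Term core psi8Weight
  have hd := mul_ne_zero d1 d2
  have hd0 := mul_ne_zero d3 d4
  have kn' := eq_div_of_mul_eq hd kn
  have k0' := eq_div_of_mul_eq hd0 k0
  have e1 : a ^ (3 * n) = a ^ (2 * n) * a ^ n := by rw [← zpow_add₀ ha]; ring_nf
  have e2 : q ^ (3 * n) = q ^ (2 * n) * q ^ n := by rw [← zpow_add₀ hq0]; ring_nf
  have e3 : q ^ (3 * n ^ 2) = q ^ (2 * n ^ 2) * q ^ n ^ 2 := by rw [← zpow_add₀ hq0]; ring_nf
  have f1 : a ^ n ≠ 0 := zpow_ne_zero _ ha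
  have f2 : q ^ n ≠ 0 := zpow_ne_zero _ hq0
  have f3 : q ^ n ^ 2 ≠ 0 := zpow_ne_zero _ hq0
  have f4 : q ^ (2 * n) ≠ 0 := zpow_ne_zero _ hq0
  have hθ := mul_ne_zero u1 u2
  have hsplit : (a ^ (2 * n) * a ^ n * q ^ (2 * n)) * (q ^ (2 * n ^ 2) * q ^ n ^ 2 *
      (q ^ (2 * n) * q ^ n)⁻¹) * ((pairFn q a (1 / z) n * pairFn q a (z / a) n) /
        (pairFn q a (1 / z) 0 * pairFn q a (z / a) 0)) = a ^ (2 * n) * q ^ (2 * n ^ 2) *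
      (((1 - z) * (1 - a / z)) / ((1 - z * q ^ n) * (1 - a / z * q ^ n))) := by
    rw [kn', k0']
    clear kn k0 kn' k0' hsix hpow hk0 e1 e2 e3
    generalize qTheta q z * qTheta q (a / z) = θ at *
    generalize (1 - z * q ^ n) * (1 - a / z * q ^ n) = w at *
    generalize (1 - z) * (1 - a / z) = w₀ at *
    generalize q ^ n ^ 2 = x₁ at *
    generalize q ^ (2 * n) = x₂ at *
    generalize q ^ n = x₃ at *
    generalize a ^ n = x₄ at *
    field_simp
  rw [e1] at hpow
  rw [e2, e3] at hsix
  rw [← hsix, ← hpow] at hsplit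
  clear kn k0 kn' k0' hsix hpow hk0 e1 e2 e3 hd hd0
  generalize (-b) ^ n = y₁ at *
  generalize (-c) ^ n = y₂ at *
  generalize (-d) ^ n = y₃ at *
  generalize (-e) ^ n = y₄ at *
  generalize (-(a / z)) ^ n = y₅ at *
  generalize (-z) ^ n = y₆ at *
  generalize (a * q / z) ^ n = y₇ at *
  generalize σ ^ (n * (n - 1)) = s at *
  generalize pairFn q a (1 / b) 0 = B₀
  generalize pairFn q a (1 / c) 0 = C₀
  generalize pairFn q a (1 / d) 0 = D₀
  generalize pairFn q a (1 / e) 0 = E₀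
  generalize (1 - z * q ^ n) * (1 - a / z * q ^ n) = w at *
  simp only [div_eq_mul_inv, mul_inv] at hsplit ⊢
  linear_combination ((1 - a * q ^ (2 * n)) * (1 - a)⁻¹ * (pairFn q a (1 * b⁻¹) n *
    pairFn q a (1 * c⁻¹) n * pairFn q a (1 * d⁻¹) n * pairFn q a (1 * e⁻¹) n *
    (B₀⁻¹ * C₀⁻¹ * D₀⁻¹ * E₀⁻¹))) * hsplit

theorem vwpTerm_eq_w7Term (hq0 : q ≠ 0) (hq1 : ‖q‖ < 1) (ha : a ≠ 0) (hz : z ≠ 0)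
    {b c d e : ℂ} (hb : b ≠ 0) (hc : c ≠ 0) (hd : d ≠ 0) (he : e ≠ 0)
    (b₁ : qInf q (q / b) ≠ 0) (c₁ : qInf q (q / c) ≠ 0) (d₁ : qInf q (q / d) ≠ 0)
    (e₁ : qInf q (q / e) ≠ 0) (h : qInf q (a * q / z ^ 2) ≠ 0) (k : ℕ) :
    vwpTerm q (1 / z) [1 / z, b / z, c / z, d / z, e / z, z / a] q k =
      1 / ((1 - 1 / z) * (qInf q q * qInf q (a * q / z ^ 2)) * (qInf q (q / b) * qInf q (q / c) *
        qInf q (q / d) * qInf q (q / e))) *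
      w7Term q a z (1 / b) (1 / c) (1 / d) (1 / e) k := by
  simp only [vwpTerm, List.map_cons, List.map_nil, List.prod_cons, List.prod_nil, mul_one]
  have hq := qInf_self_ne_zero hq1
  have r : ∀ {x : ℂ}, x ≠ 0 → 1 / z * q / (x / z) = q / x := fun hx => by field_simp
  rw [r hb, r hc, r hd, r he, r one_ne_zero, div_one, show 1 / z * q / (z / a) = a * q / z ^ 2 by
    field_simp]
  simp only [div_eq_mul_inv (qPoch _ _ _)]
  rw [inv_qPoch hq0 hq1 b₁, inv_qPoch hq0 hq1 c₁, inv_qPoch hq0 hq1 d₁, inv_qPoch hq0 hq1 e₁,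
    inv_qPoch hq0 hq1 h, inv_qPoch hq0 hq1 hq]
  simp only [qPoch_natCast, zpow_natCast]
  unfold w7Term wBase wPair
  have s : ∀ {x : ℂ}, x ≠ 0 → 1 / (1 / x * z) = x / z := fun hx => by field_simp
  rw [s hb, s hc, s hd, s he]
  simp only [mul_one_div q]
  rw [show q ^ (2 * (k : ℤ)) = q ^ (2 * k) by norm_cast, one_div_mul_eq_div]
  simp only [div_eq_mul_inv, mul_inv]
  ring

end conversion

/-! ### The transformation formula, and the degenerate case z = a. -/

section transformation

variable {q σ a z b c d e : ℂ}

theorem qPoch_one_of_pos {n : ℤ} (hn : 0 < n) : qPoch q 1 n = 0 := by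
  obtain ⟨m, rfl⟩ := Int.eq_ofNat_of_zero_le hn.le
  have hm : 0 < m := by omega
  exact Finset.prod_eq_zero (Finset.mem_range.2 hm) (by simp)

theorem qPoch_self_of_neg (hq0 : q ≠ 0) {n : ℤ} (hn : n < 0) : qPoch q q n = 0 := by
  obtain ⟨m, rfl⟩ := Int.eq_negSucc_of_lt_zero hn
  refine inv_eq_zero.2 (Finset.prod_eq_zero (Finset.mem_range.2 (Nat.succ_pos m)) ?_)
  simp [hq0]

theorem vwpTerm_zero (ha : a ≠ 1) (xs : List ℂ) : vwpTerm q a xs z 0 = 1 := by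
  have h : ∀ x, qPoch q x 0 = 1 := fun x => Finset.prod_range_zero _
  have h1 : 1 - a ≠ 0 := sub_ne_zero.2 ha.symm
  simp [vwpTerm, h, div_self h1]

/-- For n > 0 the parameter a/a = 1 gives (1; q)_n = 0. For n < 0 the lower parameter q has a pole,
so its reciprocal should be 0; the default values agree, the pole being assigned 0 and division by
it giving 0 again. -/
theorem vwpTerm_psi_of_ne_zero (hq0 : q ≠ 0) (ha : a ≠ 0) {n : ℤ} (hn : n ≠ 0) :
    vwpTerm q a [b, c, d, e, a / a, a] z n = 0 := by
  simp only [vwpTerm, List.map_cons, List.map_nil, List.prod_cons, List.prod_nil]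
  rcases lt_or_gt_of_ne hn with h | h
  · rw [show a * q / a = q by field_simp, qPoch_self_of_neg hq0 h]; simp
  · rw [div_self ha, qPoch_one_of_pos h]; simp

theorem vwpTerm_w_of_ne_zero (ha : a ≠ 0) {n : ℕ} (hn : n ≠ 0) (x : ℂ) :
    vwpTerm q x [x, b, c, d, e, a / a] z n = 0 := by
  simp only [vwpTerm, List.map_cons, List.map_nil, List.prod_cons, List.prod_nil]
  rw [div_self ha, qPoch_one_of_pos (n := n) (by omega)]; simp

/-- The transformation formula for `z ≠ a`. -/
theorem vwpPsi_eq (hq0 : q ≠ 0) (hq1 : ‖q‖ < 1) (hσ : σ ^ 2 = q) (ha : a ≠ 0) (hz : z ≠ 0)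
    (ha1 : a ≠ 1) (hzq : ∀ n : ℤ, z * q ^ n ≠ 1) (hazq : ∀ n : ℤ, a / z * q ^ n ≠ 1)
    (hlt : ‖a * q / z‖ < 1) (hb : b ≠ 0) (hc : c ≠ 0) (hd : d ≠ 0) (he : e ≠ 0)
    (h : b * c * d * e = a * q * z)
    (b₁ : qInf q (q / b) ≠ 0) (c₁ : qInf q (q / c) ≠ 0) (d₁ : qInf q (q / d) ≠ 0)
    (e₁ : qInf q (q / e) ≠ 0) (b₂ : qInf q (a * q / b) ≠ 0) (c₂ : qInf q (a * q / c) ≠ 0)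
    (d₂ : qInf q (a * q / d) ≠ 0) (e₂ : qInf q (a * q / e) ≠ 0)
    (b₃ : qInf q (b / z) ≠ 0) (c₃ : qInf q (c / z) ≠ 0) (d₃ : qInf q (d / z) ≠ 0)
    (e₃ : qInf q (e / z) ≠ 0) (h₄ : qInf q (a * q / z ^ 2) ≠ 0) :
    vwpPsi q a [b, c, d, e, a / z, z] (a * q / z) =
        (1 - 1 / z)
          * (qInfs q [q, q, a * q, q / a] / qInfs q [z * q / a, q / z, a * q / z])
          * (Omega q [a * q] [b * c, b * d, b * e, c * d, c * e, d * e, z ^ 2]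
            / (Omega q [a * q] [b, c, d, e] * Omega q [1 / z] [1 / b, 1 / c, 1 / d, 1 / e]))
          * vwpW q (1 / z) [b / z, c / z, d / z, e / z, z / a] q
        + 1 / z
          * (qInfs q [q, q, a * q, q / a, b, c, d, e]
            / qInfs q [q / z, z * q / a, z * q, a * q / z])
          * (Omega q [a * q / z] [b, c, d, e]
            / (Omega q [a * q] [b, c, d, e] * Omega q [1 / z] [1 / b, 1 / c, 1 / d, 1 / e])) := by
  have haz : a / z ≠ 0 := div_ne_zero ha hz
  have main := regDiff_eq_zero hq0 hq1 hσ ha hz hzq hazq hlt (one_div_ne_zero hb)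
    (one_div_ne_zero hc) (one_div_ne_zero hd) (one_div_ne_zero he) (by field_simp; exact h.symm)
  have hψ : vwpPsi q a [b, c, d, e, a / z, z] (a * q / z) = (1 - z) * (1 - a / z) /
      ((1 - a) * (pairFn q a (1 / b) 0 * pairFn q a (1 / c) 0 * pairFn q a (1 / d) 0 *
        pairFn q a (1 / e) 0)) * psi8 q a z (1 / b) (1 / c) (1 / d) (1 / e) := by
    unfold vwpPsi psi8
    rw [← tsum_mul_left]
    exact tsum_congr (vwpTerm_eq_psi8Term hq0 hq1 hσ ha hz hzq hazq hb hc hd he h b₁ c₁ d₁ e₁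
      b₂ c₂ d₂ e₂)
  have hW : vwpW q (1 / z) [b / z, c / z, d / z, e / z, z / a] q = 1 / ((1 - 1 / z) *
      (qInf q q * qInf q (a * q / z ^ 2)) * (qInf q (q / b) * qInf q (q / c) *
        qInf q (q / d) * qInf q (q / e))) * w7 q a z (1 / b) (1 / c) (1 / d) (1 / e) := by
    unfold vwpW w7
    rw [← tsum_mul_left]
    exact tsum_congr (vwpTerm_eq_w7Term hq0 hq1 ha hz hb hc hd he b₁ c₁ d₁ e₁ h₄)
  have hP := qInf_self_ne_zero hq1
  have u1 := qTheta_ne_zero hq0 hq1 hz hzq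
  have u2 := qTheta_ne_zero hq0 hq1 haz hazq
  have u3 := qInf_one_div_ne_zero hq0 hq1 hz hzq
  have d1 : 1 - z ≠ 0 := sub_ne_zero.2 (by simpa using (hzq 0).symm)
  have d2 : 1 - a / z ≠ 0 := sub_ne_zero.2 (by simpa using (hazq 0).symm)
  have d3 : 1 - a ≠ 0 := sub_ne_zero.2 ha1.symm
  have d4 : 1 - 1 / z ≠ 0 := by
    rw [one_sub_div hz]
    exact div_ne_zero (by rw [← neg_sub]; exact neg_ne_zero.2 d1) hz
  have s1 : qTheta q a = (1 - a) * (qInf q (a * q) * qInf q (q / a)) := by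
    unfold qTheta; rw [qInf_step hq1]; ring
  have s2 : qTheta q z = (1 - z) * (qInf q (z * q) * qInf q (q / z)) := by
    unfold qTheta; rw [qInf_step hq1]; ring
  have s3 : qTheta q (a / z) = (1 - a / z) * (qInf q (a * q / z) * qInf q (z * q / a)) := by
    unfold qTheta
    rw [qInf_step hq1, show q / (a / z) = z * q / a by field_simp,
      show a / z * q = a * q / z by ring]
    ring
  have s4 : qInf q (1 / z) = (1 - 1 / z) * qInf q (q / z) := by
    rw [qInf_step hq1, one_div_mul_eq_div]
  have r : ∀ x : ℂ, x ≠ 0 → 1 / (1 / x * z) = x / z := fun x hx => by field_simp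
  have r2 : ∀ x y : ℂ, a * q * (1 / x) * (1 / y) = a * q / (x * y) := fun x y => by
    rw [div_eq_mul_inv _ (x * y), mul_inv]; ring
  have r3 : ∀ x : ℂ, a * q * (1 / x) / z = a * q / z / x := fun x => by ring
  have r4 : ∀ x : ℂ, pairFn q a (1 / x) 0 = qInf q (a * q / x) * qInf q (q / x) := fun x => by
    unfold pairFn
    rw [zero_add, sub_zero, zpow_one, one_div_mul_eq_div, mul_one_div, div_mul_eq_mul_div]
  have r5 : ∀ x : ℂ, 1 / z / (1 / x) = x / z := fun x => by
    simp [div_eq_mul_inv, mul_comm]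
  unfold regDiff regPsi regW pairProd regProd coeffW coeffProd at main
  rw [r b hb, r c hc, r d hd, r e he, s1, s2, s3, s4] at main
  simp only [r2, r3] at main
  have s5 : ∀ x : ℂ, qTheta q (1 / (1 / x)) = qInf q x * qInf q (q / x) := fun x => by
    rw [one_div_one_div]; rfl
  rw [s5, s5, s5, s5] at main
  rw [s2] at u1
  rw [s3] at u2
  rw [s4] at u3
  rw [hψ, hW]
  simp only [r4, qInfs, Omega, List.map_cons, List.map_nil, List.prod_cons, List.prod_nil, mul_one,
    r5]
  have v1 := left_ne_zero_of_mul (right_ne_zero_of_mul u1)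
  have v2 := left_ne_zero_of_mul (right_ne_zero_of_mul u2)
  have v3 := right_ne_zero_of_mul (right_ne_zero_of_mul u2)
  have v4 := right_ne_zero_of_mul u3
  have hzz : 1 - 1 / z = -(1 - z) / z := by field_simp; ring
  rw [hzz] at main ⊢
  clear u1 u2 u3 s1 s2 s3 s4 s5 hψ hW r r2 r3 r4 r5 hzz
  -- The regularized formula is solved for the ₈ψ₈ by dividing by the products (x/z; q)_∞, x = b, c,
  -- d, e. What remains is algebra in independent symbols.
  have hψ : psi8 q a z (1 / b) (1 / c) (1 / d) (1 / e) = _ :=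
    eq_div_of_mul_eq (mul_ne_zero (mul_ne_zero (mul_ne_zero b₃ c₃) d₃) e₃)
      ((mul_comm _ _).trans ((sub_eq_zero.1 (by rw [sub_sub] at main; exact main))))
  rw [hψ]
  clear hψ main
  generalize qInf q (q / b) = B₁ at *
  generalize qInf q (q / c) = C₁ at *
  generalize qInf q (q / d) = D₁ at *
  generalize qInf q (q / e) = E₁ at *
  generalize qInf q (a * q / b) = B₂ at *
  generalize qInf q (a * q / c) = C₂ at *
  generalize qInf q (a * q / d) = D₂ at *
  generalize qInf q (a * q / e) = E₂ at *
  generalize qInf q (b / z) = B₃ at *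
  generalize qInf q (c / z) = C₃ at *
  generalize qInf q (d / z) = D₃ at *
  generalize qInf q (e / z) = E₃ at *
  generalize qInf q (a * q / z ^ 2) = F at *
  generalize qInf q (z * q) = G₁ at *
  generalize qInf q (a * q / z) = G₂ at *
  generalize qInf q (z * q / a) = G₃ at *
  generalize qInf q (q / z) = G₄ at *
  generalize qInf q q = P at *
  generalize 1 - a / z = w₁ at *
  generalize 1 - a = w₂ at *
  generalize 1 - z = w₃ at *
  generalize w7 q a z (1 / b) (1 / c) (1 / d) (1 / e) = W at *
  field_simp

theorem vwpPsi_self (hq0 : q ≠ 0) (ha : a ≠ 0) (ha1 : a ≠ 1) :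
    vwpPsi q a [b, c, d, e, a / a, a] z = 1 := by
  unfold vwpPsi
  rw [tsum_eq_single 0 fun n hn => vwpTerm_psi_of_ne_zero hq0 ha hn, vwpTerm_zero ha1]

theorem vwpW_self (ha : a ≠ 0) {x : ℂ} (hx : x ≠ 1) :
    vwpW q x [b, c, d, e, a / a] z = 1 := by
  unfold vwpW
  rw [tsum_eq_single 0 fun n hn => vwpTerm_w_of_ne_zero ha hn x]
  exact vwpTerm_zero hx _

/-- The right-hand side of the transformation formula for `z = a`, when both series are `1`. -/
theorem products_self (hq0 : q ≠ 0) (hq1 : ‖q‖ < 1) (hσ : σ ^ 2 = q) (ha : a ≠ 0)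
    (hb : b ≠ 0) (hc : c ≠ 0) (hd : d ≠ 0) (he : e ≠ 0) (h : b * c * d * e = a * q * a)
    (b₂ : qInf q (a * q / b) ≠ 0) (c₂ : qInf q (a * q / c) ≠ 0)
    (d₂ : qInf q (a * q / d) ≠ 0) (e₂ : qInf q (a * q / e) ≠ 0)
    (b₃ : qInf q (b / a) ≠ 0) (c₃ : qInf q (c / a) ≠ 0) (d₃ : qInf q (d / a) ≠ 0)
    (e₃ : qInf q (e / a) ≠ 0) (h₁ : qInf q (a * q) ≠ 0) (h₂ : qInf q (q / a) ≠ 0) :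
    1 = (1 - 1 / a)
          * (qInfs q [q, q, a * q, q / a] / qInfs q [a * q / a, q / a, a * q / a])
          * (Omega q [a * q] [b * c, b * d, b * e, c * d, c * e, d * e, a ^ 2]
            / (Omega q [a * q] [b, c, d, e] * Omega q [1 / a] [1 / b, 1 / c, 1 / d, 1 / e]))
          * 1
        + 1 / a
          * (qInfs q [q, q, a * q, q / a, b, c, d, e]
            / qInfs q [q / a, a * q / a, a * q, a * q / a])
          * (Omega q [a * q / a] [b, c, d, e]
            / (Omega q [a * q] [b, c, d, e] * Omega q [1 / a] [1 / b, 1 / c, 1 / d, 1 / e])) := by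
  -- Each theta splits into infinite products; after division by the term in θ(x/a), this identity
  -- is the claimed formula.
  have W := qTheta_weierstrass hq0 hq1 hσ ha hb hc hd he (by linear_combination -h)
  have hP := qInf_self_ne_zero hq1
  have r5 : ∀ x : ℂ, 1 / a / (1 / x) = x / a := fun x => by
    simp [div_eq_mul_inv, mul_comm]
  have s1 : qTheta q a = (1 - a) * (qInf q (a * q) * qInf q (q / a)) := by
    unfold qTheta; rw [qInf_step hq1]; ring
  have s2 : ∀ {x : ℂ}, x ≠ 0 → qTheta q (x / a) = qInf q (x / a) * qInf q (a * q / x) := by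
    intro x hx
    unfold qTheta
    rw [show q / (x / a) = a * q / x by field_simp]
  have s3 : ∀ {x y u v : ℂ}, x ≠ 0 → y ≠ 0 → u ≠ 0 → v ≠ 0 → x * y * (u * v) = a * q * a →
      qTheta q (x * y / a) = qInf q (a * q / (u * v)) * qInf q (a * q / (x * y)) := by
    intro x y u v hx hy hu hv huv
    unfold qTheta
    rw [show q / (x * y / a) = a * q / (x * y) by field_simp,
      show a * q / (u * v) = x * y / a by field_simp; linear_combination -huv]
  have hone : a * q / a = q := by field_simp
  have htwo : a * q / a ^ 2 = q / a := by field_simp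
  have s4 : ∀ x : ℂ, qTheta q x = qInf q x * qInf q (q / x) := fun _ => rfl
  rw [s3 hb hc hd he (by linear_combination h), s3 hb hd hc he (by linear_combination h),
    s3 hb he hc hd (by linear_combination h), s1, s2 hb, s2 hc, s2 hd, s2 he, s4 b, s4 c, s4 d,
    s4 e] at W
  simp only [qInfs, Omega, List.map_cons, List.map_nil, List.prod_cons, List.prod_nil, mul_one, r5,
    hone, htwo]
  clear s1 s2 s3 s4 r5 hone htwo
  generalize qInf q (q / b) = B₁ at *
  generalize qInf q (q / c) = C₁ at *
  generalize qInf q (q / d) = D₁ at *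
  generalize qInf q (q / e) = E₁ at *
  generalize qInf q (a * q / b) = B₂ at *
  generalize qInf q (a * q / c) = C₂ at *
  generalize qInf q (a * q / d) = D₂ at *
  generalize qInf q (a * q / e) = E₂ at *
  generalize qInf q (b / a) = B₃ at *
  generalize qInf q (c / a) = C₃ at *
  generalize qInf q (d / a) = D₃ at *
  generalize qInf q (e / a) = E₃ at *
  generalize qInf q (a * q) = G₁ at *
  generalize qInf q (q / a) = G₄ at *
  generalize qInf q q = P at *
  field_simp
  linear_combination -W

end transformation

end WeierstrassTheta

/-! ### The main theorem. -/

theorem mainTheorem3 (q : ℂ) (hq0 : q ≠ 0) (hq1 : ‖q‖ < 1) :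
    -- the transformation formula, with convergence of both series
    (∀ a b c d e z : ℂ, a ≠ 0 → b ≠ 0 → c ≠ 0 → d ≠ 0 → e ≠ 0 →
      z = b * c * d * e / (a * q) → ‖a * q / z‖ < 1 →
      -- no denominator vanishes: `a ≠ 1`, and `(y; q)_∞ ≠ 0` for each `y` in the list
      a ≠ 1 →
      (∀ y ∈ [q / b, q / c, q / d, q / e,
          a * q / b, a * q / c, a * q / d, a * q / e,
          b / z, c / z, d / z, e / z,
          1 / z, z * q, z * q / a, a * q / z ^ 2], ∀ n : ℕ, y * q ^ n ≠ 1) →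
      Summable (vwpTerm q a [b, c, d, e, a / z, z] (a * q / z)) ∧
      Summable (fun n : ℕ =>
        vwpTerm q (1 / z) [1 / z, b / z, c / z, d / z, e / z, z / a] q n) ∧
      vwpPsi q a [b, c, d, e, a / z, z] (a * q / z) =
        (1 - 1 / z)
          * (qInfs q [q, q, a * q, q / a] / qInfs q [z * q / a, q / z, a * q / z])
          * (Omega q [a * q] [b * c, b * d, b * e, c * d, c * e, d * e, z ^ 2]
            / (Omega q [a * q] [b, c, d, e] * Omega q [1 / z] [1 / b, 1 / c, 1 / d, 1 / e]))
          * vwpW q (1 / z) [b / z, c / z, d / z, e / z, z / a] q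
        + 1 / z
          * (qInfs q [q, q, a * q, q / a, b, c, d, e]
            / qInfs q [q / z, z * q / a, z * q, a * q / z])
          * (Omega q [a * q / z] [b, c, d, e]
            / (Omega q [a * q] [b, c, d, e] * Omega q [1 / z] [1 / b, 1 / c, 1 / d, 1 / e])) ∧
      -- for `z = a` both series reduce to `1`
      (z = a →
        vwpPsi q a [b, c, d, e, a / z, z] (a * q / z) = 1 ∧
        vwpW q (1 / z) [b / z, c / z, d / z, e / z, z / a] q = 1)) ∧
    -- the resulting theta identity
    (∀ a b c d e : ℂ, a ≠ 0 → b ≠ 0 → c ≠ 0 → d ≠ 0 → e ≠ 0 →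
      a ^ 2 * q = b * c * d * e →
      thetas q [b, c, d, e] - thetas q [a, b * c / a, b * d / a, b * e / a]
        = a * thetas q [b / a, c / a, d / a, e / a]) ∧
    -- Weierstrass' theta identity in its usual form
    (∀ x a b c : ℂ, x ≠ 0 → a ≠ 0 → b ≠ 0 → c ≠ 0 →
      thetas q [x * a, x / a, b * c, b / c] - thetas q [x * c, x / c, a * b, b / a]
        = b / a * thetas q [x * b, x / b, a * c, a / c]) := by
  obtain ⟨σ, hσ⟩ := IsAlgClosed.exists_pow_nat_eq q (n := 2) two_pos
  refine ⟨?_, ?_, ?_⟩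
  · intro a b c d e z ha hb hc hd he hzdef hlt ha1 hden
    have haq : a * q ≠ 0 := mul_ne_zero ha hq0
    have hz : z ≠ 0 := by
      rw [hzdef]
      exact div_ne_zero (by simp [hb, hc, hd, he]) haq
    have h : b * c * d * e = a * q * z := by rw [hzdef]; field_simp
    simp only [List.forall_mem_cons, ← qInf_ne_zero_iff hq1] at hden
    obtain ⟨b₁, c₁, d₁, e₁, b₂, c₂, d₂, e₂, b₃, c₃, d₃, e₃, h₁, h₂, h₃, h₄, -⟩ := hden
    have hpos : ∀ n : ℤ, 0 < n → ∃ m : ℕ, n = m + 1 := fun n hn => ⟨(n - 1).toNat, by omega⟩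
    have hneg : ∀ n : ℤ, n ≤ 0 → ∃ m : ℕ, n = -(m : ℤ) := fun n hn => ⟨(-n).toNat, by omega⟩
    have hqn : ∀ n : ℕ, q ^ n ≠ 0 := fun n => pow_ne_zero _ hq0
    -- Positive n are covered by the condition on zq, nonpositive n by the condition on 1/z.
    have hzq : ∀ n : ℤ, z * q ^ n ≠ 1 := by
      intro n hn
      rcases lt_or_ge 0 n with hn0 | hn0
      · obtain ⟨m, rfl⟩ := hpos n hn0
        refine (qInf_ne_zero_iff hq1 _).1 h₂ m ?_
        rw [← hn, zpow_add_one₀ hq0, zpow_natCast]; ring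
      · obtain ⟨m, rfl⟩ := hneg n hn0
        refine (qInf_ne_zero_iff hq1 _).1 h₁ m ?_
        rw [zpow_neg, zpow_natCast, mul_inv_eq_one₀ (hqn m)] at hn
        rw [hn]; have := hqn m; field_simp
    have hW : Summable (fun n : ℕ =>
        vwpTerm q (1 / z) [1 / z, b / z, c / z, d / z, e / z, z / a] q n) := by
      have hfun : (fun n : ℕ => vwpTerm q (1 / z) [1 / z, b / z, c / z, d / z, e / z, z / a] q n) =
          _ := funext (vwpTerm_eq_w7Term hq0 hq1 ha hz hb hc hd he b₁ c₁ d₁ e₁ h₄)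
      rw [hfun]
      exact (summable_w7Term hq1 _ _ _ _).mul_left _
    -- The case z = a must be separated, because the regularized coefficients have θ(a/z) in their
    -- denominators.
    rcases eq_or_ne z a with rfl | hza
    · have hone : 1 / z ≠ 1 := by
        rw [ne_eq, div_eq_one_iff_eq ha]
        exact ha1.symm
      have hψ1 := vwpPsi_self (b := b) (c := c) (d := d) (e := e) (z := z * q / z) hq0 ha ha1
      have hW1 := vwpW_self (q := q) (b := b / z) (c := c / z) (d := d / z) (e := e / z) (z := q)
        ha hone
      have h₅ : qInf q (q / z) ≠ 0 := by
        rw [qInf_step hq1, one_div_mul_eq_div] at h₁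
        exact right_ne_zero_of_mul h₁
      refine ⟨summable_of_ne_finset_zero (s := {0}) fun n hn =>
        vwpTerm_psi_of_ne_zero hq0 ha (by simpa using hn), hW, ?_, fun _ => ⟨hψ1, hW1⟩⟩
      rw [hψ1, hW1]
      exact products_self hq0 hq1 hσ ha hb hc hd he h b₂ c₂ d₂ e₂ b₃ c₃ d₃ e₃ h₂ h₅
    -- Positive n are excluded by ‖aq/z‖ < 1, n = 0 by z ≠ a, and negative n by the condition on
    -- zq/a.
    · have hazq : ∀ n : ℤ, a / z * q ^ n ≠ 1 := by
        intro n hn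
        rcases lt_or_ge 0 n with hn0 | hn0
        · obtain ⟨m, rfl⟩ := hpos n hn0
          refine (qInf_ne_zero_iff hq1 _).1 (qInf_ne_zero_of_norm_lt hq1 hlt) m ?_
          rw [← hn, zpow_add_one₀ hq0, zpow_natCast]; ring
        · obtain ⟨m, rfl⟩ := hneg n hn0
          rw [zpow_neg, zpow_natCast, mul_inv_eq_one₀ (hqn m), div_eq_iff hz] at hn
          cases m with
          | zero => exact hza (by rw [hn]; simp)
          | succ m =>
            refine (qInf_ne_zero_iff hq1 _).1 h₃ m ?_
            rw [div_mul_eq_mul_div, div_eq_one_iff_eq ha, hn]; ring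
      have hE : a ^ 2 * q ^ 2 * (1 / b * (1 / c) * (1 / d) * (1 / e)) = a * q / z := by
        rw [show 1 / b * (1 / c) * (1 / d) * (1 / e) = 1 / (b * c * d * e) by field_simp, h]
        field_simp
      refine ⟨?_, hW, vwpPsi_eq hq0 hq1 hσ ha hz ha1 hzq hazq hlt hb hc hd he h b₁ c₁ d₁ e₁ b₂ c₂
        d₂ e₂ b₃ c₃ d₃ e₃ h₄, fun hcon => absurd hcon hza⟩
      have hfun : vwpTerm q a [b, c, d, e, a / z, z] (a * q / z) = _ :=
        funext (vwpTerm_eq_psi8Term hq0 hq1 hσ ha hz hzq hazq hb hc hd he h b₁ c₁ d₁ e₁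
          b₂ c₂ d₂ e₂)
      rw [hfun]
      exact (summable_psi8Term hq0 hq1 hσ ha hz (by rw [hE]; exact hlt)).mul_left _
  · intro a b c d e ha hb hc hd he h
    have W := qTheta_weierstrass hq0 hq1 hσ ha hb hc hd he h
    simp only [thetas, List.map_cons, List.map_nil, List.prod_cons, List.prod_nil, mul_one]
    have t : ∀ {x : ℂ}, x ≠ 0 → theta q x = qTheta q x := fun hx => theta_eq_qTheta hq0 hq1 hσ hx
    rw [t hb, t hc, t hd, t he, t ha, t (div_ne_zero (mul_ne_zero hb hc) ha),
      t (div_ne_zero (mul_ne_zero hb hd) ha), t (div_ne_zero (mul_ne_zero hb he) ha),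
      t (div_ne_zero hb ha), t (div_ne_zero hc ha), t (div_ne_zero hd ha), t (div_ne_zero he ha)]
    linear_combination W
  · intro x a b c hx ha hb hc
    have W := theta_weierstrass hq0 hq1 hσ hx ha hb hc
    simp only [thetas, List.map_cons, List.map_nil, List.prod_cons, List.prod_nil, mul_one]
    rw [mul_comm a b]
    linear_combination W
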